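/- There are a program $P$ for a random access machine with real-number memory (described below) and a function $T:\mathbb{N}\to\mathbb{N}$ with $T(n)=O(n\log^2 n)$ such that the following holds. Let $\mathcal{T}=(\mathcal{X},E,w)$ be any tree with $n=|\mathcal{X}|$ nodes and edge weights $w\colon E\to\mathbb{R}_{\ge 0}$, let $d_{\mathcal{T}}(x,y)$ be the sum of the edge weights on the unique path between $x$ and $y$, let $\lambda_d,\lambda_c\colon\mathcal{X}\to\mathbb{R}_{\ge 0}$ be arbitrary destruction and creation cost functions, and let $\boldsymbol{a},\boldsymbol{b}\in\mathbb{R}_{\ge 0}^{\mathcal{X}}$ be two measures. Given $n$, a list of the edges (in any order and orientation) with their weights, and the values of $\lambda_d,\lambda_c,\boldsymbol{a},\boldsymbol{b}$, the program $P$ halts after at most $T(n)$ steps and outputs exactly the generalized Kantorovich--Rubinstein (GKR) distance \[ \mathrm{GKR}(\boldsymbol{a},\boldsymbol{b})=\min_{\pi\in\mathcal{U}^-(\boldsymbol{a},\boldsymbol{b})}\ \sum_{x,y\in\mathcal{X}} d_{\mathcal{T}}(x,y)\,\pi_{x,y}+\sum_{x\in\mathcal{X}}\lambda_d(x)\Bigl(\boldsymbol{a}_x-\sum_{y\in\mathcal{X}}\pi_{x,y}\Bigr)+\sum_{y\in\mathcal{X}}\lambda_c(y)\Bigl(\boldsymbol{b}_y-\sum_{x\in\mathcal{X}}\pi_{x,y}\Bigr),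 \] where $\mathcal{U}^-(\boldsymbol{a},\boldsymbol{b})$ is the set of matrices $\pi\in\mathbb{R}_{\ge 0}^{\mathcal{X}\times\mathcal{X}}$ with $\sum_y\pi_{x,y}\le\boldsymbol{a}_x$ for all $x$ and $\sum_x\pi_{x,y}\le\boldsymbol{b}_y$ for all $y$. In the machine model, memory consists of registers and indirectly addressed arrays holding natural numbers or real numbers, and each of the following takes one step: an assignment of an integer constant or of a register, an addition or (truncated) subtraction of natural numbers, an addition, subtraction or multiplication of real numbers, reading or writing an array cell, a comparison of two registers, and a procedure call. -/

import Mathlib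

/-! ## Trees, sub-couplings and the GKR distance on a finite tree metric -/

namespace GKR

open scoped NNReal

/-- A weighted tree: a connected acyclic undirected graph with nonnegative edge weights.
Only the values of `weight` on edges of the graph are ever used. -/
structure WeightedTree (V : Type) where
  graph : SimpleGraph V
  isTree : graph.IsTree
  weight : Sym2 V → ℝ≥0

/-- The unique path between two nodes of a tree. -/
noncomputable def WeightedTree.path {V : Type} (T : WeightedTree V) (u v : V) :
    T.graph.Walk u v :=
  (T.isTree.existsUnique_path u v).choose

/-- The tree metric: the sum of the edge weights on the unique path. -/
noncomputable def WeightedTree.dist {V : Type} (T : WeightedTree V) (u v : V) : ℝ≥0 :=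
  ((T.path u v).edges.map T.weight).sum

/-- Sub-couplings of `a` and `b`: nonnegative matrices whose marginals are dominated by
`a` and `b`. -/
def SubCoupling {V : Type} [Fintype V] (a b : V → ℝ≥0) : Set (V → V → ℝ≥0) :=
  {π | (∀ x, ∑ y, π x y ≤ a x) ∧ (∀ y, ∑ x, π x y ≤ b y)}

/-- The total cost of a transport plan `π`: transport, destruction and creation. -/
noncomputable def planCost {V : Type} [Fintype V] (c : V → V → ℝ≥0) (ld lc a b : V → ℝ≥0)
    (π : V → V → ℝ≥0) : ℝ :=
  (∑ x, ∑ y, (c x y : ℝ) * (π x y : ℝ))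
    + (∑ x, (ld x : ℝ) * ((a x : ℝ) - ∑ y, (π x y : ℝ)))
    + (∑ y, (lc y : ℝ) * ((b y : ℝ) - ∑ x, (π x y : ℝ)))

/-- `r` is the generalized Kantorovich-Rubinstein distance of `a` and `b`: the minimum, over
all sub-couplings, of the total cost. -/
def IsGKRDistance {V : Type} [Fintype V] (c : V → V → ℝ≥0) (ld lc a b : V → ℝ≥0) (r : ℝ) :
    Prop :=
  IsLeast (planCost c ld lc a b '' SubCoupling a b) r

/-- An input of the problem with nodes `0, …, n - 1`: a weighted tree, a destruction cost
function, a creation cost function, and two measures. -/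
structure Problem (n : ℕ) where
  tree : WeightedTree (Fin n)
  destroy : Fin n → ℝ≥0
  create : Fin n → ℝ≥0
  source : Fin n → ℝ≥0
  target : Fin n → ℝ≥0

/-- `r` is the correct output for the input `I`. -/
def Problem.IsSolution {n : ℕ} (I : Problem n) (r : ℝ) : Prop :=
  IsGKRDistance I.tree.dist I.destroy I.create I.source I.target r

/-- A listing of the edges of a graph, each once, in any order and with any orientation.
(A tree with `n` nodes has `n - 1` edges.) -/
structure EdgeList {n : ℕ} (G : SimpleGraph (Fin n)) where
  src : Fin (n - 1) → Fin n
  dst : Fin (n - 1) → Fin n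
  injective : Function.Injective fun i => s(src i, dst i)
  range_eq : Set.range (fun i => s(src i, dst i)) = G.edgeSet

/-! ## A random access machine with real and integer memory -/

/-- A machine state: registers and arrays of natural numbers, registers and arrays of reals.
A program mentions finitely many registers and arrays, by name; the cells of an array are
addressed indirectly, by the content of a natural number register. -/
structure State where
  nreg : ℕ → ℕ
  narr : ℕ → ℕ → ℕ
  rreg : ℕ → ℝ
  rarr : ℕ → ℕ → ℝ

/-- Elementary instructions. Names of registers and arrays are numerals in the program. -/
inductive Instr where
  /-- do nothing -/
  | skip
  /-- `x := c` -/
  | nconst (x : ℕ) (c : ℕ)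
  /-- `x := y` -/
  | nmove (x y : ℕ)
  /-- `x := y + z` -/
  | nadd (x y z : ℕ)
  /-- `x := max (y - z) 0` -/
  | nsub (x y z : ℕ)
  /-- `x := A[i]` -/
  | nload (x A i : ℕ)
  /-- `A[i] := x` -/
  | nstore (A i x : ℕ)
  /-- `x := c` -/
  | rconst (x : ℕ) (c : ℤ)
  /-- `x := y` -/
  | rmove (x y : ℕ)
  /-- `x := y + z` -/
  | radd (x y z : ℕ)
  /-- `x := y - z` -/
  | rsub (x y z : ℕ)
  /-- `x := y * z` -/
  | rmul (x y z : ℕ)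
  /-- `x := A[i]` -/
  | rload (x A i : ℕ)
  /-- `A[i] := x` -/
  | rstore (A i x : ℕ)

/-- Assign to a natural number register. -/
def State.setN (s : State) (x v : ℕ) : State :=
  { s with nreg := Function.update s.nreg x v }

/-- Assign to a real register. -/
def State.setR (s : State) (x : ℕ) (v : ℝ) : State :=
  { s with rreg := Function.update s.rreg x v }

/-- Assign to a cell of an array of natural numbers. -/
def State.setNArr (s : State) (A i v : ℕ) : State :=
  { s with narr := Function.update s.narr A (Function.update (s.narr A) i v) }

/-- Assign to a cell of an array of reals. -/
def State.setRArr (s : State) (A i : ℕ) (v : ℝ) : State :=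
  { s with rarr := Function.update s.rarr A (Function.update (s.rarr A) i v) }

/-- The effect of an elementary instruction. -/
noncomputable def Instr.exec (s : State) : Instr → State
  | .skip => s
  | .nconst x c => s.setN x c
  | .nmove x y => s.setN x (s.nreg y)
  | .nadd x y z => s.setN x (s.nreg y + s.nreg z)
  | .nsub x y z => s.setN x (s.nreg y - s.nreg z)
  | .nload x A i => s.setN x (s.narr A (s.nreg i))
  | .nstore A i x => s.setNArr A (s.nreg i) (s.nreg x)
  | .rconst x c => s.setR x (c : ℝ)
  | .rmove x y => s.setR x (s.rreg y)
  | .radd x y z => s.setR x (s.rreg y + s.rreg z)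
  | .rsub x y z => s.setR x (s.rreg y - s.rreg z)
  | .rmul x y z => s.setR x (s.rreg y * s.rreg z)
  | .rload x A i => s.setR x (s.rarr A (s.nreg i))
  | .rstore A i x => s.setRArr A (s.nreg i) (s.rreg x)

/-- Tests: comparisons of two registers. -/
inductive Test where
  | neq (x y : ℕ)
  | nlt (x y : ℕ)
  | nle (x y : ℕ)
  | rlt (x y : ℕ)
  | rle (x y : ℕ)

/-- The outcome of a test. -/
def Test.Holds (s : State) : Test → Prop
  | .neq x y => s.nreg x = s.nreg y
  | .nlt x y => s.nreg x < s.nreg y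
  | .nle x y => s.nreg x ≤ s.nreg y
  | .rlt x y => s.rreg x < s.rreg y
  | .rle x y => s.rreg x ≤ s.rreg y

/-- Program text. `loop b c` repeats `c` while `b` holds. `call p` runs the body of the
procedure with number `p`; there are no parameters and no local variables. -/
inductive Cmd where
  | instr (i : Instr)
  | seq (c₁ c₂ : Cmd)
  | branch (b : Test) (c₁ c₂ : Cmd)
  | loop (b : Test) (c : Cmd)
  | call (p : ℕ)

/-- `Exec procs s c k t`: started in state `s`, with the procedure table `procs`, the command
`c` halts in state `t` after exactly `k` steps. Each elementary instruction, each evaluation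
of a test, and each procedure call takes one step. -/
inductive Exec (procs : List Cmd) : State → Cmd → ℕ → State → Prop where
  | instr (s : State) (i : Instr) : Exec procs s (.instr i) 1 (i.exec s)
  | seq {s t u : State} {c₁ c₂ : Cmd} {k l : ℕ} :
      Exec procs s c₁ k t → Exec procs t c₂ l u → Exec procs s (.seq c₁ c₂) (k + l) u
  | branch_true {s t : State} {b : Test} {c₁ c₂ : Cmd} {k : ℕ} :
      b.Holds s → Exec procs s c₁ k t → Exec procs s (.branch b c₁ c₂) (k + 1) t
  | branch_false {s t : State} {b : Test} {c₁ c₂ : Cmd} {k : ℕ} :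
      ¬ b.Holds s → Exec procs s c₂ k t → Exec procs s (.branch b c₁ c₂) (k + 1) t
  | loop_true {s t u : State} {b : Test} {c : Cmd} {k l : ℕ} :
      b.Holds s → Exec procs s c k t → Exec procs t (.loop b c) l u →
        Exec procs s (.loop b c) (k + l + 1) u
  | loop_false {s : State} {b : Test} {c : Cmd} :
      ¬ b.Holds s → Exec procs s (.loop b c) 1 s
  | call {s t : State} {p : ℕ} {c : Cmd} {k : ℕ} :
      procs[p]? = some c → Exec procs s c k t → Exec procs s (.call p) (k + 1) t

/-- A program: a finite table of (possibly mutually recursive) procedures and a main command. -/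
structure Program where
  procs : List Cmd
  main : Cmd

/-- `P.HaltsIn s k t`: the program `P` started in `s` halts in `t` after exactly `k` steps. -/
def Program.HaltsIn (P : Program) (s : State) (k : ℕ) (t : State) : Prop :=
  Exec P.procs s P.main k t

/-! ## Input format -/

/-- The array holding a finite list of values, and zeros after it. -/
def toArray {α : Type} [Zero α] {m : ℕ} (f : Fin m → α) (i : ℕ) : α :=
  if h : i < m then f ⟨i, h⟩ else 0

/-- The initial memory. Natural number register `0` holds the number of nodes. The arrays `0`
and `1` of natural numbers hold the two endpoints of each edge. The arrays `0` to `4` of reals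
hold the weight of each edge, and the destruction cost, the creation cost and the mass of the
first and of the second measure at each node. All other cells are zero. -/
noncomputable def Problem.initialState {n : ℕ} (I : Problem n) (e : EdgeList I.tree.graph) :
    State where
  nreg := fun x => if x = 0 then n else 0
  narr := fun A => match A with
    | 0 => toArray fun i => (e.src i : ℕ)
    | 1 => toArray fun i => (e.dst i : ℕ)
    | _ => fun _ => 0
  rreg := fun _ => 0
  rarr := fun A => match A with
    | 0 => toArray fun i => (I.tree.weight s(e.src i, e.dst i) : ℝ)
    | 1 => toArray fun v => (I.destroy v : ℝ)
    | 2 => toArray fun v => (I.create v : ℝ)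
    | 3 => toArray fun v => (I.source v : ℝ)
    | 4 => toArray fun v => (I.target v : ℝ)
    | _ => fun _ => 0

/-- Started on the input `I`, given by the edge list `e`, the program `P` halts within `t`
steps, with the GKR distance in real register `0`. -/
def Program.Solves {n : ℕ} (P : Program) (I : Problem n) (e : EdgeList I.tree.graph) (t : ℕ) :
    Prop :=
  ∃ (k : ℕ) (s : State),
    P.HaltsIn (I.initialState e) k s ∧ k ≤ t ∧ I.IsSolution (s.rreg 0)

end GKR

/-!
The distance is computed by removing the leaves of the tree one after the other. Since the metric
is the path metric, mass may be moved along edges only, so a sub-coupling is a flow: node `v` sends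
out the net amount `x v - B v`, where `B v` is the mass of the second measure at `v`, and `x v` is
the amount of filling, at least cost, of a list of *segments* `(slope, length)`. At the start there
are two segments, `(-λ_d v, a v)` for mass that is not destroyed, and `(λ_c v, b v)` for mass that
is created; the least cost of filling them up to `x` is a convex piecewise linear function of `x`.

Let `u` be a leaf with neighbour `p`, at distance `w`. All mass at `u` may pass through `p`
(`Attains.eliminate`, `Attains.of_eliminate`), so `u` can be removed if the cost function of `p` is
replaced by its infimal convolution with that of `u`, in which the edge is taken into account: cut
the segments of `u`, in the order of their slopes, at position `B u`; subtract `w` from the slopes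
on the left and add `w` to those on the right; add the resulting segments to those of `p`, `B u` to
`B p`, and `w * B u` to the cost. When only one node is left, filling its segments in order up to
its offset solves the problem (`isLeast_greedySum`, `Reduced.isSolution`).

The segments of a node are kept in a balanced search tree (an AA tree) whose nodes store the slopes
as differences to the slope at the parent, and the total lengths of the subtrees. Then the cut with
the two shifts of slopes takes one descent (`runs_shiftBody`), as does an insertion
(`runs_insBody`). Two trees are merged by inserting the segments of the smaller one into the larger
one (`runs_merge`). The trees are immutable: an operation allocates new nodes, so that the frame
condition `Core` of the recursive procedures says only that allocated cells do not change.

For the running time, a tree with `m` segments has the potential `m * log₂ m`. Merging trees with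
`a` and `b` segments raises the sum of the potentials by at least `min a b` (`potential_add`), so
that there are `O(n log n)` insertions, each of which takes time `O(log n)`. The leaves are found
in linear time: the program keeps, for each node, the degree and the sums of the neighbours and of
the edge weights, which are the neighbour and the weight of the edge once the degree is `1`; after
the removal of a leaf it goes on with the neighbour, and otherwise with the next node.

The steps are counted by the predicate `Runs`, with a rule for loops (`runs_loop`) in which the
time is charged to a function of a ghost value.
-/

namespace GKR

open scoped NNReal

variable {procs : List Cmd}

/-! ### Symbolic execution of programs -/

/-- `Runs procs c s Q`: the command `c`, started in `s`, halts after some number `k` of steps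
in some state `t` with `Q k t`. -/
def Runs (procs : List Cmd) (c : Cmd) (s : State) (Q : ℕ → State → Prop) : Prop :=
  ∃ k t, Exec procs s c k t ∧ Q k t

theorem Runs.mono {c : Cmd} {s : State} {P Q : ℕ → State → Prop} (h : Runs procs c s P)
    (hPQ : ∀ k t, P k t → Q k t) : Runs procs c s Q := by
  obtain ⟨k, t, he, hp⟩ := h
  exact ⟨k, t, he, hPQ k t hp⟩

@[simp] theorem runs_instr {i : Instr} {s : State} {Q : ℕ → State → Prop} :
    Runs procs (.instr i) s Q ↔ Q 1 (i.exec s) := by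
  constructor
  · rintro ⟨k, t, he, hq⟩
    cases he
    exact hq
  · exact fun h => ⟨_, _, .instr s i, h⟩

@[simp] theorem runs_seq {c₁ c₂ : Cmd} {s : State} {Q : ℕ → State → Prop} :
    Runs procs (.seq c₁ c₂) s Q ↔
      Runs procs c₁ s fun k t => Runs procs c₂ t fun l u => Q (k + l) u := by
  constructor
  · rintro ⟨k, t, he, hq⟩
    cases he with
    | seq h₁ h₂ => exact ⟨_, _, h₁, _, _, h₂, hq⟩
  · rintro ⟨k, t, h₁, l, u, h₂, hq⟩
    exact ⟨_, _, .seq h₁ h₂, hq⟩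

theorem runs_branch_true {b : Test} {c₁ c₂ : Cmd} {s : State} {Q : ℕ → State → Prop}
    (hb : b.Holds s) (h : Runs procs c₁ s fun k t => Q (k + 1) t) :
    Runs procs (.branch b c₁ c₂) s Q := by
  obtain ⟨k, t, he, hq⟩ := h
  exact ⟨_, _, .branch_true hb he, hq⟩

theorem runs_branch_false {b : Test} {c₁ c₂ : Cmd} {s : State} {Q : ℕ → State → Prop}
    (hb : ¬ b.Holds s) (h : Runs procs c₂ s fun k t => Q (k + 1) t) :
    Runs procs (.branch b c₁ c₂) s Q := by
  obtain ⟨k, t, he, hq⟩ := h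
  exact ⟨_, _, .branch_false hb he, hq⟩

theorem runs_call {p : ℕ} {c : Cmd} {s : State} {Q : ℕ → State → Prop}
    (hp : procs[p]? = some c) (h : Runs procs c s fun k t => Q (k + 1) t) :
    Runs procs (.call p) s Q := by
  obtain ⟨k, t, he, hq⟩ := h
  exact ⟨_, _, .call hp he, hq⟩

/-- The loop rule. The ghost value `a` describes the state; `spent a` bounds the running time
up to the moment described by `a`, and `rank` bounds the number of remaining iterations. -/
theorem runs_loop {α : Type*} {b : Test} {c : Cmd} (I : α → State → Prop) (spent rank : α → ℕ)
    (step : ∀ a s, I a s → b.Holds s → Runs procs c s fun k t =>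
      ∃ a', I a' t ∧ rank a' < rank a ∧ k + 1 + spent a ≤ spent a')
    (a : α) (s : State) (h : I a s) :
    Runs procs (.loop b c) s fun k t =>
      ∃ a', I a' t ∧ ¬ b.Holds t ∧ k + spent a ≤ spent a' + 1 := by
  induction hr : rank a using Nat.strong_induction_on generalizing a s with
  | _ r ih =>
    by_cases hb : b.Holds s
    · obtain ⟨k, t, he, a', ha', hra, hk⟩ := step a s h hb
      obtain ⟨l, u, hl, a'', ha'', hn, hl'⟩ := ih (rank a') (hr ▸ hra) a' t ha' rfl
      exact ⟨_, _, .loop_true hb he hl, a'', ha'', hn, by omega⟩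
    · exact ⟨_, _, .loop_false hb, a, h, hb, by omega⟩

/-- Straight-line code followed by a command. -/
def thenDo : List Instr → Cmd → Cmd
  | [], c => c
  | i :: is, c => .seq (.instr i) (thenDo is c)

@[simp] theorem runs_thenDo_nil {c : Cmd} {s : State} {Q : ℕ → State → Prop} :
    Runs procs (thenDo [] c) s Q ↔ Runs procs c s Q := Iff.rfl

@[simp] theorem runs_thenDo_cons {i : Instr} {is : List Instr} {c : Cmd} {s : State}
    {Q : ℕ → State → Prop} :
    Runs procs (thenDo (i :: is) c) s Q ↔
      Runs procs (thenDo is c) (i.exec s) fun k t => Q (1 + k) t := by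
  simp [thenDo]

section Exec

variable (s : State) (x y A B i j v : ℕ) (r : ℝ)

@[simp] theorem setN_nreg : (s.setN x v).nreg y = if y = x then v else s.nreg y := by
  simp [State.setN, Function.update_apply]
@[simp] theorem setN_setN (w : ℕ) : (s.setN x v).setN x w = s.setN x w := by
  simp [State.setN]
@[simp] theorem setR_setR (q : ℝ) : (s.setR x r).setR x q = s.setR x q := by
  simp [State.setR]
@[simp] theorem setN_narr : (s.setN x v).narr = s.narr := rfl
@[simp] theorem setN_rreg : (s.setN x v).rreg = s.rreg := rfl
@[simp] theorem setN_rarr : (s.setN x v).rarr = s.rarr := rfl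
@[simp] theorem setR_rreg : (s.setR x r).rreg y = if y = x then r else s.rreg y := by
  simp [State.setR, Function.update_apply]
@[simp] theorem setR_narr : (s.setR x r).narr = s.narr := rfl
@[simp] theorem setR_nreg : (s.setR x r).nreg = s.nreg := rfl
@[simp] theorem setR_rarr : (s.setR x r).rarr = s.rarr := rfl
@[simp] theorem setNArr_narr :
    (s.setNArr A i v).narr B j = if B = A ∧ j = i then v else s.narr B j := by
  by_cases h : B = A
  · subst h; simp [State.setNArr, Function.update_apply]
  · simp [State.setNArr, h]
@[simp] theorem setNArr_nreg : (s.setNArr A i v).nreg = s.nreg := rfl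
@[simp] theorem setNArr_rreg : (s.setNArr A i v).rreg = s.rreg := rfl
@[simp] theorem setNArr_rarr : (s.setNArr A i v).rarr = s.rarr := rfl
@[simp] theorem setRArr_rarr :
    (s.setRArr A i r).rarr B j = if B = A ∧ j = i then r else s.rarr B j := by
  by_cases h : B = A
  · subst h; simp [State.setRArr, Function.update_apply]
  · simp [State.setRArr, h]
@[simp] theorem setRArr_nreg : (s.setRArr A i r).nreg = s.nreg := rfl
@[simp] theorem setRArr_rreg : (s.setRArr A i r).rreg = s.rreg := rfl
@[simp] theorem setRArr_narr : (s.setRArr A i r).narr = s.narr := rfl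

end Exec

attribute [simp] Instr.exec Test.Holds

/-! ### Balanced search trees of segments -/

/-- Binary search trees of segments `(slope, length)`, balanced as AA trees. A node stores its
level, the length of its own segment, and for each child the difference between the slope at
the child and the slope at the node. The slope at the root is not stored, so that a tree is
used together with its root slope, and all slopes of a subtree are changed by changing one
number. -/
inductive Tr where
  | nil
  | node (lv : ℕ) (l : Tr) (dl len : ℝ) (r : Tr) (dr : ℝ)

namespace Tr

/-- The segments of a tree whose root has slope `s`, in order. -/
def elems : Tr → ℝ → List (ℝ × ℝ)
  | nil, _ => []
  | node _ l dl len r dr, s => l.elems (s + dl) ++ (s, len) :: r.elems (s + dr)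

/-- The total length of the segments. -/
def total : Tr → ℝ
  | nil => 0
  | node _ l _ len r _ => l.total + len + r.total

/-- The number of segments. -/
def size : Tr → ℕ
  | nil => 0
  | node _ l _ _ r _ => l.size + 1 + r.size

/-- The height of the tree. -/
def depth : Tr → ℕ
  | nil => 0
  | node _ l _ _ r _ => max l.depth r.depth + 1

/-- The level stored at the root; the empty tree has level `0`. -/
def level : Tr → ℕ
  | nil => 0
  | node lv _ _ _ _ _ => lv

/-- The right subtree. -/
def right : Tr → Tr
  | nil => nil
  | node _ _ _ _ r _ => r

@[simp] theorem level_nil : nil.level = 0 := rfl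
@[simp] theorem right_nil : nil.right = nil := rfl

section

variable (lv : ℕ) (l : Tr) (dl len : ℝ) (r : Tr) (dr : ℝ)

@[simp] theorem level_node : (node lv l dl len r dr).level = lv := rfl
@[simp] theorem right_node : (node lv l dl len r dr).right = r := rfl

end

/-- Rotate right if the left child has the level of the root. -/
def skew : Tr → ℝ → Tr × ℝ
  | node lv (node lv' a da len' b db) dl len r dr, s =>
    if lv' = lv then (node lv a da len' (node lv b (db + dl) len r dr) (0 - dl), s + dl)
    else (node lv (node lv' a da len' b db) dl len r dr, s)
  | t, s => (t, s)

/-- Rotate left, and raise the root, if the right child of the right child has the level of the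
root. -/
def split : Tr → ℝ → Tr × ℝ
  | node lv l dl len (node lv' b db len' c dc) dr, s =>
    if c.level = lv then (node (lv + 1) (node lv l dl len b (db + dr)) (0 - dr) len' c dc, s + dr)
    else (node lv l dl len (node lv' b db len' c dc) dr, s)
  | t, s => (t, s)

/-- Restore the balance after an insertion into a child. -/
def bal (t : Tr) (s : ℝ) : Tr × ℝ := split (skew t s).1 (skew t s).2

/-- Insert the segment `(k, m)` into the tree with root slope `s`. -/
noncomputable def ins : Tr → ℝ → ℝ → ℝ → Tr × ℝ
  | nil, _, k, m => (node 1 nil 0 m nil 0, k)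
  | node lv l dl len r dr, s, k, m =>
    if k < s then bal (node lv (l.ins (s + dl) k m).1 ((l.ins (s + dl) k m).2 - s) len r dr) s
    else bal (node lv l dl len (r.ins (s + dr) k m).1 ((r.ins (s + dr) k m).2 - s)) s

/-- Cut the segments at position `b`, measured from the left end, and add `-w` to the slopes on
the left and `w` to the slopes on the right. The segment in which `b` lies is cut in two: the
tree keeps the left part, and the right part is the second component of the result. -/
noncomputable def shift (w : ℝ) : Tr → ℝ → ℝ → (Tr × ℝ) × (ℝ × ℝ)
  | nil, s, _ => ((nil, s), (0, 0))
  | node lv l dl len r dr, s, b =>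
    if b < l.total then
      ((node lv (l.shift w (s + dl) b).1.1 ((l.shift w (s + dl) b).1.2 - (s + w)) len r dr, s + w),
        (l.shift w (s + dl) b).2)
    else if b ≤ l.total + len then
      ((node lv l dl (b - l.total) r (dr + w + w), s - w), (s + w, l.total + len - b))
    else
      ((node lv l dl len (r.shift w (s + dr) (b - (l.total + len))).1.1
        ((r.shift w (s + dr) (b - (l.total + len))).1.2 - (s - w)), s - w),
        (r.shift w (s + dr) (b - (l.total + len))).2)

theorem length_elems (t : Tr) (s : ℝ) : (t.elems s).length = t.size := by
  induction t generalizing s with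
  | nil => rfl
  | node lv l dl len r dr ihl ihr => simp [elems, size, ihl, ihr]; omega

theorem total_eq (t : Tr) (s : ℝ) : t.total = ((t.elems s).map Prod.snd).sum := by
  induction t generalizing s with
  | nil => rfl
  | node lv l dl len r dr ihl ihr =>
    simp [elems, total, ihl (s + dl), ihr (s + dr), add_assoc]

theorem elems_skew (t : Tr) (s : ℝ) : (skew t s).1.elems (skew t s).2 = t.elems s := by
  unfold skew
  split
  · split_ifs
    · simp [elems, add_assoc, add_comm, add_left_comm]
    · rfl
  · rfl

theorem elems_split (t : Tr) (s : ℝ) : (split t s).1.elems (split t s).2 = t.elems s := by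
  unfold split
  split
  · split_ifs
    · simp [elems, add_assoc, add_comm, add_left_comm]
    · rfl
  · rfl

theorem elems_bal (t : Tr) (s : ℝ) : (bal t s).1.elems (bal t s).2 = t.elems s := by
  rw [bal, elems_split, elems_skew]

/-- Insertion into a sorted tree puts the new segment at a place between the smaller and the
larger slopes. -/
theorem elems_ins (t : Tr) (s k m : ℝ) (h : (t.elems s).Pairwise fun a b => a.1 ≤ b.1) :
    ∃ l₁ l₂, t.elems s = l₁ ++ l₂ ∧ (t.ins s k m).1.elems (t.ins s k m).2 = l₁ ++ (k, m) :: l₂ ∧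
      (∀ a ∈ l₁, a.1 ≤ k) ∧ ∀ a ∈ l₂, k ≤ a.1 := by
  induction t generalizing s with
  | nil => exact ⟨[], [], by simp [elems, ins]⟩
  | node lv l dl len r dr ihl ihr =>
    simp only [elems, List.pairwise_append, List.pairwise_cons] at h
    obtain ⟨hl, ⟨hr1, hr⟩, hlr⟩ := h
    by_cases hk : k < s
    · obtain ⟨l₁, l₂, h1, h2, h3, h4⟩ := ihl (s + dl) hl
      refine ⟨l₁, l₂ ++ (s, len) :: r.elems (s + dr), ?_, ?_, h3, ?_⟩
      · simp [elems, h1]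
      · simp [ins, hk, elems_bal, elems, h2]
      · intro a ha
        simp only [List.mem_append, List.mem_cons] at ha
        rcases ha with ha | rfl | ha
        · exact h4 a ha
        · exact hk.le
        · exact hk.le.trans (hr1 a ha)
    · obtain ⟨l₁, l₂, h1, h2, h3, h4⟩ := ihr (s + dr) hr
      refine ⟨l.elems (s + dl) ++ (s, len) :: l₁, l₂, ?_, ?_, ?_, h4⟩
      · simp [elems, h1]
      · simp [ins, hk, elems_bal, elems, h2]
      · intro a ha
        simp only [List.mem_append, List.mem_cons] at ha
        rcases ha with ha | rfl | ha
        · exact (hlr a ha (s, len) (by simp)).trans (not_lt.1 hk)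
        · exact not_lt.1 hk
        · exact h3 a ha

/-- A tree of segments in order of slope, with nonnegative lengths. -/
def Sorted (t : Tr) (s : ℝ) : Prop :=
  ((t.elems s).Pairwise fun a b => a.1 ≤ b.1) ∧ ∀ a ∈ t.elems s, 0 ≤ a.2

theorem perm_ins {t : Tr} {s : ℝ} (k m : ℝ) (h : t.Sorted s) :
    ((t.ins s k m).1.elems (t.ins s k m).2).Perm ((k, m) :: t.elems s) := by
  obtain ⟨l₁, l₂, h1, h2, -, -⟩ := elems_ins t s k m h.1
  rw [h1, h2]
  exact List.perm_middle

theorem Sorted.ins {t : Tr} {s k m : ℝ} (h : t.Sorted s) (hm : 0 ≤ m) :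
    (t.ins s k m).1.Sorted (t.ins s k m).2 := by
  refine ⟨?_, fun a ha => ?_⟩
  · obtain ⟨l₁, l₂, h1, h2, h3, h4⟩ := elems_ins t s k m h.1
    have := h.1
    rw [h1, List.pairwise_append] at this
    rw [h2, List.pairwise_append, List.pairwise_cons]
    refine ⟨this.1, ⟨h4, this.2.1⟩, fun a ha b hb => ?_⟩
    rcases List.mem_cons.1 hb with rfl | hb
    · exact h3 a ha
    · exact this.2.2 a ha b hb
  · rcases List.mem_cons.1 ((perm_ins k m h).mem_iff.1 ha) with rfl | ha
    · exact hm
    · exact h.2 a ha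

theorem size_ins {t : Tr} {s : ℝ} (k m : ℝ) (h : t.Sorted s) :
    (t.ins s k m).1.size = t.size + 1 := by
  rw [← length_elems _ (t.ins s k m).2, (perm_ins k m h).length_eq, List.length_cons,
    length_elems]

/-- What `shift` does to the list of segments. -/
theorem elems_shift (w : ℝ) (t : Tr) (s b : ℝ) (hn : ∀ a ∈ t.elems s, 0 ≤ a.2) (ht : t ≠ nil)
    (hb : 0 ≤ b) (hb' : b ≤ t.total) :
    ∃ l₁ θ p q l₂, t.elems s = l₁ ++ (θ, p + q) :: l₂ ∧ 0 ≤ p ∧ 0 ≤ q ∧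
      (l₁.map Prod.snd).sum + p = b ∧
      (t.shift w s b).1.1.elems (t.shift w s b).1.2 =
        l₁.map (fun a => (a.1 - w, a.2)) ++ (θ - w, p) :: l₂.map (fun a => (a.1 + w, a.2)) ∧
      (t.shift w s b).2 = (θ + w, q) := by
  have key : ∀ (t : Tr) (s : ℝ) (c : ℝ),
      t.elems (s + c) = (t.elems s).map fun a => (a.1 + c, a.2) := by
    intro t
    induction t with
    | nil => intros; rfl
    | node lv l dl len r dr ihl ihr =>
      intro s c
      simp only [elems, List.map_append, List.map_cons, ← ihl, ← ihr]
      simp only [add_right_comm]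
  have key' : ∀ (t : Tr) (s : ℝ) (c : ℝ),
      t.elems (s - c) = (t.elems s).map fun a => (a.1 - c, a.2) := by
    intro t s c
    rw [sub_eq_add_neg, key]
    simp [sub_eq_add_neg]
  induction t generalizing s b with
  | nil => exact absurd rfl ht
  | node lv l dl len r dr ihl ihr =>
    simp only [elems, List.mem_append, List.mem_cons] at hn
    have hlen : 0 ≤ len := hn (s, len) (by simp)
    simp only [total] at hb'
    by_cases h1 : b < l.total
    · have hl : l ≠ nil := by
        rintro rfl
        exact absurd hb (not_le.2 h1)
      obtain ⟨l₁, θ, p, q, l₂, e1, e2, e3, e4, e5, e6⟩ :=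
        ihl (s + dl) b (fun a ha => hn a (.inl ha)) hl hb h1.le
      refine ⟨l₁, θ, p, q, l₂ ++ (s, len) :: r.elems (s + dr), ?_, e2, e3, e4, ?_, ?_⟩
      · simp [elems, e1]
      · simp only [shift, if_pos h1, elems, add_sub_cancel, e5, List.map_append, List.map_cons,
          ← key]
        simp [add_right_comm]
      · simp [shift, h1, e6]
    · by_cases h2 : b ≤ l.total + len
      · refine ⟨l.elems (s + dl), s, b - l.total, l.total + len - b, r.elems (s + dr),
          ?_, ?_, ?_, ?_, ?_, ?_⟩
        · simp [elems]
        · linarith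
        · linarith
        · rw [← total_eq]; ring
        · simp only [shift, if_neg h1, if_pos h2, elems]
          rw [sub_add_eq_add_sub, key', show s - w + (dr + w + w) = s + dr + w by ring, key r]
        · simp [shift, h1, h2]
      · have hr : r ≠ nil := by
          rintro rfl
          simp only [total] at hb'
          linarith
        obtain ⟨l₁, θ, p, q, l₂, e1, e2, e3, e4, e5, e6⟩ :=
          ihr (s + dr) (b - (l.total + len)) (fun a ha => hn a (.inr (.inr ha))) hr
            (by linarith) (by linarith)
        refine ⟨l.elems (s + dl) ++ (s, len) :: l₁, θ, p, q, l₂, ?_, e2, e3, ?_, ?_, ?_⟩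
        · simp [elems, e1]
        · rw [List.map_append, List.sum_append, ← total_eq, List.map_cons, List.sum_cons]
          linarith
        · simp only [shift, if_neg h1, if_neg h2, elems, add_sub_cancel, e5, List.map_append,
            List.map_cons, ← key']
          simp [sub_add_eq_add_sub]
        · simp [shift, h1, h2, e6]

/-! ### Balance -/

/-- The balance condition of AA trees: the left child is one level below its parent; the right
child is one level below, or on the same level, but then its right child is below. -/
def Balanced : Tr → Prop
  | nil => True
  | node lv l _ _ r _ => l.Balanced ∧ r.Balanced ∧ lv = l.level + 1 ∧
      (r.level + 1 = lv ∨ r.level = lv ∧ r.right.level < lv)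

theorem skew_of_ne {lv : ℕ} {l : Tr} (h : l.level ≠ lv) (dl len : ℝ) (r : Tr) (dr s : ℝ) :
    skew (node lv l dl len r dr) s = (node lv l dl len r dr, s) := by
  cases l with
  | nil => rfl
  | node => exact if_neg h

theorem split_of_ne {lv : ℕ} {r : Tr} (h : r.right.level ≠ lv) (l : Tr) (dl len dr s : ℝ) :
    split (node lv l dl len r dr) s = (node lv l dl len r dr, s) := by
  cases r with
  | nil => rfl
  | node => exact if_neg h

theorem Balanced.right_level_le {t : Tr} (h : t.Balanced) : t.right.level ≤ t.level := by
  cases t with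
  | nil => exact le_rfl
  | node => simp only [Balanced, right_node, level_node] at *; omega

/-- An insertion keeps the balance. It raises the level of the root only if the root had a right
child on its own level (or the tree was empty), and then the new root has no such child. -/
theorem balanced_ins (t : Tr) (s k m : ℝ) (h : t.Balanced) :
    (t.ins s k m).1.Balanced ∧ ((t.ins s k m).1.level = t.level ∨
      (t.ins s k m).1.level = t.level + 1 ∧
        (t.ins s k m).1.right.level < (t.ins s k m).1.level ∧
        t.right.level = t.level) := by
  induction t generalizing s with
  | nil => simp [ins, Balanced]
  | node lv l dl len r dr ihl ihr =>
    obtain ⟨hl, hr, h1, h2⟩ := h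
    have hrr : r.right.level ≠ lv := by
      cases r with
      | nil => simp only [right_nil, level_nil] at *; omega
      | node => simp only [Balanced, right_node, level_node] at *; omega
    simp only [ins, level_node, right_node]
    split_ifs with hk
    · have ih := ihl (s + dl) hl
      generalize l.ins (s + dl) k m = l' at ih
      obtain ⟨l', s'⟩ := l'
      dsimp only at ih ⊢
      by_cases hl' : l'.level = lv
      · obtain _ | ⟨lv', a, da, len', b, db⟩ := l'
        · simp only [level_nil] at hl'
          omega
        simp only [level_node, right_node, Balanced] at ih hl'
        subst hl'
        simp only [bal, skew, if_true]
        by_cases hr' : r.level = lv'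
        · simp only [split, hr', if_true, Balanced, level_node, right_node]
          grind
        · rw [split_of_ne (by simpa using hr')]
          simp only [Balanced, level_node, right_node]
          grind
      · rw [bal, skew_of_ne hl', split_of_ne hrr]
        simp only [Balanced, level_node, right_node]
        grind
    · have ih := ihr (s + dr) hr
      generalize r.ins (s + dr) k m = r' at ih
      obtain ⟨r', s'⟩ := r'
      dsimp only at ih ⊢
      rw [bal, skew_of_ne (by omega)]
      by_cases hr' : r'.right.level = lv
      · obtain _ | ⟨lv', b, db, len', c, dc⟩ := r'
        · simp only [right_nil, level_nil] at hr'
          omega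
        simp only [level_node, right_node, Balanced] at ih hr'
        simp only [split, hr', if_true, Balanced, level_node, right_node]
        grind
      · have := ih.1.right_level_le
        rw [split_of_ne hr']
        simp only [Balanced, level_node, right_node]
        grind

theorem Balanced.depth_le {t : Tr} (h : t.Balanced) :
    t.depth ≤ 2 * t.level ∧ (t.right.level < t.level → t.depth + 1 ≤ 2 * t.level) := by
  induction t with
  | nil => simp [depth, level]
  | node lv l dl len r dr ihl ihr =>
    obtain ⟨hl, hr, h1, h2⟩ := h
    have := ihl hl
    have := ihr hr
    simp only [depth, level_node, right_node] at *
    omega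

theorem Balanced.two_pow_level_le {t : Tr} (h : t.Balanced) : 2 ^ t.level ≤ t.size + 1 := by
  induction t with
  | nil => simp [size, level]
  | node lv l dl len r dr ihl ihr =>
    obtain ⟨hl, hr, h1, h2⟩ := h
    have h3 := ihl hl
    have h4 := ihr hr
    have h5 : 2 ^ l.level ≤ 2 ^ r.level := Nat.pow_le_pow_right (by norm_num) (by omega)
    simp only [level_node, size, h1, pow_succ]
    omega

theorem Balanced.depth_le_log {t : Tr} (h : t.Balanced) :
    t.depth ≤ 2 * Nat.log 2 (t.size + 1) := by
  have := Nat.le_log_of_pow_le (by norm_num) h.two_pow_level_le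
  have := h.depth_le.1
  omega

theorem level_shift (w : ℝ) (t : Tr) (s b : ℝ) : (t.shift w s b).1.1.level = t.level := by
  cases t <;> simp only [shift]
  split_ifs <;> rfl

theorem balanced_shift (w : ℝ) (t : Tr) (s b : ℝ) (h : t.Balanced) :
    (t.shift w s b).1.1.Balanced ∧ (t.shift w s b).1.1.right.level = t.right.level := by
  induction t generalizing s b with
  | nil => exact ⟨trivial, rfl⟩
  | node lv l dl len r dr ihl ihr =>
    obtain ⟨hl, hr, h1, h2⟩ := h
    simp only [shift]
    split_ifs
    · simp only [Balanced, right_node, level_shift]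
      exact ⟨⟨(ihl _ _ hl).1, hr, h1, h2⟩, trivial⟩
    · exact ⟨⟨hl, hr, h1, h2⟩, rfl⟩
    · simp only [Balanced, right_node, level_shift, (ihr _ _ hr).2]
      exact ⟨⟨hl, (ihr _ _ hr).1, h1, h2⟩, trivial⟩

theorem size_shift (w : ℝ) (t : Tr) (s b : ℝ) : (t.shift w s b).1.1.size = t.size := by
  induction t generalizing s b with
  | nil => rfl
  | node lv l dl len r dr ihl ihr =>
    simp only [shift]
    split_ifs <;> simp [size, ihl, ihr]

end Tr

/-! ### Trees in the memory of the machine -/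

-- Registers of natural numbers: the number of allocated nodes, the height of the stack, the current
-- tree, the level and the children of a node under construction, and the tree being traversed.
notation "nTop" => 1
notation "nSp" => 2
notation "nTree" => 3
notation "nLv" => 4
notation "nL" => 5
notation "nR" => 6
notation "nVisit" => 10

-- Real registers: the accumulated cost, the slope at the root of the current tree, a segment (or a
-- position in `rKey`), the real data of a node under construction, the weight of an edge, the
-- amount to be filled, and the slope at the root of the tree being traversed. Register `7` of both kinds,
-- and registers `8` and `9`, are temporary.
notation "rAns" => 0
notation "rSlope" => 1
notation "rKey" => 2
notation "rLen" => 3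
notation "rDl" => 4
notation "rSeg" => 5
notation "rDr" => 6
notation "rW" => 10
notation "rPos" => 11
notation "rVisit" => 12

-- Arrays: the data of the nodes of the trees, of natural and of real numbers, and the stack, of
-- which there is one of each kind.
notation "aLv" => 10
notation "aL" => 11
notation "aR" => 12
notation "aDl" => 10
notation "aSeg" => 11
notation "aDr" => 12
notation "aTotal" => 13
notation "aStack" => 14

/-- Cell `i` of array `A` is outside the heap and the stack, or it belongs to an allocated node,
or to the part of the stack in use. -/
def State.Live (s : State) (A i : ℕ) : Prop :=
  A < 10 ∨ A < aStack ∧ i ≤ s.nreg nTop ∨ A = aStack ∧ i < s.nreg nSp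

/-- The state `t` arises from `s` by a computation that allocates nodes and never changes one. -/
structure Core (s t : State) : Prop where
  top : s.nreg nTop ≤ t.nreg nTop
  sp : t.nreg nSp = s.nreg nSp
  narr : ∀ A i, s.Live A i → t.narr A i = s.narr A i
  rarr : ∀ A i, s.Live A i → t.rarr A i = s.rarr A i
  zero : t.nreg 0 = s.nreg 0
  nreg : ∀ x, 11 ≤ x → t.nreg x = s.nreg x

/-- Moreover, only working registers have changed. -/
structure Ext (s t : State) : Prop extends Core s t where
  visit : t.nreg nVisit = s.nreg nVisit
  ans : t.rreg rAns = s.rreg rAns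
  rreg : ∀ x, 10 ≤ x → t.rreg x = s.rreg x

theorem Core.live {s t : State} (h : Core s t) {A i : ℕ} (hl : s.Live A i) : t.Live A i := by
  have := h.top
  have := h.sp
  unfold State.Live at *
  omega

theorem Core.refl (s : State) : Core s s :=
  ⟨le_rfl, rfl, fun _ _ _ => rfl, fun _ _ _ => rfl, rfl, fun _ _ => rfl⟩

theorem Core.trans {s t u : State} (h : Core s t) (h' : Core t u) : Core s u where
  top := h.top.trans h'.top
  sp := h'.sp.trans h.sp
  narr A i hl := (h'.narr A i (h.live hl)).trans (h.narr A i hl)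
  rarr A i hl := (h'.rarr A i (h.live hl)).trans (h.rarr A i hl)
  zero := h'.zero.trans h.zero
  nreg x hx := (h'.nreg x hx).trans (h.nreg x hx)

theorem Ext.refl (s : State) : Ext s s :=
  ⟨.refl s, rfl, rfl, fun _ _ => rfl⟩

theorem Ext.trans {s t u : State} (h : Ext s t) (h' : Ext t u) : Ext s u where
  toCore := h.toCore.trans h'.toCore
  visit := h'.visit.trans h.visit
  ans := h'.ans.trans h.ans
  rreg x hx := (h'.rreg x hx).trans (h.rreg x hx)

/-- The node with index `i` is the root of the tree `T` in memory; the empty tree has index `0`.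
The total length of each subtree is stored as well. -/
def Rep (s : State) : Tr → ℕ → Prop
  | .nil, i => i = 0
  | .node lv l dl len r dr, i =>
    i ≠ 0 ∧ i ≤ s.nreg nTop ∧ s.narr aLv i = lv ∧ s.rarr aDl i = dl ∧ s.rarr aSeg i = len ∧
      s.rarr aDr i = dr ∧ s.rarr aTotal i = l.total + len + r.total ∧
      Rep s l (s.narr aL i) ∧ Rep s r (s.narr aR i)

/-- The contents of the index `0`, which stands for the empty tree. -/
structure Heap (s : State) : Prop where
  level : s.narr aLv 0 = 0
  right : s.narr aR 0 = 0
  total : s.rarr aTotal 0 = 0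

theorem Heap.core {s t : State} (h : Heap s) (e : Core s t) : Heap t where
  level := (e.narr _ _ (by simp [State.Live])).trans h.level
  right := (e.narr _ _ (by simp [State.Live])).trans h.right
  total := (e.rarr _ _ (by simp [State.Live])).trans h.total

theorem Rep.core {s t : State} (e : Core s t) {T : Tr} {i : ℕ} (h : Rep s T i) : Rep t T i := by
  induction T generalizing i with
  | nil => exact h
  | node lv l dl len r dr ihl ihr =>
    obtain ⟨h0, h1, h2, h3, h4, h5, h6, h7, h8⟩ := h
    have hn (A) (h1 : 10 ≤ A) (h2 : A < 14) : s.Live A i := by unfold State.Live; omega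
    refine ⟨h0, h1.trans e.top, ?_, ?_, ?_, ?_, ?_, ?_, ?_⟩
    · rw [e.narr _ _ (hn _ (by norm_num) (by norm_num)), h2]
    · rw [e.rarr _ _ (hn _ (by norm_num) (by norm_num)), h3]
    · rw [e.rarr _ _ (hn _ (by norm_num) (by norm_num)), h4]
    · rw [e.rarr _ _ (hn _ (by norm_num) (by norm_num)), h5]
    · rw [e.rarr _ _ (hn _ (by norm_num) (by norm_num)), h6]
    · rw [e.narr _ _ (hn _ (by norm_num) (by norm_num))]
      exact ihl h7
    · rw [e.narr _ _ (hn _ (by norm_num) (by norm_num))]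
      exact ihr h8

theorem Rep.level {s : State} (hs : Heap s) {T : Tr} {i : ℕ} (h : Rep s T i) :
    s.narr aLv i = T.level := by
  cases T with
  | nil => rw [show i = 0 from h]; exact hs.level
  | node => exact h.2.2.1

theorem Rep.total {s : State} (hs : Heap s) {T : Tr} {i : ℕ} (h : Rep s T i) :
    s.rarr aTotal i = T.total := by
  cases T with
  | nil => rw [show i = 0 from h]; exact hs.total
  | node => exact h.2.2.2.2.2.2.1

theorem Rep.right {s : State} (hs : Heap s) {T : Tr} {i : ℕ} (h : Rep s T i) :
    Rep s T.right (s.narr aR i) := by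
  cases T with
  | nil => rw [show i = 0 from h]; exact hs.right
  | node => exact h.2.2.2.2.2.2.2.2

theorem Rep.le_top {s : State} {T : Tr} {i : ℕ} (h : Rep s T i) : i ≤ s.nreg nTop := by
  cases T with
  | nil => rw [show i = 0 from h]; exact Nat.zero_le _
  | node => exact h.2.1

/-- The working registers hold the data of the nonempty tree `T`. -/
def Fields (s : State) : Tr → Prop
  | .nil => False
  | .node lv l dl len r dr =>
    s.nreg nLv = lv ∧ Rep s l (s.nreg nL) ∧ Rep s r (s.nreg nR) ∧
      s.rreg rDl = dl ∧ s.rreg rSeg = len ∧ s.rreg rDr = dr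

/-- Straight-line code as a command. -/
def block (is : List Instr) : Cmd := thenDo is (.instr .skip)

/-- Allocate a node for the data in the working registers. -/
def mkNode : Cmd := block
  [.nconst 7 1, .nadd nTop nTop 7, .nmove nTree nTop,
   .nstore aLv nTree nLv, .nstore aL nTree nL, .nstore aR nTree nR,
   .rstore aDl nTree rDl, .rstore aSeg nTree rSeg, .rstore aDr nTree rDr,
   .rload 7 aTotal nL, .radd 7 7 rSeg, .rload 8 aTotal nR, .radd 7 7 8, .rstore aTotal nTree 7]

theorem runs_mkNode {s : State} {T : Tr} (hs : Heap s) (hT : Fields s T) :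
    Runs procs mkNode s fun k t => k ≤ 15 ∧ Ext s t ∧ Rep t T (t.nreg nTree) ∧
      (∀ x, x ≠ 1 → x ≠ 3 → x ≠ 7 → t.nreg x = s.nreg x) ∧
      (∀ x, x ≠ 7 → x ≠ 8 → t.rreg x = s.rreg x) := by
  cases T with
  | nil => exact hT.elim
  | node lv l dl len r dr =>
    obtain ⟨h1, h2, h3, h4, h5, h6⟩ := hT
    have hl := h2.le_top
    have hr := h3.le_top
    have hlt := h2.total hs
    have hrt := h3.total hs
    simp only [mkNode, block, runs_thenDo_cons, runs_thenDo_nil, runs_instr, Instr.exec]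
    generalize ht : State.setRArr _ _ _ _ = t
    have e : Ext s t := by
      subst ht
      refine ⟨⟨?_, ?_, fun A i h => ?_, fun A i h => ?_, ?_, fun x h => ?_⟩, ?_, ?_, fun x h => ?_⟩
      all_goals unfold State.Live at *
      all_goals simp
      all_goals grind
    refine ⟨by norm_num, e, ?_, fun x h1 h2 h3 => ?_, fun x h1 h2 => ?_⟩
    · have h2' := h2.core e.toCore
      have h3' := h3.core e.toCore
      have e1 : t.narr 11 (t.nreg 3) = s.nreg 5 := by subst ht; simp
      have e2 : t.narr 12 (t.nreg 3) = s.nreg 6 := by subst ht; simp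
      refine ⟨?_, ?_, ?_, ?_, ?_, ?_, ?_, e1 ▸ h2', e2 ▸ h3'⟩
      all_goals subst ht
      all_goals simp [*]
    · subst ht; simp [*]
    · subst ht; simp [*]

@[simp] theorem core_setN {s t : State} {x v : ℕ} (h2 : 2 < x) (h11 : x < 11) :
    Core s (t.setN x v) ↔ Core s t := by
  have h (y : ℕ) (hy : y ≤ 2 ∨ 11 ≤ y) : (t.setN x v).nreg y = t.nreg y := by
    simp only [setN_nreg, ite_eq_right_iff]
    omega
  have h' (y : ℕ) (hy : 11 ≤ y) := h y (by omega)
  constructor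
  · rintro ⟨h1, h2, h3, h4, h5, h6⟩
    rw [h _ (by norm_num)] at h1 h2 h5
    exact ⟨h1, h2, h3, h4, h5, fun x hx => h' x hx ▸ h6 x hx⟩
  · rintro ⟨h1, h2, h3, h4, h5, h6⟩
    rw [← h _ (by norm_num)] at h1 h2 h5
    exact ⟨h1, h2, h3, h4, h5, fun x hx => (h' x hx).trans (h6 x hx)⟩

@[simp] theorem core_setR {s t : State} {x : ℕ} {v : ℝ} : Core s (t.setR x v) ↔ Core s t :=
  ⟨fun h => ⟨h.1, h.2, h.3, h.4, h.5, h.6⟩, fun h => ⟨h.1, h.2, h.3, h.4, h.5, h.6⟩⟩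

@[simp] theorem ext_setN {s t : State} {x v : ℕ} (h2 : 2 < x) (h10 : x < 10) :
    Ext s (t.setN x v) ↔ Ext s t := by
  have h : (t.setN x v).nreg nVisit = t.nreg nVisit := by
    simp only [setN_nreg, ite_eq_right_iff]
    omega
  constructor
  · rintro ⟨h1, h7, h8, h9⟩
    exact ⟨(core_setN h2 (by omega)).1 h1, h ▸ h7, h8, h9⟩
  · rintro ⟨h1, h7, h8, h9⟩
    exact ⟨(core_setN h2 (by omega)).2 h1, h.trans h7, h8, h9⟩

@[simp] theorem ext_setR {s t : State} {x : ℕ} {v : ℝ} (h1 : 0 < x) (h10 : x < 10) :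
    Ext s (t.setR x v) ↔ Ext s t := by
  have h (y : ℕ) (hy : y = 0 ∨ 10 ≤ y) : (t.setR x v).rreg y = t.rreg y := by
    simp only [setR_rreg, ite_eq_right_iff]
    omega
  have h' (y : ℕ) (hy : 10 ≤ y) := h y (.inr hy)
  constructor
  · rintro ⟨h0, h7, h8, h9⟩
    rw [h _ (by norm_num)] at h8
    exact ⟨core_setR.1 h0, h7, h8, fun x hx => h' x hx ▸ h9 x hx⟩
  · rintro ⟨h0, h7, h8, h9⟩
    rw [← h _ (by norm_num)] at h8
    exact ⟨core_setR.2 h0, h7, h8, fun x hx => (h' x hx).trans (h9 x hx)⟩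

@[simp] theorem rep_setN {s : State} {x v i : ℕ} {T : Tr} (hx : x ≠ nTop) :
    Rep (s.setN x v) T i ↔ Rep s T i := by
  induction T generalizing i with
  | nil => rfl
  | node lv l dl len r dr ihl ihr => simp [Rep, ihl, ihr, hx.symm]

@[simp] theorem rep_setR {s : State} {x i : ℕ} {v : ℝ} {T : Tr} :
    Rep (s.setR x v) T i ↔ Rep s T i := by
  induction T generalizing i with
  | nil => rfl
  | node lv l dl len r dr ihl ihr => simp [Rep, ihl, ihr]

@[simp] theorem heap_setN {s : State} {x v : ℕ} : Heap (s.setN x v) ↔ Heap s :=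
  ⟨fun h => ⟨h.1, h.2, h.3⟩, fun h => ⟨h.1, h.2, h.3⟩⟩

@[simp] theorem heap_setR {s : State} {x : ℕ} {v : ℝ} : Heap (s.setR x v) ↔ Heap s :=
  ⟨fun h => ⟨h.1, h.2, h.3⟩, fun h => ⟨h.1, h.2, h.3⟩⟩

attribute [simp] Ext.refl Core.refl

/-- Rotate right if the left child has the level of the root. -/
def skewCmd : Cmd :=
  thenDo [.nload 7 aLv nL] <| .branch (.neq 7 nLv)
    (thenDo [.nmove 8 nL, .nload nL aR 8, .rmove 9 rDl, .rload 7 aDr 8, .radd rDl 7 9] <|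
      .seq mkNode <| block
        [.rload rSeg aSeg 8, .rload rDl aDl 8, .nload nL aL 8, .nmove nR nTree,
         .radd rSlope rSlope 9, .rconst rDr 0, .rsub rDr rDr 9])
    (.instr .skip)

theorem runs_skewCmd {s : State} {T : Tr} (hs : Heap s) (hT : Fields s T) (h0 : T.level ≠ 0) :
    Runs procs skewCmd s fun k t => k ≤ 31 ∧ Ext s t ∧ Fields t (T.skew (s.rreg rSlope)).1 ∧
      t.rreg rSlope = (T.skew (s.rreg rSlope)).2 := by
  cases T with
  | nil => exact hT.elim
  | node lv l dl len r dr =>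
    obtain ⟨h1, h2, h3, h4, h5, h6⟩ := hT
    have hlv := h2.level hs
    simp only [Tr.level_node] at h0
    simp only [skewCmd, runs_thenDo_cons, runs_thenDo_nil, Instr.exec]
    by_cases hl : l.level = lv
    · cases l with
      | nil => exact absurd hl.symm h0
      | node lv' a da len' b db =>
        have h2' := h2
        obtain ⟨-, -, h22, h23, h24, h25, h26, h27, h28⟩ := h2'
        apply runs_branch_true
        · simpa [h1, hlv] using hl
        simp
        refine (runs_mkNode (T := .node lv b (db + dl) len r dr) (by simpa using hs)
          (by simp [Fields, *])).mono ?_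
        rintro k t ⟨hk, e, hr, hn, hv⟩
        have et : Ext s t := Ext.trans (by simp) e
        obtain ⟨-, -, h22, h23, h24, h25, h26, h27, h28⟩ := h2.core et.toCore
        have e1 := hn 8
        have e2 := hn 4
        have e3 := hv 9
        have e4 := hv 1
        simp at e1 e2 e3 e4
        simp only [Tr.level_node] at hl
        clear hn hv e
        simp [block, Tr.skew, Fields, *]
        omega
    · apply runs_branch_false
      · simpa [h1, hlv] using hl
      · rw [Tr.skew_of_ne hl]
        simp [Fields, *]

/-! ### Insertion, shifting and traversal -/

/-- Rotate left, and raise the root, if the right child of the right child has the level of the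
root. -/
def splitCmd : Cmd :=
  thenDo [.nload 7 aR nR, .nload 7 aLv 7] <| .branch (.neq 7 nLv)
    (thenDo [.nmove 8 nR, .nload nR aL 8, .rmove 9 rDr, .rload 7 aDl 8, .radd rDr 7 9] <|
      .seq mkNode <| block
        [.rload rSeg aSeg 8, .rload rDr aDr 8, .nload nR aR 8, .nmove nL nTree,
         .radd rSlope rSlope 9, .rconst rDl 0, .rsub rDl rDl 9, .nconst 7 1, .nadd nLv nLv 7])
    (.instr .skip)

theorem runs_splitCmd {s : State} {T : Tr} (hs : Heap s) (hT : Fields s T) (h0 : T.level ≠ 0) :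
    Runs procs splitCmd s fun k t => k ≤ 34 ∧ Ext s t ∧ Fields t (T.split (s.rreg rSlope)).1 ∧
      t.rreg rSlope = (T.split (s.rreg rSlope)).2 := by
  cases T with
  | nil => exact hT.elim
  | node lv l dl len r dr =>
    obtain ⟨h1, h2, h3, h4, h5, h6⟩ := hT
    have hlv := (h3.right hs).level hs
    simp only [Tr.level_node] at h0
    simp only [splitCmd, runs_thenDo_cons, runs_thenDo_nil, Instr.exec]
    by_cases hl : r.right.level = lv
    · cases r with
      | nil => exact absurd hl.symm h0
      | node lv' b db len' c dc =>
        have h3' := h3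
        obtain ⟨-, -, h22, h23, h24, h25, h26, h27, h28⟩ := h3'
        simp only [Tr.right_node] at hl hlv
        apply runs_branch_true
        · simpa [h1, hlv] using hl
        simp
        refine (runs_mkNode (T := .node lv l dl len b (db + dr)) (by simpa using hs)
          (by simp [Fields, *])).mono ?_
        rintro k t ⟨hk, e, hr, hn, hv⟩
        have et : Ext s t := Ext.trans (by simp) e
        obtain ⟨-, -, h22, h23, h24, h25, h26, h27, h28⟩ := h3.core et.toCore
        have e1 := hn 8
        have e2 := hn 4
        have e3 := hv 9
        have e4 := hv 1
        simp at e1 e2 e3 e4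
        clear hn hv e
        simp [block, Tr.split, Fields, *]
        omega
    · apply runs_branch_false
      · simpa [h1, hlv] using hl
      · rw [Tr.split_of_ne hl]
        simp [Fields, *]

/-- Allocate a node for the data in the working registers, after restoring the balance. -/
def balCmd : Cmd := .seq skewCmd (.seq splitCmd mkNode)

theorem runs_balCmd {s : State} {T : Tr} (hs : Heap s) (hT : Fields s T) (h0 : T.level ≠ 0) :
    Runs procs balCmd s fun k t => k ≤ 80 ∧ Ext s t ∧
      Rep t (T.bal (s.rreg rSlope)).1 (t.nreg nTree) ∧
      t.rreg rSlope = (T.bal (s.rreg rSlope)).2 := by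
  have h0' : (T.skew (s.rreg rSlope)).1.level ≠ 0 := by
    unfold Tr.skew
    split
    · split_ifs <;> exact h0
    · exact h0
  simp only [balCmd, runs_seq]
  refine (runs_skewCmd hs hT h0).mono ?_
  rintro k t ⟨hk, e, hF, hS⟩
  refine (runs_splitCmd (hs.core e.toCore) hF h0').mono ?_
  rintro k' t' ⟨hk', e', hF', hS'⟩
  refine (runs_mkNode (hs.core (e.trans e').toCore) hF').mono ?_
  rintro k'' t'' ⟨hk'', e'', hR, -, hv⟩
  rw [hS] at hR hS'
  refine ⟨by omega, e.trans (e'.trans e''), hR, ?_⟩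
  rw [hv _ (by norm_num) (by norm_num), hS']
  rfl

/-- Push the current tree and its slope. -/
def push : List Instr :=
  [.nstore aStack nSp nTree, .rstore aStack nSp rSlope, .nconst 7 1, .nadd nSp nSp 7]

/-- Pop a tree and its slope into temporary registers. -/
def pop : List Instr :=
  [.nconst 7 1, .nsub nSp nSp 7, .nload 8 aStack nSp, .rload 7 aStack nSp]

/-- Load the data of a node into the working registers. -/
def loadFields : List Instr :=
  [.nload nLv aLv 8, .nload nL aL 8, .nload nR aR 8, .rload rDl aDl 8, .rload rSeg aSeg 8,
   .rload rDr aDr 8]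

@[simp] theorem rep_setNArr_stack {s : State} {i j v : ℕ} {T : Tr} :
    Rep (s.setNArr aStack j v) T i ↔ Rep s T i := by
  induction T generalizing i with
  | nil => rfl
  | node lv l dl len r dr ihl ihr => simp [Rep, ihl, ihr]

@[simp] theorem rep_setRArr_stack {s : State} {i j : ℕ} {v : ℝ} {T : Tr} :
    Rep (s.setRArr aStack j v) T i ↔ Rep s T i := by
  induction T generalizing i with
  | nil => rfl
  | node lv l dl len r dr ihl ihr => simp [Rep, ihl, ihr]

@[simp] theorem heap_setNArr_stack {s : State} {j v : ℕ} :
    Heap (s.setNArr aStack j v) ↔ Heap s := by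
  constructor <;> rintro ⟨h1, h2, h3⟩ <;> constructor <;> simpa using by assumption

@[simp] theorem heap_setRArr_stack {s : State} {j : ℕ} {v : ℝ} :
    Heap (s.setRArr aStack j v) ↔ Heap s := by
  constructor <;> rintro ⟨h1, h2, h3⟩ <;> constructor <;> simpa using by assumption

/-- The state after pushing `i` and `r`. -/
def State.pushed (s : State) (i : ℕ) (r : ℝ) : State :=
  (((s.setNArr aStack (s.nreg nSp) i).setRArr aStack (s.nreg nSp) r).setN 7 1).setN nSp
    (s.nreg nSp + 1)

theorem Core.pop {s t : State} {i : ℕ} {r : ℝ} (e : Core (s.pushed i r) t) :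
    Core s (t.setN nSp (s.nreg nSp)) ∧ t.nreg nSp = s.nreg nSp + 1 ∧
      t.narr aStack (s.nreg nSp) = i ∧ t.rarr aStack (s.nreg nSp) = r := by
  have hl : ∀ A j, s.Live A j → (s.pushed i r).Live A j := by
    intro A j h
    simp [State.pushed, State.Live] at h ⊢
    omega
  have hn : ∀ A j, s.Live A j → ¬ (A = aStack ∧ j = s.nreg nSp) := by
    intro A j h
    unfold State.Live at h
    omega
  have hsp : (s.pushed i r).Live aStack (s.nreg nSp) := by simp [State.pushed, State.Live]
  obtain ⟨h1, h2, h3, h4, h5, h6⟩ := e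
  refine ⟨⟨?_, ?_, fun A j h => ?_, fun A j h => ?_, ?_, fun x h => ?_⟩, ?_, ?_, ?_⟩
  · simpa [State.pushed] using h1
  · simp
  · simp [h3 _ _ (hl A j h), State.pushed, hn A j h]
  · simp [h4 _ _ (hl A j h), State.pushed, hn A j h]
  · simp [h5, State.pushed]
  · have h2 : x ≠ 2 := by omega
    have h7 : x ≠ 7 := by omega
    simp [h6 x h, State.pushed, h2, h7]
  · simp [h2, State.pushed]
  · simp [h3 _ _ hsp, State.pushed]
  · simp [h4 _ _ hsp, State.pushed]

theorem Ext.pop {s t : State} {i : ℕ} {r : ℝ} (e : Ext (s.pushed i r) t) :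
    Ext s (t.setN nSp (s.nreg nSp)) := by
  obtain ⟨h1, h2, h3, h4⟩ := e
  refine ⟨h1.pop.1, ?_, ?_, fun x h => ?_⟩
  · simp [h2, State.pushed]
  · simp [h3, State.pushed]
  · simp [h4 x h, State.pushed]

theorem pop_comm (s : State) (u v : ℕ) :
    (s.setN 7 u).setN nSp v = (s.setN nSp v).setN 7 u := by
  simp [State.setN, Function.update_comm]

/-- The recursive procedure number `0`: insert the segment with slope `rKey` and length `rLen`
into the tree `nTree` with root slope `rSlope`. -/
def insBody : Cmd :=
  thenDo [.nconst 7 0] <| .branch (.neq nTree 7)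
    (thenDo [.nconst nLv 1, .nmove nL 7, .nmove nR 7, .rconst rDl 0, .rconst rDr 0,
      .rmove rSeg rLen, .rmove rSlope rKey] mkNode)
    (.branch (.rlt rKey rSlope)
      (thenDo push <| thenDo [.rload 7 aDl nTree, .radd rSlope rSlope 7, .nload nTree aL nTree] <|
        .seq (.call 0) <| thenDo pop <| thenDo loadFields <|
          thenDo [.nmove nL nTree, .rsub rDl rSlope 7, .rmove rSlope 7] balCmd)
      (thenDo push <| thenDo [.rload 7 aDr nTree, .radd rSlope rSlope 7, .nload nTree aR nTree] <|
        .seq (.call 0) <| thenDo pop <| thenDo loadFields <|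
          thenDo [.nmove nR nTree, .rsub rDr rSlope 7, .rmove rSlope 7] balCmd))

theorem runs_insBody (hp : procs[0]? = some insBody) (T : Tr) (hb : T.Balanced) (s : State)
    (hs : Heap s) (hT : Rep s T (s.nreg nTree)) :
    Runs procs insBody s fun k t => k ≤ 110 * (T.depth + 1) ∧ Ext s t ∧
      Rep t (T.ins (s.rreg rSlope) (s.rreg rKey) (s.rreg rLen)).1 (t.nreg nTree) ∧
      t.rreg rSlope = (T.ins (s.rreg rSlope) (s.rreg rKey) (s.rreg rLen)).2 := by
  induction T generalizing s with
  | nil =>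
    have h0 : s.nreg 3 = 0 := hT
    simp only [insBody, runs_thenDo_cons, runs_thenDo_nil]
    apply runs_branch_true
    · simp [h0]
    simp
    refine (runs_mkNode (T := .node 1 .nil 0 (s.rreg 3) .nil 0) (by simpa using hs)
      (by simp [Fields, Rep])).mono ?_
    rintro k t ⟨hk, e, hR, -, hv⟩
    have et : Ext s t := Ext.trans (by simp) e
    refine ⟨by simp [Tr.depth]; omega, et, hR, ?_⟩
    rw [hv _ (by norm_num) (by norm_num)]
    simp [Tr.ins]
  | node lv l dl len r dr ihl ihr =>
    obtain ⟨hbl, hbr, hlv, -⟩ := hb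
    have hT' := hT
    obtain ⟨h20, -, h22, h23, h24, h25, -, h27, h28⟩ := hT
    simp only [insBody, runs_thenDo_cons, runs_thenDo_nil]
    apply runs_branch_false
    · simpa using h20
    by_cases hk : s.rreg 2 < s.rreg 1
    · apply runs_branch_true
      · simpa using hk
      simp [push]
      apply runs_call hp
      refine (ihl hbl _ (by simpa using hs) (by simpa using h27)).mono ?_
      rintro k t ⟨hk', e, hR, hS⟩
      have e1 : Ext ((s.setN 7 0).pushed (s.nreg 3) (s.rreg 1)) t :=
        Ext.trans (by simp [State.pushed]) e
      obtain ⟨-, a1, a2, a3⟩ := e1.toCore.pop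
      have e2 : Ext s (t.setN 2 (s.nreg 2)) := Ext.trans (by simp) e1.pop
      have hT := hT'.core e2.toCore
      have hs' := hs.core e2.toCore
      simp [h23] at a1 a2 a3 hR hS hT hs'
      obtain ⟨-, -, h22, h23, h24, h25, -, h27, h28⟩ := hT
      simp [pop, loadFields, a1, a2, a3]
      refine (runs_balCmd
        (T := .node lv (l.ins (s.rreg 1 + dl) (s.rreg 2) (s.rreg 3)).1
          ((l.ins (s.rreg 1 + dl) (s.rreg 2) (s.rreg 3)).2 - s.rreg 1) len r dr)
        (by simpa using hs') (by simp [Fields, *]) (by simp [hlv])).mono ?_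
      rintro k' t' ⟨hk'', e', hR', hS'⟩
      simp at hR' hS'
      refine ⟨by simp only [Tr.depth]; omega, e2.trans (Ext.trans (by simp [pop_comm]) e'), ?_, ?_⟩
      · simpa [Tr.ins, hk] using hR'
      · simpa [Tr.ins, hk] using hS'
    · apply runs_branch_false
      · simpa using hk
      simp [push]
      apply runs_call hp
      refine (ihr hbr _ (by simpa using hs) (by simpa using h28)).mono ?_
      rintro k t ⟨hk', e, hR, hS⟩
      have e1 : Ext ((s.setN 7 0).pushed (s.nreg 3) (s.rreg 1)) t :=
        Ext.trans (by simp [State.pushed]) e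
      obtain ⟨-, a1, a2, a3⟩ := e1.toCore.pop
      have e2 : Ext s (t.setN 2 (s.nreg 2)) := Ext.trans (by simp) e1.pop
      have hT := hT'.core e2.toCore
      have hs' := hs.core e2.toCore
      simp [h25] at a1 a2 a3 hR hS hT hs'
      obtain ⟨-, -, h22, h23, h24, h25, -, h27, h28⟩ := hT
      simp [pop, loadFields, a1, a2, a3]
      refine (runs_balCmd
        (T := .node lv l dl len (r.ins (s.rreg 1 + dr) (s.rreg 2) (s.rreg 3)).1
          ((r.ins (s.rreg 1 + dr) (s.rreg 2) (s.rreg 3)).2 - s.rreg 1))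
        (by simpa using hs') (by simp [Fields, *]) (by simp [hlv])).mono ?_
      rintro k' t' ⟨hk'', e', hR', hS'⟩
      simp at hR' hS'
      refine ⟨by simp only [Tr.depth]; omega, e2.trans (Ext.trans (by simp [pop_comm]) e'), ?_, ?_⟩
      · simpa [Tr.ins, hk] using hR'
      · simpa [Tr.ins, hk] using hS'

/-- The recursive procedure number `1`: apply `Tr.shift rW` at position `rKey` to the tree `nTree`
with root slope `rSlope`. The right part of the segment that is cut is returned in `rKey`
and `rLen`. -/
def shiftBody : Cmd :=
  thenDo [.nconst 7 0] <| .branch (.neq nTree 7)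
    (block [.rconst rKey 0, .rconst rLen 0]) <|
  thenDo [.nload 7 aL nTree, .rload 7 aTotal 7] <| .branch (.rlt rKey 7)
    (thenDo push <| thenDo [.rload 8 aDl nTree, .radd rSlope rSlope 8, .nload nTree aL nTree] <|
      .seq (.call 1) <| thenDo pop <| thenDo loadFields <|
        thenDo [.nmove nL nTree, .radd 7 7 rW, .rsub rDl rSlope 7, .rmove rSlope 7] mkNode) <|
  thenDo [.rload 8 aSeg nTree, .radd 8 7 8] <| .branch (.rle rKey 8)
    (thenDo [.nmove 8 nTree] <| thenDo loadFields <|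
      thenDo [.rsub rSeg rKey 7, .rsub rLen 8 rKey, .radd rKey rSlope rW, .rsub rSlope rSlope rW,
        .radd rDr rDr rW, .radd rDr rDr rW] mkNode)
    (thenDo push <| thenDo [.rsub rKey rKey 8, .rload 8 aDr nTree, .radd rSlope rSlope 8,
        .nload nTree aR nTree] <|
      .seq (.call 1) <| thenDo pop <| thenDo loadFields <|
        thenDo [.nmove nR nTree, .rsub 7 7 rW, .rsub rDr rSlope 7, .rmove rSlope 7] mkNode)

theorem runs_shiftBody (hp : procs[1]? = some shiftBody) (T : Tr) (s : State)
    (hs : Heap s) (hT : Rep s T (s.nreg nTree)) :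
    Runs procs shiftBody s fun k t => k ≤ 50 * (T.depth + 1) ∧ Ext s t ∧
      Rep t (T.shift (s.rreg rW) (s.rreg rSlope) (s.rreg rKey)).1.1 (t.nreg nTree) ∧
      t.rreg rSlope = (T.shift (s.rreg rW) (s.rreg rSlope) (s.rreg rKey)).1.2 ∧
      (t.rreg rKey, t.rreg rLen) = (T.shift (s.rreg rW) (s.rreg rSlope) (s.rreg rKey)).2 := by
  induction T generalizing s with
  | nil =>
    have h0 : s.nreg 3 = 0 := hT
    simp only [shiftBody, runs_thenDo_cons, runs_thenDo_nil]
    apply runs_branch_true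
    · simp [h0]
    simp [block, Tr.shift, Rep, Tr.depth, h0]
  | node lv l dl len r dr ihl ihr =>
    have hT' := hT
    obtain ⟨h20, -, h22, h23, h24, h25, -, h27, h28⟩ := hT
    have hlt := h27.total hs
    simp only [shiftBody, runs_thenDo_cons, runs_thenDo_nil]
    apply runs_branch_false
    · simpa using h20
    simp only [runs_thenDo_cons, runs_thenDo_nil]
    by_cases hk : s.rreg 2 < l.total
    · apply runs_branch_true
      · simpa [hlt] using hk
      simp [push]
      apply runs_call hp
      refine (ihl _ (by simpa using hs) (by simpa using h27)).mono ?_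
      rintro k t ⟨hk', e, hR, hS, hL⟩
      have e1 : Ext (((s.setN 7 (s.narr 11 (s.nreg 3))).setR 7 l.total).pushed (s.nreg 3)
          (s.rreg 1)) t := Ext.trans (by simp [State.pushed, hlt]) e
      obtain ⟨-, a1, a2, a3⟩ := e1.toCore.pop
      have a4 := e1.rreg 10 le_rfl
      have e2 : Ext s (t.setN 2 (s.nreg 2)) := Ext.trans (by simp) e1.pop
      have hT := hT'.core e2.toCore
      have hs' := hs.core e2.toCore
      simp [h23, State.pushed] at a1 a2 a3 a4 hR hS hT hs' hL
      obtain ⟨-, -, h22, h23, h24, h25, -, h27, h28⟩ := hT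
      simp [pop, loadFields, a1, a2, a3]
      refine (runs_mkNode
        (T := .node lv (l.shift (s.rreg 10) (s.rreg 1 + dl) (s.rreg 2)).1.1
          ((l.shift (s.rreg 10) (s.rreg 1 + dl) (s.rreg 2)).1.2 - (s.rreg 1 + s.rreg 10)) len r dr)
        (by simpa using hs') (by simp [Fields, *])).mono ?_
      rintro k' t' ⟨hk'', e', hR', -, hv⟩
      refine ⟨by simp only [Tr.depth]; omega, e2.trans (Ext.trans (by simp [pop_comm]) e'), ?_,
        ?_, ?_⟩
      · simpa [Tr.shift, hk] using hR'
      · simp [Tr.shift, hk, hv, a4]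
      · simp [Tr.shift, hk, hv, hL]
    apply runs_branch_false
    · simpa [hlt] using hk
    simp only [runs_thenDo_cons, runs_thenDo_nil]
    by_cases hk2 : s.rreg 2 ≤ l.total + len
    · apply runs_branch_true
      · simpa [hlt, h24] using hk2
      simp [loadFields]
      refine (runs_mkNode
        (T := .node lv l dl (s.rreg 2 - l.total) r (dr + s.rreg 10 + s.rreg 10))
        (by simpa using hs) (by simp [Fields, *])).mono ?_
      rintro k' t' ⟨hk'', e', hR', -, hv⟩
      refine ⟨by omega, Ext.trans (by simp) e', ?_, ?_, ?_⟩
      · simpa [Tr.shift, hk, hk2] using hR'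
      · simp [Tr.shift, hk, hk2, hv]
      · simp [Tr.shift, hk, hk2, hv, hlt, h24]
    · apply runs_branch_false
      · simpa [hlt, h24] using hk2
      simp [push]
      apply runs_call hp
      refine (ihr _ (by simpa using hs) (by simpa using h28)).mono ?_
      rintro k t ⟨hk', e, hR, hS, hL⟩
      have e1 : Ext ((((s.setN 7 (s.narr 11 (s.nreg 3))).setR 7 l.total).setR 8
          (l.total + len)).pushed (s.nreg 3) (s.rreg 1)) t :=
        Ext.trans (by simp [State.pushed, hlt, h24]) e
      obtain ⟨-, a1, a2, a3⟩ := e1.toCore.pop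
      have a4 := e1.rreg 10 le_rfl
      have e2 : Ext s (t.setN 2 (s.nreg 2)) := Ext.trans (by simp) e1.pop
      have hT := hT'.core e2.toCore
      have hs' := hs.core e2.toCore
      simp [h25, h24, hlt, State.pushed] at a1 a2 a3 a4 hR hS hT hs' hL
      obtain ⟨-, -, h22, h23, h24, h25, -, h27, h28⟩ := hT
      simp [pop, loadFields, a1, a2, a3]
      refine (runs_mkNode
        (T := .node lv l dl len
          (r.shift (s.rreg 10) (s.rreg 1 + dr) (s.rreg 2 - (l.total + len))).1.1
          ((r.shift (s.rreg 10) (s.rreg 1 + dr) (s.rreg 2 - (l.total + len))).1.2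
            - (s.rreg 1 - s.rreg 10)))
        (by simpa using hs') (by simp [Fields, *])).mono ?_
      rintro k' t' ⟨hk'', e', hR', -, hv⟩
      refine ⟨by simp only [Tr.depth]; omega, e2.trans (Ext.trans (by simp [pop_comm]) e'), ?_,
        ?_, ?_⟩
      · simpa [Tr.shift, hk, hk2] using hR'
      · simp [Tr.shift, hk, hk2, hv, a4]
      · simp [Tr.shift, hk, hk2, hv, hL]

/-- A recursive procedure that runs `visit` on the nodes of the tree `nVisit` with root slope
`rVisit`, in order; `self` is its number. -/
def travBody (self : ℕ) (visit : Cmd) : Cmd :=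
  thenDo [.nconst 7 0] <| .branch (.neq nVisit 7) (.instr .skip) <|
  thenDo [.nstore aStack nSp nVisit, .rstore aStack nSp rVisit, .nconst 7 1, .nadd nSp nSp 7,
    .rload 7 aDl nVisit, .radd rVisit rVisit 7, .nload nVisit aL nVisit] <|
  .seq (.call self) <|
  thenDo [.nconst 7 1, .nsub nSp nSp 7, .nload nVisit aStack nSp, .rload rVisit aStack nSp] <|
  .seq visit <|
  thenDo [.rload 7 aDr nVisit, .radd rVisit rVisit 7, .nload nVisit aR nVisit] <|
  .call self

/-- The traversal of a tree. The invariant `J L` holds after the visits to the segments in the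
list `L`; it must not depend on the registers and the stack used by the traversal. -/
theorem runs_travBody {self : ℕ} {visit : Cmd} (hp : procs[self]? = some (travBody self visit))
    (all : List (ℝ × ℝ)) (J : List (ℝ × ℝ) → State → Prop) (K : ℕ)
    (hJ : ∀ L s t, J L s → (∀ x, x ≠ nSp → x ≠ 7 → x ≠ nVisit → t.nreg x = s.nreg x) →
      (∀ x, x ≠ 7 → x ≠ rVisit → t.rreg x = s.rreg x) →
      (∀ A i, A ≠ aStack → t.narr A i = s.narr A i) →
      (∀ A i, A ≠ aStack → t.rarr A i = s.rarr A i) → J L t)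
    (hvisit : ∀ L s, L ++ [(s.rreg rVisit, s.rarr aSeg (s.nreg nVisit))] <+: all →
      J L s → Heap s → Runs procs visit s fun k t => k ≤ K ∧ Core s t ∧
        t.nreg nVisit = s.nreg nVisit ∧ t.rreg rVisit = s.rreg rVisit ∧
        J (L ++ [(s.rreg rVisit, s.rarr aSeg (s.nreg nVisit))]) t)
    (T : Tr) (L : List (ℝ × ℝ)) (s : State) (hs : Heap s) (hT : Rep s T (s.nreg nVisit))
    (hL : L ++ T.elems (s.rreg rVisit) <+: all) (hJL : J L s) :
    Runs procs (travBody self visit) s fun k t => k ≤ (K + 22) * T.size + 3 ∧ Core s t ∧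
      J (L ++ T.elems (s.rreg rVisit)) t := by
  induction T generalizing L s with
  | nil =>
    have h0 : s.nreg 10 = 0 := hT
    simp only [travBody, runs_thenDo_cons, runs_thenDo_nil]
    apply runs_branch_true
    · simp [h0]
    simp [Tr.size, Tr.elems]
    exact hJ _ _ _ hJL (by simp +contextual) (by simp) (by simp) (by simp)
  | node lv l dl len r dr ihl ihr =>
    have hT' := hT
    obtain ⟨h20, -, h22, h23, h24, h25, -, h27, h28⟩ := hT
    simp only [travBody, runs_thenDo_cons, runs_thenDo_nil]
    apply runs_branch_false
    · simpa using h20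
    simp
    apply runs_call hp
    have hL1 : (L ++ l.elems (s.rreg 12 + dl)) ++ [(s.rreg 12, len)] <+: all := by
      refine List.IsPrefix.trans ⟨r.elems (s.rreg 12 + dr), ?_⟩ hL
      simp [Tr.elems]
    refine (ihl L _ (by simpa using hs) (by simpa using h27)
      (by simpa [h23] using (List.prefix_append _ _).trans hL1)
      (hJ _ _ _ hJL (by simp +contextual) (by simp +contextual) (by simp +contextual)
        (by simp +contextual))).mono ?_
    rintro k t ⟨hk, e, hJt⟩
    have e1 : Core ((s.setN 7 0).pushed (s.nreg 10) (s.rreg 12)) t :=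
      Core.trans (by simp [State.pushed]) e
    obtain ⟨e2, a1, a2, a3⟩ := e1.pop
    have e2' : Core s (t.setN 2 (s.nreg 2)) := Core.trans (by simp) e2
    have hT := hT'.core e2'
    have hs' := hs.core e2'
    simp [h23] at a1 a2 a3 hT hs' hJt
    obtain ⟨-, -, -, -, h24, h25, -, -, h28⟩ := hT
    simp [a1, a2, a3]
    refine (hvisit (L ++ l.elems (s.rreg 12 + dl)) _ (by simpa [h24] using hL1) ?_
      (by simpa using hs')).mono ?_
    · exact hJ _ _ _ hJt (by simp +contextual) (by simp +contextual) (by simp) (by simp)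
    rintro k' t' ⟨hk', e', b1, b2, hJt'⟩
    have e3 : Core s t' := e2'.trans (Core.trans (by simp [pop_comm]) e')
    have hT := hT'.core e3
    simp [h24] at b1 b2 hT hJt'
    obtain ⟨-, -, -, -, h24, h25, -, -, h28⟩ := hT
    simp [b1, b2]
    apply runs_call hp
    refine (ihr ((L ++ l.elems (s.rreg 12 + dl)) ++ [(s.rreg 12, len)]) _
      (by simpa using hs.core e3) (by simpa using h28) (by simpa [h25, Tr.elems] using hL)
      (hJ _ _ _ (by simpa using hJt') (by simp +contextual) (by simp +contextual)
        (by simp +contextual) (by simp +contextual))).mono ?_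
    rintro k'' t'' ⟨hk'', e'', hJt''⟩
    refine ⟨?_, e3.trans (Core.trans (by simp) e''), ?_⟩
    · simp only [Tr.size]
      nlinarith
    · simpa [Tr.elems, h25] using hJt''

/-! ### Piecewise linear convex functions as lists of segments -/

/-- `Fill l x m`: a total amount `x` can be distributed over the segments `(slope, length)` of `l`,
at most `length` to each, such that the amounts times the slopes have the sum `m`. The least such
`m` is a convex piecewise linear function of `x`. -/
def Fill : List (ℝ × ℝ) → ℝ → ℝ → Prop
  | [], x, m => x = 0 ∧ m = 0
  | a :: l, x, m => ∃ t, 0 ≤ t ∧ t ≤ a.2 ∧ Fill l (x - t) (m - a.1 * t)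

/-- The total length of a list of segments. -/
def total (l : List (ℝ × ℝ)) : ℝ := (l.map Prod.snd).sum

@[simp] theorem total_nil : total [] = 0 := rfl

@[simp] theorem total_cons (a : ℝ × ℝ) (l : List (ℝ × ℝ)) : total (a :: l) = a.2 + total l := by
  simp [total]

theorem fill_append {l₁ l₂ : List (ℝ × ℝ)} {x m : ℝ} :
    Fill (l₁ ++ l₂) x m ↔ ∃ x₁ m₁, Fill l₁ x₁ m₁ ∧ Fill l₂ (x - x₁) (m - m₁) := by
  induction l₁ generalizing x m with
  | nil => simp [Fill]
  | cons a l ih =>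
    simp only [List.cons_append, Fill, ih]
    constructor
    · rintro ⟨t, h0, h1, x₁, m₁, h2, h3⟩
      refine ⟨x₁ + t, m₁ + a.1 * t, ⟨t, h0, h1, by simpa using h2⟩, ?_⟩
      convert h3 using 1 <;> ring
    · rintro ⟨x₁, m₁, ⟨t, h0, h1, h2⟩, h3⟩
      refine ⟨t, h0, h1, x₁ - t, m₁ - a.1 * t, h2, ?_⟩
      convert h3 using 1 <;> ring

theorem fill_perm {l₁ l₂ : List (ℝ × ℝ)} (h : l₁.Perm l₂) {x m : ℝ} :
    Fill l₁ x m ↔ Fill l₂ x m := by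
  induction h generalizing x m with
  | nil => rfl
  | cons a _ ih => simp only [Fill, ih]
  | swap a b l =>
    have (a b : ℝ × ℝ) : Fill (b :: a :: l) x m → Fill (a :: b :: l) x m := by
      rintro ⟨t, h0, h1, t', h0', h1', h⟩
      refine ⟨t', h0', h1', t, h0, h1, ?_⟩
      rwa [sub_right_comm x, sub_right_comm m]
    exact ⟨this _ _, this _ _⟩
  | trans _ _ ih₁ ih₂ => exact ih₁.trans ih₂

/-- Cutting a segment in two does not matter. -/
theorem fill_cut {θ p q : ℝ} (hp : 0 ≤ p) (hq : 0 ≤ q) {l : List (ℝ × ℝ)} {x m : ℝ} :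
    Fill ((θ, p + q) :: l) x m ↔ Fill ((θ, p) :: (θ, q) :: l) x m := by
  constructor
  · rintro ⟨t, h0, h1, h⟩
    dsimp only at h1 h
    refine ⟨min t p, le_min h0 hp, min_le_right _ _, t - min t p,
      sub_nonneg.2 (min_le_left _ _), ?_, ?_⟩
    · rcases min_choice t p with h | h <;> rw [h] <;> simp only <;> linarith
    · dsimp only
      convert h using 1 <;> ring
  · rintro ⟨t, h0, h1, t', h0', h1', h⟩
    dsimp only at h1 h1' h
    refine ⟨t + t', by linarith, by dsimp only; linarith, ?_⟩
    dsimp only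
    convert h using 1 <;> ring

theorem fill_map_add {c : ℝ} {l : List (ℝ × ℝ)} {x m : ℝ} :
    Fill (l.map fun a => (a.1 + c, a.2)) x m ↔ Fill l x (m - c * x) := by
  induction l generalizing x m with
  | nil =>
    simp only [List.map_nil, Fill]
    constructor <;> rintro ⟨rfl, h⟩ <;> simpa using h
  | cons a l ih =>
    simp only [List.map_cons, Fill, ih]
    refine exists_congr fun t => ?_
    rw [show m - (a.1 + c) * t - c * (x - t) = m - c * x - a.1 * t by ring]

theorem Fill.nonneg {l : List (ℝ × ℝ)} {x m : ℝ} (h : Fill l x m) : 0 ≤ x := by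
  induction l generalizing x m with
  | nil => exact h.1.ge
  | cons a l ih =>
    obtain ⟨t, h0, -, h⟩ := h
    linarith [ih h]

theorem Fill.le_length {l : List (ℝ × ℝ)} {x m : ℝ} (h : Fill l x m) : x ≤ total l := by
  induction l generalizing x m with
  | nil => exact h.1.le
  | cons a l ih =>
    obtain ⟨t, -, h1, h⟩ := h
    rw [total_cons]
    linarith [ih h]

/-- If all slopes are at most `θ`, an additional amount `δ` costs at most `θ * δ`. -/
theorem Fill.raise {l : List (ℝ × ℝ)} {θ x m δ : ℝ} (hl : ∀ a ∈ l, a.1 ≤ θ) (h : Fill l x m)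
    (hδ : 0 ≤ δ) (hx : x + δ ≤ total l) : ∃ m' ≤ m + θ * δ, Fill l (x + δ) m' := by
  induction l generalizing x m δ with
  | nil =>
    obtain ⟨rfl, rfl⟩ := h
    simp only [total_nil] at hx
    obtain rfl : δ = 0 := by linarith
    exact ⟨0, by simp, by simp [Fill]⟩
  | cons a l ih =>
    obtain ⟨t, h0, h1, h⟩ := h
    rw [total_cons] at hx
    have hle := h.le_length
    have h2 : 0 ≤ min δ (a.2 - t) := le_min hδ (by linarith)
    have h3 := min_le_left δ (a.2 - t)
    have h4 := min_le_right δ (a.2 - t)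
    obtain ⟨m', hm', hf⟩ := ih (δ := δ - min δ (a.2 - t)) (fun b hb => hl b (by simp [hb])) h
      (by linarith) (by rcases min_choice δ (a.2 - t) with h | h <;> rw [h] <;> linarith)
    refine ⟨m' + a.1 * (t + min δ (a.2 - t)), ?_, t + min δ (a.2 - t), by linarith, by linarith, ?_⟩
    · nlinarith [mul_le_mul_of_nonneg_right (hl a (by simp)) h2]
    · convert hf using 1 <;> ring

/-- If all slopes are at least `θ`, taking away an amount `δ` saves at least `θ * δ`. -/
theorem Fill.lower {l : List (ℝ × ℝ)} {θ x m δ : ℝ} (hl : ∀ a ∈ l, θ ≤ a.1) (h : Fill l x m)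
    (hδ : 0 ≤ δ) (hx : δ ≤ x) : ∃ m' ≤ m - θ * δ, Fill l (x - δ) m' := by
  induction l generalizing x m δ with
  | nil =>
    obtain ⟨rfl, rfl⟩ := h
    obtain rfl : δ = 0 := by linarith
    exact ⟨0, by simp, by simp [Fill]⟩
  | cons a l ih =>
    obtain ⟨t, h0, h1, h⟩ := h
    have hle := h.nonneg
    have h2 : 0 ≤ min δ t := le_min hδ h0
    have h3 := min_le_left δ t
    have h4 := min_le_right δ t
    obtain ⟨m', hm', hf⟩ := ih (δ := δ - min δ t) (fun b hb => hl b (by simp [hb])) h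
      (by linarith) (by rcases min_choice δ t with h | h <;> rw [h] <;> linarith)
    refine ⟨m' + a.1 * (t - min δ t), ?_, t - min δ t, by linarith, by linarith, ?_⟩
    · nlinarith [mul_le_mul_of_nonneg_right (hl a (by simp)) h2]
    · convert hf using 1 <;> ring

/-- Let the segments of `L` have slopes at most those of `R`. Adding `w` to the slopes of `R` and
`-w` to the slopes of `L` adds `w * |x - total L| - w * total L` to the convex function: an optimal
filling fills `L` before `R`. -/
theorem Fill.widen {L R : List (ℝ × ℝ)} {θ w x m : ℝ} (hL : ∀ a ∈ L, a.1 ≤ θ)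
    (hR : ∀ a ∈ R, θ ≤ a.1) (h : Fill (L ++ R) x m) :
    ∃ m' ≤ m + w * |x - total L| - w * total L,
      Fill (L.map (fun a => (a.1 - w, a.2)) ++ R.map fun a => (a.1 + w, a.2)) x m' := by
  obtain ⟨x₁, m₁, h1, h2⟩ := fill_append.1 h
  simp only [fill_append, sub_eq_add_neg _ w, fill_map_add]
  have h1le := h1.le_length
  rcases le_total x (total L) with hx | hx
  · obtain ⟨m', hm', hf⟩ := h1.raise hL h2.nonneg (by linarith)
    obtain ⟨m'', hm'', hf'⟩ := h2.lower hR h2.nonneg le_rfl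
    rw [abs_of_nonpos (by linarith)]
    refine ⟨m' - w * x + m'', ?_, x, m' - w * x, ?_, ?_⟩
    · linarith
    · convert hf using 1 <;> ring
    · convert hf' using 1 <;> ring
  · obtain ⟨m', hm', hf⟩ := h1.raise hL (δ := total L - x₁) (by linarith) (by linarith)
    obtain ⟨m'', hm'', hf'⟩ := h2.lower hR (δ := total L - x₁) (by linarith) (by linarith)
    rw [abs_of_nonneg (by linarith)]
    refine ⟨m' - w * total L + (m'' + w * (x - total L)), ?_, total L, m' - w * total L, ?_, ?_⟩
    · linarith
    · convert hf using 1 <;> ring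
    · convert hf' using 1 <;> ring

theorem Fill.narrow {L R : List (ℝ × ℝ)} {w x m : ℝ} (hw : 0 ≤ w)
    (h : Fill (L.map (fun a => (a.1 - w, a.2)) ++ R.map fun a => (a.1 + w, a.2)) x m) :
    ∃ m' ≤ m - w * |x - total L| + w * total L, Fill (L ++ R) x m' := by
  simp only [fill_append, sub_eq_add_neg _ w, fill_map_add] at h ⊢
  obtain ⟨x₁, m₁, h1, h2⟩ := h
  have h1le := h1.le_length
  have h2le := h2.nonneg
  refine ⟨m₁ - -w * x₁ + (m - m₁ - w * (x - x₁)), ?_, x₁, _, h1, by simpa using h2⟩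
  have : |x - total L| ≤ total L - x₁ + (x - x₁) := abs_le.2 ⟨by linarith, by linarith⟩
  nlinarith [mul_le_mul_of_nonneg_left this hw]

/-- The cost of filling the segments with an amount `b` in the given order. -/
noncomputable def greedySum : List (ℝ × ℝ) → ℝ → ℝ
  | [], _ => 0
  | a :: l, b => a.1 * min b a.2 + greedySum l (b - min b a.2)

/-- What is left of the amount `b` after filling the segments. -/
noncomputable def greedyRest : List (ℝ × ℝ) → ℝ → ℝ
  | [], b => b
  | a :: l, b => greedyRest l (b - min b a.2)

theorem greedySum_concat (l : List (ℝ × ℝ)) (a : ℝ × ℝ) (b : ℝ) :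
    greedySum (l ++ [a]) b = greedySum l b + a.1 * min (greedyRest l b) a.2 := by
  induction l generalizing b with
  | nil => simp [greedySum, greedyRest]
  | cons c l ih => simp [greedySum, greedyRest, ih, add_assoc]

theorem greedyRest_concat (l : List (ℝ × ℝ)) (a : ℝ × ℝ) (b : ℝ) :
    greedyRest (l ++ [a]) b = greedyRest l b - min (greedyRest l b) a.2 := by
  induction l generalizing b with
  | nil => simp [greedyRest]
  | cons c l ih => simp [greedyRest, ih]

/-- Filling in the order of slope is optimal. -/
theorem isLeast_greedySum {l : List (ℝ × ℝ)} (hl : l.Pairwise fun a b => a.1 ≤ b.1)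
    (h0 : ∀ a ∈ l, 0 ≤ a.2) {b : ℝ} (hb : 0 ≤ b) (hb' : b ≤ total l) :
    IsLeast {m | Fill l b m} (greedySum l b) := by
  induction l generalizing b with
  | nil =>
    obtain rfl : b = 0 := le_antisymm hb' hb
    exact ⟨⟨rfl, rfl⟩, fun m hm => hm.2.ge⟩
  | cons a l ih =>
    rw [List.pairwise_cons] at hl
    rw [total_cons] at hb'
    have ha := h0 a (by simp)
    have hl0 : 0 ≤ total l :=
      List.sum_nonneg (by simpa using fun c d hc => h0 (d, c) (by simp [hc]))
    have h3 := min_le_left b a.2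
    have h4 := min_le_right b a.2
    obtain ⟨h5, h6⟩ := ih hl.2 (fun c hc => h0 c (by simp [hc])) (b := b - min b a.2)
      (by linarith) (by rcases min_choice b a.2 with h | h <;> rw [h] <;> linarith)
    refine ⟨⟨min b a.2, le_min hb ha, min_le_right _ _, by simpa [greedySum] using h5⟩, ?_⟩
    rintro m ⟨t, ht0, ht1, hf⟩
    have ht : t ≤ min b a.2 := le_min (by linarith [hf.nonneg]) ht1
    obtain ⟨m', hm', hf'⟩ := hf.lower hl.1 (δ := min b a.2 - t) (by linarith) (by linarith)
    have := h6 (show Fill l (b - min b a.2) m' by convert hf' using 1; ring)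
    simp only [greedySum]
    linarith

/-! ### Transport plans and the elimination of a leaf -/

section Plans

variable {V : Type} [Fintype V] [DecidableEq V]

/-- `r` is a value attained by some flow in the reduced problem on the set `S` of nodes: node `v`
sends out the net amount `x v - B v` at the cost of filling the segments `F v` up to `x v`, and
the flow is given by the amounts `π u v` moved from `u` to `v`. -/
def Attains (d : V → V → ℝ) (S : Finset V) (F : V → List (ℝ × ℝ)) (B : V → ℝ) (c r : ℝ) : Prop :=
  ∃ (x m : V → ℝ) (π : V → V → ℝ), (∀ v ∈ S, Fill (F v) (x v) (m v)) ∧ (∀ u v, 0 ≤ π u v) ∧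
    (∀ v ∈ S, ∑ y ∈ S, π v y - ∑ y ∈ S, π y v = x v - B v) ∧
    r = c + ∑ v ∈ S, m v + ∑ u ∈ S, ∑ v ∈ S, d u v * π u v

omit [Fintype V] in
/-- Two sets of reals that dominate each other have the same least elements. -/
theorem isLeast_of_dominated {A A' : Set ℝ} (h : ∀ r ∈ A, ∃ r' ∈ A', r' ≤ r)
    (h' : ∀ r' ∈ A', ∃ r ∈ A, r ≤ r') {r : ℝ} (hr : IsLeast A' r) : IsLeast A r := by
  obtain ⟨r₁, h1, h2⟩ := h' r hr.1
  obtain ⟨r₂, h3, h4⟩ := h r₁ h1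
  obtain rfl : r₁ = r := le_antisymm h2 ((hr.2 h3).trans h4)
  refine ⟨h1, fun s hs => ?_⟩
  obtain ⟨r₃, h5, h6⟩ := h s hs
  exact (hr.2 h5).trans h6

variable {d : V → V → ℝ} {S : Finset V} {F F' : V → List (ℝ × ℝ)} {B B' : V → ℝ} {c w : ℝ}
  {u p : V} {L R : List (ℝ × ℝ)} {θ : ℝ}

omit [Fintype V] in
/-- Eliminating the leaf `u` with neighbour `p`: moving all mass at `u` to `p` first does not
increase the cost. -/
theorem Attains.eliminate (hw : 0 ≤ w) (hu : u ∉ S) (hp : p ∈ S) (hd : d u u = 0)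
    (h1 : ∀ y ∈ S, d u y = w + d p y) (h2 : ∀ y ∈ S, d y u = w + d y p)
    (hLR : ∀ x m, Fill (F u) x m ↔ Fill (L ++ R) x m) (hB : total L = B u)
    (hL : ∀ a ∈ L, a.1 ≤ θ) (hR : ∀ a ∈ R, θ ≤ a.1)
    (hF : ∀ v ∈ S, v ≠ p → F' v = F v)
    (hFp : (F' p).Perm
      ((L.map (fun a => (a.1 - w, a.2)) ++ R.map fun a => (a.1 + w, a.2)) ++ F p))
    (hB' : ∀ v ∈ S, v ≠ p → B' v = B v) (hBp : B' p = B p + B u) {r : ℝ}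
    (h : Attains d (insert u S) F B c r) :
    ∃ r' ≤ r, Attains d S F' B' (c + w * B u) r' := by
  obtain ⟨x, m, π, hf, hπ, hnet, rfl⟩ := h
  obtain ⟨m', hm', hfu⟩ := ((hLR _ _).1 (hf u (by simp))).widen (w := w) hL hR
  have hup : u ≠ p := fun h => hu (h ▸ hp)
  have hsum (f : V → ℝ) (q : ℝ) : ∑ v ∈ S, (f v + if v = p then q else 0) = ∑ v ∈ S, f v + q := by
    rw [Finset.sum_add_distrib, Finset.sum_ite_eq' S p, if_pos hp]
  refine ⟨_, ?_, fun v => x v + if v = p then x u else 0, fun v => m v + if v = p then m' else 0,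
    fun a b => (π a b + if b = p then π a u else 0) + if a = p then π u b else 0, fun v hv => ?_,
    fun a b => ?_, fun v hv => ?_, rfl⟩
  · have e1 : ∑ a ∈ S, ∑ b ∈ S, d a b *
        ((π a b + if b = p then π a u else 0) + if a = p then π u b else 0) =
        ∑ a ∈ S, ∑ b ∈ S, d a b * π a b + ∑ a ∈ S, d a p * π a u + ∑ b ∈ S, d p b * π u b := by
      simp only [mul_add, Finset.sum_add_distrib, mul_ite, mul_zero, Finset.sum_ite_eq' S p,
        if_pos hp]
      congr 1
      rw [Finset.sum_comm]
      simp only [Finset.sum_ite_eq' S p, if_pos hp]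
    have e2 : ∑ b ∈ S, d u b * π u b = w * ∑ b ∈ S, π u b + ∑ b ∈ S, d p b * π u b := by
      rw [Finset.mul_sum, ← Finset.sum_add_distrib]
      exact Finset.sum_congr rfl fun b hb => by rw [h1 b hb]; ring
    have e3 : ∑ a ∈ S, d a u * π a u = w * ∑ a ∈ S, π a u + ∑ a ∈ S, d a p * π a u := by
      rw [Finset.mul_sum, ← Finset.sum_add_distrib]
      exact Finset.sum_congr rfl fun b hb => by rw [h2 b hb]; ring
    have e4 := hnet u (by simp)
    rw [Finset.sum_insert hu, Finset.sum_insert hu] at e4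
    have h3 : 0 ≤ ∑ b ∈ S, π u b := Finset.sum_nonneg fun b _ => hπ u b
    have h4 : 0 ≤ ∑ b ∈ S, π b u := Finset.sum_nonneg fun b _ => hπ b u
    have h5 : |x u - total L| ≤ ∑ b ∈ S, π u b + ∑ b ∈ S, π b u := by
      rw [hB]
      exact abs_le.2 ⟨by linarith, by linarith⟩
    rw [hsum, e1]
    simp only [Finset.sum_insert hu, Finset.sum_add_distrib, hd, zero_mul, e2, e3]
    rw [hB] at hm' h5
    nlinarith [mul_le_mul_of_nonneg_left h5 hw]
  · dsimp only
    by_cases hvp : v = p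
    · subst hvp
      simp only [if_true]
      rw [fill_perm hFp, fill_append]
      exact ⟨_, _, hfu, by simpa using hf v (by simp [hv])⟩
    · simp only [if_neg hvp, add_zero]
      rw [hF v hv hvp]
      exact hf v (by simp [hv])
  · dsimp only
    have := hπ a b
    have := hπ a u
    have := hπ u b
    split_ifs <;> linarith
  · have e := hnet v (by simp [hv])
    have e' := hnet u (by simp)
    rw [Finset.sum_insert hu, Finset.sum_insert hu] at e e'
    simp only [Finset.sum_add_distrib, Finset.sum_ite_eq' S p, if_pos hp]
    by_cases hvp : v = p
    · subst hvp
      simp only [if_true, hBp]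
      linarith
    · simp only [if_neg hvp, Finset.sum_const_zero, hB' v hv hvp]
      linarith

omit [Fintype V] in
theorem Attains.of_eliminate (hw : 0 ≤ w) (hu : u ∉ S) (hp : p ∈ S) (hd : d u u = 0)
    (hd' : d p p = 0)
    (h1 : ∀ y ∈ S, d u y = w + d p y) (h2 : ∀ y ∈ S, d y u = w + d y p)
    (hLR : ∀ x m, Fill (F u) x m ↔ Fill (L ++ R) x m) (hB : total L = B u)
    (hF : ∀ v ∈ S, v ≠ p → F' v = F v)
    (hFp : (F' p).Perm
      ((L.map (fun a => (a.1 - w, a.2)) ++ R.map fun a => (a.1 + w, a.2)) ++ F p))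
    (hB' : ∀ v ∈ S, v ≠ p → B' v = B v) (hBp : B' p = B p + B u) {r : ℝ}
    (h : Attains d S F' B' (c + w * B u) r) :
    ∃ r' ≤ r, Attains d (insert u S) F B c r' := by
  obtain ⟨x, m, π, hf, hπ, hnet, rfl⟩ := h
  have hup : u ≠ p := fun h => hu (h ▸ hp)
  have hne : ∀ v ∈ S, v ≠ u := fun v hv h => hu (h ▸ hv)
  have hfp := hf p hp
  rw [fill_perm hFp, fill_append] at hfp
  obtain ⟨xu, mu', hfu, hfp⟩ := hfp
  obtain ⟨mu, hmu, hfu⟩ := hfu.narrow hw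
  rw [← hLR] at hfu
  rw [hB] at hmu
  have hsum (f : V → ℝ) (q s : ℝ) :
      ∑ v ∈ S, (if v = u then q else if v = p then s else f v) = ∑ v ∈ S, f v + (s - f p) := by
    rw [← Finset.add_sum_erase S _ hp, ← Finset.add_sum_erase S f hp, if_neg hup.symm, if_pos rfl,
      Finset.sum_congr rfl fun v hv => ?_, add_comm s, add_comm (f p)]
    · ring
    · rw [Finset.mem_erase] at hv
      rw [if_neg (hne v hv.2), if_neg hv.1]
  set P := max (xu - B u) 0 with hP
  set N := max (B u - xu) 0 with hN
  have hPN : P - N = xu - B u := by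
    rw [hP, hN]
    rcases le_total xu (B u) with h | h
    · rw [max_eq_right (by linarith), max_eq_left (by linarith)]; ring
    · rw [max_eq_left (by linarith), max_eq_right (by linarith)]; ring
  have hPN' : P + N = |xu - B u| := by
    rw [hP, hN]
    rcases le_total xu (B u) with h | h
    · rw [max_eq_right (by linarith), max_eq_left (by linarith), abs_of_nonpos (by linarith)]; ring
    · rw [max_eq_left (by linarith), max_eq_right (by linarith), abs_of_nonneg (by linarith)]; ring
  -- the flow along the new edge is added to the flow on the smaller tree
  let ρ : V → V → ℝ := fun a b => if a = u then (if b = p then P else 0) else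
      if b = u then (if a = p then N else 0) else π a b
  have hρu : ∀ b, ρ u b = if b = p then P else 0 := fun b => if_pos rfl
  have hρS : ∀ a ∈ S, ∀ b ∈ S, ρ a b = π a b := fun a ha b hb => by
    simp only [ρ, if_neg (hne a ha), if_neg (hne b hb)]
  have hρu' : ∀ a ∈ S, ρ a u = if a = p then N else 0 := fun a ha => by
    simp only [ρ, if_neg (hne a ha), if_true]
  have hrow : ∑ b ∈ S, ρ u b = P := by
    simp only [hρu, Finset.sum_ite_eq' S p, if_pos hp]
  have hcol : ∑ a ∈ S, ρ a u = N := by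
    rw [Finset.sum_congr rfl hρu', Finset.sum_ite_eq' S p, if_pos hp]
  refine ⟨_, ?_, fun v => if v = u then xu else if v = p then x p - xu else x v,
    fun v => if v = u then mu else if v = p then m p - mu' else m v, ρ, fun v hv => ?_,
    fun a b => ?_, fun v hv => ?_, rfl⟩
  · have e1 : ∑ b ∈ S, d u b * ρ u b = w * P := by
      simp only [hρu, mul_ite, mul_zero, Finset.sum_ite_eq' S p, if_pos hp, h1 p hp, hd', add_zero]
    have e2 : ∑ a ∈ S, d a u * ρ a u = w * N := by
      rw [Finset.sum_congr rfl fun a ha => by rw [hρu' a ha]]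
      simp only [mul_ite, mul_zero, Finset.sum_ite_eq' S p, if_pos hp, h2 p hp, hd', add_zero]
    have e3 : ∑ a ∈ S, ∑ b ∈ S, d a b * ρ a b = ∑ a ∈ S, ∑ b ∈ S, d a b * π a b :=
      Finset.sum_congr rfl fun a ha => Finset.sum_congr rfl fun b hb => by rw [hρS a ha b hb]
    rw [Finset.sum_insert hu, Finset.sum_insert hu, hsum, if_pos rfl, Finset.sum_insert hu, hd]
    simp only [Finset.sum_insert hu, Finset.sum_add_distrib, e1, e2, e3]
    rw [← hPN'] at hmu
    linarith
  · rcases Finset.mem_insert.1 hv with rfl | hv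
    · simpa using hfu
    · simp only [if_neg (hne v hv)]
      by_cases hvp : v = p
      · subst hvp
        simpa using hfp
      · simp only [if_neg hvp, ← hF v hv hvp]
        exact hf v hv
  · have : 0 ≤ P := le_max_right _ _
    have : 0 ≤ N := le_max_right _ _
    have := hπ a b
    simp only [ρ]
    split_ifs <;> linarith
  · rcases Finset.mem_insert.1 hv with rfl | hv
    · rw [Finset.sum_insert hu, Finset.sum_insert hu, hrow, hcol]
      simp only [if_true]
      linarith
    · have e := hnet v hv
      rw [Finset.sum_insert hu, Finset.sum_insert hu, hρu, hρu' v hv,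
        Finset.sum_congr rfl fun b hb => hρS v hv b hb,
        Finset.sum_congr rfl fun b hb => hρS b hb v hv]
      by_cases hvp : v = p
      · subst hvp
        simp only [if_true, if_neg (hne v hv)]
        linarith
      · simp only [if_neg hvp, if_neg (hne v hv), ← hB' v hv hvp]
        linarith

/-- Any net flow `α - β` between nonnegative masses is realised, at no greater cost, by a flow
with row sums `α` and column sums `β` at the node `v`: the mass that passes through `v` is sent
directly. -/
theorem exists_bypass (hd : ∀ v, d v v = 0) (ht : ∀ x y z, d x z ≤ d x y + d y z)
    {π : V → V → ℝ} (hπ : ∀ x y, 0 ≤ π x y) (v : V) {α β : ℝ} (hα : 0 ≤ α) (hβ : 0 ≤ β)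
    (hnet : ∑ y, π v y - ∑ y, π y v = α - β) :
    ∃ ρ : V → V → ℝ, (∀ x y, 0 ≤ ρ x y) ∧ ∑ y, ρ v y = α ∧ ∑ y, ρ y v = β ∧
      (∀ x, x ≠ v → ∑ y, ρ x y = ∑ y, π x y ∧ ∑ y, ρ y x = ∑ y, π y x) ∧
      ∑ x, ∑ y, d x y * ρ x y ≤ ∑ x, ∑ y, d x y * π x y := by
  have hsplit (f : V → ℝ) : ∑ y, f y = f v + ∑ y, if y = v then 0 else f y := by
    rw [← Finset.add_sum_erase _ _ (Finset.mem_univ v),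
      ← Finset.add_sum_erase _ _ (Finset.mem_univ v), if_pos rfl, zero_add]
    congr 1
    exact Finset.sum_congr rfl fun y hy => (if_neg (Finset.ne_of_mem_erase hy)).symm
  set P : ℝ := ∑ y, if y = v then 0 else π v y with hP
  set C : ℝ := ∑ y, if y = v then 0 else π y v with hC
  have hPC : P - C = α - β := by
    rw [hsplit (π v), hsplit fun y => π y v] at hnet
    linarith
  -- the flow without the loop at `v`, plus a loop of the amount `z`
  have key (z : ℝ) (hz : 0 ≤ z) : ∃ ρ : V → V → ℝ, (∀ x y, 0 ≤ ρ x y) ∧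
      ∑ y, ρ v y = P + z ∧ ∑ y, ρ y v = C + z ∧
      (∀ x, x ≠ v → ∑ y, ρ x y = ∑ y, π x y ∧ ∑ y, ρ y x = ∑ y, π y x) ∧
      ∑ x, ∑ y, d x y * ρ x y = ∑ x, ∑ y, d x y * π x y ∧ ρ v v = z ∧
      (∀ x, x ≠ v → ρ x v = π x v ∧ ρ v x = π v x) := by
    refine ⟨fun x y => if x = v then (if y = v then z else π x y) else π x y, fun x y => ?_, ?_, ?_,
      fun x hx => ⟨?_, ?_⟩, ?_, ?_, fun x hx => ⟨?_, ?_⟩⟩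
    · have := hπ x y
      dsimp only
      split_ifs <;> assumption
    · rw [hsplit]
      simp only [if_true, hP, add_comm z]
      congr 1
      exact Finset.sum_congr rfl fun y _ => by split_ifs <;> rfl
    · rw [hsplit]
      simp only [if_true, hC, add_comm z]
      congr 1
      exact Finset.sum_congr rfl fun y _ => by split_ifs <;> rfl
    · simp only [if_neg hx]
    · simp only [if_neg hx, ite_self]
    · refine Finset.sum_congr rfl fun x _ => Finset.sum_congr rfl fun y _ => ?_
      dsimp only
      split_ifs with h1 h2
      · rw [h1, h2, hd, zero_mul, zero_mul]
      · rfl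
      · rfl
    · simp
    · simp [hx]
    · simp [hx]
  rcases le_or_gt P α with he | he
  · obtain ⟨ρ, h1, h2, h3, h4, h5, -⟩ := key (α - P) (by linarith)
    exact ⟨ρ, h1, by linarith, by linarith, h4, h5.le⟩
  · obtain ⟨ρ, h1, h2, h3, h4, h5, h6, h7⟩ := key 0 le_rfl
    have hP0 : 0 < P := by linarith
    have hC0 : 0 < C := by linarith
    set e := P - α with hedef
    have hp0 (x : V) : 0 ≤ ρ x v / C := div_nonneg (h1 x v) hC0.le
    have hq0 (y : V) : 0 ≤ ρ v y / P := div_nonneg (h1 v y) hP0.le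
    have hps : ∑ x, ρ x v / C = 1 := by
      rw [← Finset.sum_div, h3, add_zero, div_self hC0.ne']
    have hqs : ∑ y, ρ v y / P = 1 := by
      rw [← Finset.sum_div, h2, add_zero, div_self hP0.ne']
    have hpe (x : V) : e * (ρ x v / C) ≤ ρ x v := by
      rw [mul_div_assoc', div_le_iff₀ hC0, mul_comm]
      exact mul_le_mul_of_nonneg_left (by linarith) (h1 x v)
    have hqe (y : V) : e * (ρ v y / P) ≤ ρ v y := by
      rw [mul_div_assoc', div_le_iff₀ hP0, mul_comm]
      exact mul_le_mul_of_nonneg_left (by linarith) (h1 v y)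
    generalize hp : (fun x => ρ x v / C) = p at hps
    generalize hq : (fun y => ρ v y / P) = q at hqs
    replace hp (x : V) : ρ x v / C = p x := congrFun hp x
    replace hq (x : V) : ρ v x / P = q x := congrFun hq x
    simp only [hp, hq] at hp0 hq0 hpe hqe
    have hpv : p v = 0 := by rw [← hp, h6, zero_div]
    have hqv : q v = 0 := by rw [← hq, h6, zero_div]
    refine ⟨fun x y => ρ x y - e * ((if y = v then p x else 0) + (if x = v then q y else 0)
      - p x * q y), fun x y => ?_, ?_, ?_, fun x hx => ⟨?_, ?_⟩, ?_⟩
    · have h8 := mul_nonneg (mul_nonneg (by linarith : 0 ≤ e) (hp0 x)) (hq0 y)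
      have h9 := h1 x y
      dsimp only
      split_ifs with hy hx hx
      · subst hx hy
        rw [hpv, hqv]
        linarith
      · subst hy
        have := hpe x
        rw [hqv]
        linarith
      · subst hx
        have := hqe y
        rw [hpv]
        linarith
      · linarith
    · simp only [Finset.sum_sub_distrib, ← Finset.mul_sum, Finset.sum_add_distrib, if_true,
        Finset.sum_ite_eq' Finset.univ v, Finset.mem_univ, hqs, h2, hpv]
      linarith
    · simp only [Finset.sum_sub_distrib, ← Finset.mul_sum, ← Finset.sum_mul,
        Finset.sum_add_distrib, if_true, Finset.sum_ite_eq' Finset.univ v, Finset.mem_univ, hps, h3,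
        hqv]
      linarith
    · simp only [Finset.sum_sub_distrib, ← Finset.mul_sum, Finset.sum_add_distrib, if_neg hx,
        Finset.sum_ite_eq' Finset.univ v, Finset.mem_univ, if_true, hqs, (h4 x hx).1,
        Finset.sum_const_zero]
      linarith
    · simp only [Finset.sum_sub_distrib, ← Finset.mul_sum, ← Finset.sum_mul,
        Finset.sum_add_distrib, if_neg hx, Finset.sum_ite_eq' Finset.univ v, Finset.mem_univ,
        if_true, hps, (h4 x hx).2, Finset.sum_const_zero]
      linarith
    · have h8 : ∑ x, ∑ y, d x y * (p x * q y) ≤ ∑ x, d x v * p x + ∑ y, d v y * q y := by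
        calc ∑ x, ∑ y, d x y * (p x * q y)
            ≤ ∑ x, ∑ y, (d x v * p x * q y + p x * (d v y * q y)) := by
              refine Finset.sum_le_sum fun x _ => Finset.sum_le_sum fun y _ => ?_
              have := mul_le_mul_of_nonneg_right (ht x v y) (mul_nonneg (hp0 x) (hq0 y))
              linarith
          _ = _ := by
              simp only [Finset.sum_add_distrib, ← Finset.mul_sum, ← Finset.sum_mul, hqs, hps,
                mul_one, one_mul]
      have h9 : ∑ x, ∑ y, d x y * (ρ x y - e * ((if y = v then p x else 0) +
          (if x = v then q y else 0) - p x * q y)) = ∑ x, ∑ y, d x y * π x y -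
          e * (∑ x, d x v * p x + ∑ y, d v y * q y - ∑ x, ∑ y, d x y * (p x * q y)) := by
        have h10 (x y : V) : d x y * (ρ x y - e * ((if y = v then p x else 0) +
          (if x = v then q y else 0) - p x * q y)) = d x y * ρ x y - e * ((if y = v then
            d x y * p x else 0) + (if x = v then d x y * q y else 0) - d x y * (p x * q y)) := by
          split_ifs <;> ring
        have h11 : ∑ x, ∑ y, (if x = v then d x y * q y else 0) = ∑ y, d v y * q y := by
          rw [Finset.sum_comm]
          simp
        simp only [h10, Finset.sum_sub_distrib, ← Finset.mul_sum, Finset.sum_add_distrib, h11, ← h5]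
        simp
      rw [h9]
      nlinarith [mul_nonneg (by linarith : 0 ≤ e) (sub_nonneg.2 h8)]

/-- In a pseudometric, a flow with net amounts `α - β` can be replaced by a coupling of `α` and
`β` of no greater cost. -/
theorem exists_coupling (hd : ∀ v, d v v = 0) (ht : ∀ x y z, d x z ≤ d x y + d y z)
    {π : V → V → ℝ} (hπ : ∀ x y, 0 ≤ π x y) {α β : V → ℝ} (hα : ∀ v, 0 ≤ α v) (hβ : ∀ v, 0 ≤ β v)
    (hnet : ∀ v, ∑ y, π v y - ∑ y, π y v = α v - β v) :
    ∃ ρ : V → V → ℝ, (∀ x y, 0 ≤ ρ x y) ∧ (∀ v, ∑ y, ρ v y = α v) ∧ (∀ v, ∑ y, ρ y v = β v) ∧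
      ∑ x, ∑ y, d x y * ρ x y ≤ ∑ x, ∑ y, d x y * π x y := by
  suffices H : ∀ S : Finset V, ∃ ρ : V → V → ℝ, (∀ x y, 0 ≤ ρ x y) ∧
      (∀ v, ∑ y, ρ v y - ∑ y, ρ y v = α v - β v) ∧
      (∀ v ∈ S, ∑ y, ρ v y = α v ∧ ∑ y, ρ y v = β v) ∧
      ∑ x, ∑ y, d x y * ρ x y ≤ ∑ x, ∑ y, d x y * π x y by
    obtain ⟨ρ, h1, -, h2, h3⟩ := H Finset.univ
    exact ⟨ρ, h1, fun v => (h2 v (Finset.mem_univ v)).1, fun v => (h2 v (Finset.mem_univ v)).2, h3⟩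
  intro S
  induction S using Finset.induction_on with
  | empty => exact ⟨π, hπ, hnet, by simp, le_rfl⟩
  | insert u S hu ih =>
    obtain ⟨ρ, h1, h2, h3, h4⟩ := ih
    obtain ⟨ρ', h1', h2', h3', h4', h5'⟩ := exists_bypass hd ht h1 u (hα u) (hβ u) (h2 u)
    refine ⟨ρ', h1', fun v => ?_, fun v hv => ?_, h5'.trans h4⟩
    · by_cases hv : v = u
      · rw [hv, h2', h3']
      · rw [(h4' v hv).1, (h4' v hv).2, h2]
    · by_cases hvu : v = u
      · rw [hvu]
        exact ⟨h2', h3'⟩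
      · rw [(h4' v hvu).1, (h4' v hvu).2]
        exact h3 v (Finset.mem_of_mem_insert_of_ne hv hvu)

/-- The generalized Kantorovich-Rubinstein distance is the least attained value when every node
`v` has the two segments `(-ld v, a v)`, for the mass that is kept, and `(lc v, b v)`, for the mass
that is created. -/
theorem isGKRDistance_of_isLeast {δ : V → V → ℝ≥0} (hd : ∀ v, δ v v = 0)
    (ht : ∀ x y z, δ x z ≤ δ x y + δ y z) {ld lc a b : V → ℝ≥0} {F : V → List (ℝ × ℝ)} {r : ℝ}
    (hF : ∀ v, (F v).Perm [(-(ld v : ℝ), (a v : ℝ)), ((lc v : ℝ), (b v : ℝ))])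
    (hr : IsLeast {r | Attains (fun x y => (δ x y : ℝ)) Finset.univ F (fun v => (b v : ℝ))
      (∑ v, (ld v : ℝ) * (a v : ℝ)) r} r) : IsGKRDistance δ ld lc a b r := by
  refine isLeast_of_dominated ?_ ?_ hr
  · rintro _ ⟨π, ⟨h1, h2⟩, rfl⟩
    refine ⟨_, ⟨fun v => ∑ y, (π v y : ℝ) + (b v - ∑ y, (π y v : ℝ)),
      fun v => -(ld v : ℝ) * ∑ y, (π v y : ℝ) + lc v * (b v - ∑ y, (π y v : ℝ)),
      fun x y => π x y, fun v _ => ?_, fun x y => (π x y).2, fun v _ => by ring, rfl⟩, ?_⟩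
    · have h1' : ∑ y, (π v y : ℝ) ≤ a v := by exact_mod_cast h1 v
      have h2' : ∑ y, (π y v : ℝ) ≤ b v := by exact_mod_cast h2 v
      have h3 : 0 ≤ ∑ y, (π y v : ℝ) := Finset.sum_nonneg fun y _ => (π y v).2
      rw [fill_perm (hF v)]
      refine ⟨∑ y, (π v y : ℝ), Finset.sum_nonneg fun y _ => (π v y).2, h1', b v - ∑ y, (π y v : ℝ),
        by linarith, by dsimp only; linarith, ?_, ?_⟩
      · ring
      · ring
    · apply le_of_eq
      simp only [planCost, Finset.sum_add_distrib, mul_sub, neg_mul, Finset.sum_sub_distrib,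
        Finset.sum_neg_distrib]
      ring
  · rintro _ ⟨x, m, π, hf, hπ, hnet, rfl⟩
    have hf' (v : V) := (fill_perm (hF v)).1 (hf v (Finset.mem_univ v))
    choose t ht0 ht1 t' ht0' ht1' hx hm using hf'
    dsimp only at ht1 ht1' hm
    obtain ⟨ρ, h1, h2, h3, h4⟩ := exists_coupling (d := fun x y => (δ x y : ℝ))
      (α := t) (β := fun v => b v - t' v) (fun v => by simp [hd])
      (fun x y z => by exact_mod_cast ht x y z) hπ ht0 (fun v => by linarith [ht1' v])
      (fun v => by linarith [hnet v (Finset.mem_univ v), hx v])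
    let σ : V → V → ℝ≥0 := fun x y => ⟨ρ x y, h1 x y⟩
    have hσ (x y : V) : (σ x y : ℝ) = ρ x y := rfl
    refine ⟨_, ⟨σ, ⟨fun v => ?_, fun v => ?_⟩, rfl⟩, ?_⟩
    · rw [← NNReal.coe_le_coe, NNReal.coe_sum]
      simp only [hσ]
      exact (h2 v).le.trans (ht1 v)
    · rw [← NNReal.coe_le_coe, NNReal.coe_sum]
      simp only [hσ]
      exact (h3 v).le.trans (by linarith [ht0' v])
    · have hm' : ∀ v, m v = -(ld v : ℝ) * t v + lc v * t' v := fun v => by linarith [hm v]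
      simp only [planCost, hσ, h2, h3, hm', sub_sub_cancel, mul_sub,
        Finset.sum_sub_distrib, Finset.sum_add_distrib, neg_mul, Finset.sum_neg_distrib]
      linarith

end Plans

/-! ### Tree metrics and leaves -/

namespace WeightedTree

variable {V : Type} (T : WeightedTree V)

theorem isPath_path (u v : V) : (T.path u v).IsPath :=
  (T.isTree.existsUnique_path u v).choose_spec.1

variable {T} in
theorem eq_path {u v : V} {p : T.graph.Walk u v} (hp : p.IsPath) : p = T.path u v :=
  (T.isTree.existsUnique_path u v).unique hp (T.isPath_path u v)

theorem dist_self (v : V) : T.dist v v = 0 := by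
  rw [dist, ← eq_path (p := .nil) (by simp)]
  rfl

theorem dist_comm (u v : V) : T.dist u v = T.dist v u := by
  rw [dist, dist, ← eq_path (T.isPath_path u v).reverse]
  simp

theorem dist_triangle (u v z : V) : T.dist u z ≤ T.dist u v + T.dist v z := by
  classical
  rw [dist, dist, dist, ← eq_path ((T.path u v).append (T.path v z)).bypass_isPath,
    ← List.sum_append, ← List.map_append, ← SimpleGraph.Walk.edges_append]
  exact ((SimpleGraph.Walk.edges_bypass_sublist_edges _).map _).sum_le_sum fun _ _ => zero_le

/-- A set of nodes that contains the paths between its members. -/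
def Convex (S : Finset V) : Prop :=
  ∀ x ∈ S, ∀ y ∈ S, ∀ z ∈ (T.path x y).support, z ∈ S

variable {T} {S : Finset V} {u p : V}

/-- A path from a leaf `u` of the subtree `S` starts with the edge to the neighbour `p`. -/
theorem Convex.path_eq_cons (hS : T.Convex S) (hu : u ∈ S)
    (hp : ∀ q ∈ S, T.graph.Adj u q → q = p) {y : V} (hy : y ∈ S) (hyu : y ≠ u) :
    ∃ h : T.graph.Adj u p, T.path u y = .cons h (T.path p y) := by
  have hsub := hS u hu y hy
  have hpath := T.isPath_path u y
  cases hP : T.path u y with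
  | nil => exact absurd rfl hyu
  | cons h P =>
    rename_i q
    rw [hP] at hsub hpath
    obtain rfl : q = p := hp q (hsub q (by simp)) h
    refine ⟨h, ?_⟩
    rw [eq_path hpath.of_cons]

theorem Convex.dist_eq (hS : T.Convex S) (hu : u ∈ S)
    (hp : ∀ q ∈ S, T.graph.Adj u q → q = p) {y : V} (hy : y ∈ S) (hyu : y ≠ u) :
    T.dist u y = T.weight s(u, p) + T.dist p y := by
  obtain ⟨h, he⟩ := hS.path_eq_cons hu hp hy hyu
  simp [dist, he]

theorem Convex.erase [DecidableEq V] (hS : T.Convex S) (hu : u ∈ S)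
    (hp : ∀ q ∈ S, T.graph.Adj u q → q = p) : T.Convex (S.erase u) := by
  intro x hx y hy z hz
  rw [Finset.mem_erase] at hx hy ⊢
  refine ⟨?_, hS x hx.2 y hy.2 z hz⟩
  rintro rfl
  -- otherwise the path from `x` to `y` would visit `p` both before and after `u`
  have h1 := T.isPath_path x y
  have h2 : ((T.path x y).takeUntil z hz).reverse = T.path z x :=
    eq_path (h1.takeUntil hz).reverse
  have h3 : (T.path x y).dropUntil z hz = T.path z y := eq_path (h1.dropUntil hz)
  obtain ⟨h4, h5⟩ := hS.path_eq_cons hu hp hx.2 hx.1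
  obtain ⟨h6, h7⟩ := hS.path_eq_cons hu hp hy.2 hy.1
  have h8 := (T.path x y).take_spec hz
  have h9 : ((T.path x y).takeUntil z hz) = (T.path z x).reverse := by rw [← h2]; simp
  rw [h9, h3, h5, h7] at h8
  rw [← h8, SimpleGraph.Walk.isPath_def, SimpleGraph.Walk.support_append] at h1
  refine (List.nodup_append.1 h1).2.2 p ?_ p ?_ rfl
  · simp
  · simp

/-- A subtree with at least two nodes has a leaf. -/
theorem Convex.exists_leaf (hS : T.Convex S) (h2 : 1 < S.card) :
    ∃ u ∈ S, ∃ p ∈ S, T.graph.Adj u p ∧ ∀ q ∈ S, T.graph.Adj u q → q = p := by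
  classical
  have : Nontrivial (S : Set V) := by
    rw [Set.nontrivial_coe_sort]
    exact Finset.one_lt_card_iff_nontrivial.1 h2
  have htree : (T.graph.induce (S : Set V)).IsTree := by
    refine ⟨⟨fun x y => ?_⟩, T.isTree.isAcyclic.induce _⟩
    exact ((T.path x y).induce (S : Set V) fun z hz => hS x x.2 y y.2 z hz).reachable
  obtain ⟨u, hu⟩ := SimpleGraph.exists_minimal_degree_vertex (T.graph.induce (S : Set V))
  rw [htree.minDegree_eq_one_of_nontrivial, eq_comm,
    SimpleGraph.degree_eq_one_iff_existsUnique_adj] at hu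
  obtain ⟨p, hp, huniq⟩ := hu
  refine ⟨u, u.2, p, p.2, hp, fun q hq hadj => ?_⟩
  exact congrArg Subtype.val (huniq ⟨q, hq⟩ hadj)

end WeightedTree

/-- A sum over the edges at `v`, given by the edge list, is a sum over the neighbours of `v`. -/
theorem EdgeList.sum_eq {n : ℕ} {G : SimpleGraph (Fin n)} (e : EdgeList G) [DecidableRel G.Adj]
    {M : Type*} [AddCommMonoid M] (v : Fin n) (φ : Fin n → M) :
    ∑ j, ((if e.src j = v then φ (e.dst j) else 0) + if e.dst j = v then φ (e.src j) else 0) =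
      ∑ q with G.Adj v q, φ q := by
  have hadj (j) : G.Adj (e.src j) (e.dst j) := by
    rw [← SimpleGraph.mem_edgeSet, ← e.range_eq]
    exact ⟨j, rfl⟩
  have hother (j) : (if e.src j = v then φ (e.dst j) else 0) +
      (if e.dst j = v then φ (e.src j) else 0) =
      ∑ q with G.Adj v q, if s(e.src j, e.dst j) = s(v, q) then φ q else 0 := by
    have hne := (hadj j).ne
    by_cases h1 : e.src j = v
    · subst h1
      rw [if_pos rfl, if_neg hne.symm, add_zero, Finset.sum_eq_single (e.dst j)]
      · simp
      · intro q _ hq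
        rw [if_neg]
        rw [Sym2.congr_right]
        exact hq.symm
      · intro h
        exact absurd (hadj j) (by simpa using h)
    · by_cases h2 : e.dst j = v
      · subst h2
        rw [if_neg h1, if_pos rfl, zero_add, Finset.sum_eq_single (e.src j)]
        · simp [Sym2.eq_swap]
        · intro q _ hq
          rw [if_neg]
          rw [Sym2.eq_swap, Sym2.congr_right]
          exact hq.symm
        · intro h
          exact absurd (hadj j).symm (by simpa using h)
      · rw [if_neg h1, if_neg h2, add_zero, Finset.sum_eq_zero]
        intro q _
        rw [if_neg]
        simp only [Sym2.eq_iff]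
        tauto
  rw [Finset.sum_congr rfl fun j _ => hother j, Finset.sum_comm]
  refine Finset.sum_congr rfl fun q hq => ?_
  have hq' : s(v, q) ∈ Set.range fun i => s(e.src i, e.dst i) := by
    rw [e.range_eq]
    simpa using hq
  obtain ⟨i, hi⟩ := hq'
  dsimp only at hi
  rw [Finset.sum_eq_single i]
  · rw [if_pos hi]
  · intro j _ hj
    rw [if_neg]
    intro h
    exact hj (e.injective (h.trans hi.symm))
  · simp

/-! ### The reduced problem and its solution by trees -/

namespace Tr

theorem Sorted.shift {t : Tr} {s b w : ℝ} (h : t.Sorted s) (hw : 0 ≤ w) (ht : t ≠ nil)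
    (hb : 0 ≤ b) (hb' : b ≤ t.total) :
    (t.shift w s b).1.1.Sorted (t.shift w s b).1.2 ∧ 0 ≤ (t.shift w s b).2.2 := by
  obtain ⟨l₁, θ, p, q, l₂, h1, hp, hq, -, h2, h3⟩ := elems_shift w t s b h.2 ht hb hb'
  have h4 := h.1
  have h5 := h.2
  rw [h1] at h4 h5
  simp only [List.pairwise_append, List.pairwise_cons, List.mem_cons] at h4
  obtain ⟨h6, ⟨h7, h8⟩, h9⟩ := h4
  rw [Sorted, h2, h3]
  refine ⟨⟨?_, fun a ha => ?_⟩, hq⟩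
  · simp only [List.pairwise_append, List.pairwise_cons, List.pairwise_map, List.mem_cons,
      List.mem_map]
    refine ⟨h6.imp fun hab => by simpa using hab, ⟨?_, h8.imp fun hab => by simpa using hab⟩, ?_⟩
    · rintro _ ⟨a, ha, rfl⟩
      have := h7 a ha
      dsimp only
      linarith
    · rintro _ ⟨a, ha, rfl⟩ _ (rfl | ⟨a', ha', rfl⟩)
      · have := h9 a ha _ (.inl rfl)
        dsimp only at this ⊢
        linarith
      · have := h9 a ha _ (.inr ha')
        dsimp only
        linarith
  · simp only [List.mem_append, List.mem_cons, List.mem_map] at ha h5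
    rcases ha with ⟨a', ha', rfl⟩ | rfl | ⟨a', ha', rfl⟩
    · exact h5 a' (.inl ha')
    · exact hp
    · exact h5 a' (.inr (.inr ha'))

/-- Insert all segments of a list. -/
noncomputable def insAll (t : Tr × ℝ) (l : List (ℝ × ℝ)) : Tr × ℝ :=
  l.foldl (fun t a => t.1.ins t.2 a.1 a.2) t

theorem insAll_concat (t : Tr × ℝ) (l : List (ℝ × ℝ)) (a : ℝ × ℝ) :
    insAll t (l ++ [a]) = (insAll t l).1.ins (insAll t l).2 a.1 a.2 := by
  simp [insAll]

theorem insAll_spec {t : Tr × ℝ} {l : List (ℝ × ℝ)} (h : t.1.Sorted t.2) (hb : t.1.Balanced)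
    (hl : ∀ a ∈ l, 0 ≤ a.2) :
    (insAll t l).1.Sorted (insAll t l).2 ∧ (insAll t l).1.Balanced ∧
      ((insAll t l).1.elems (insAll t l).2).Perm (l ++ t.1.elems t.2) := by
  induction l generalizing t with
  | nil => exact ⟨h, hb, .refl _⟩
  | cons a l ih =>
    obtain ⟨h1, h2, h3⟩ := ih (t := t.1.ins t.2 a.1 a.2) (h.ins (hl a (by simp)))
      (balanced_ins _ _ _ _ hb).1 fun b hb => hl b (by simp [hb])
    refine ⟨h1, h2, h3.trans ?_⟩
    rw [List.cons_append]
    exact ((perm_ins a.1 a.2 h).append_left l).trans List.perm_middle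

theorem size_eq_of_perm {t : Tr} {s : ℝ} {l : List (ℝ × ℝ)} (h : (t.elems s).Perm l) :
    t.size = l.length := by
  rw [← length_elems t s, h.length_eq]

end Tr

/-- The problem `I` has been reduced to the nodes in `S`: node `x` has the segments of the tree
`tr x` with root slope `sl x` and the offset `B x`, and `c` is the cost so far. -/
structure Reduced {n : ℕ} (I : Problem n) (S : Finset (Fin n)) (tr : Fin n → Tr)
    (sl B : Fin n → ℝ) (c : ℝ) : Prop where
  convex : I.tree.Convex S
  sorted : ∀ x ∈ S, (tr x).Sorted (sl x)
  balanced : ∀ x ∈ S, (tr x).Balanced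
  ne_nil : ∀ x ∈ S, tr x ≠ .nil
  nonneg : ∀ x ∈ S, 0 ≤ B x
  le_total : ∀ x ∈ S, B x ≤ (tr x).total
  size_le : ∑ x ∈ S, (tr x).size + S.card ≤ 3 * n
  solution : ∀ r, IsLeast {r | Attains (fun x y => (I.tree.dist x y : ℝ)) S
    (fun x => (tr x).elems (sl x)) B c r} r → I.IsSolution r

namespace Reduced

variable {n : ℕ} {I : Problem n} {S : Finset (Fin n)} {tr : Fin n → Tr} {sl B : Fin n → ℝ}
  {c : ℝ} {u p : Fin n}

/-- The elimination of a leaf by shifting its segments and adding them to those of its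
neighbour. -/
theorem eliminate (h : Reduced I S tr sl B c) (hu : u ∈ S) (hp : p ∈ S)
    (hadj : I.tree.graph.Adj u p) (huniq : ∀ q ∈ S, I.tree.graph.Adj u q → q = p) {t : Tr × ℝ}
    (hts : t.1.Sorted t.2) (htb : t.1.Balanced)
    (ht : (t.1.elems t.2).Perm
      ((((tr u).shift (I.tree.weight s(u, p)) (sl u) (B u)).2 ::
        ((tr u).shift (I.tree.weight s(u, p)) (sl u) (B u)).1.1.elems
        ((tr u).shift (I.tree.weight s(u, p)) (sl u) (B u)).1.2) ++ (tr p).elems (sl p))) :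
    Reduced I (S.erase u) (Function.update tr p t.1) (Function.update sl p t.2)
      (Function.update B p (B p + B u)) (c + I.tree.weight s(u, p) * B u) := by
  obtain ⟨l₁, θ, q₁, q₂, l₂, h1, hq1, hq2, hB, h2, h3⟩ := Tr.elems_shift
    (I.tree.weight s(u, p)) (tr u) (sl u) (B u) (h.sorted u hu).2 (h.ne_nil u hu) (h.nonneg u hu)
    (h.le_total u hu)
  have hsu := (h.sorted u hu).1
  rw [h1] at hsu
  simp only [List.pairwise_append, List.pairwise_cons, List.mem_cons] at hsu
  obtain ⟨h6, ⟨h7, h8⟩, h9⟩ := hsu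
  rw [h2, h3] at ht
  have hpu : p ≠ u := hadj.ne'
  have hpS : p ∈ S.erase u := Finset.mem_erase.2 ⟨hpu, hp⟩
  have hsize := Tr.size_eq_of_perm ht
  have hsizeu : (tr u).size = l₁.length + l₂.length + 1 := by
    rw [← Tr.length_elems (tr u) (sl u), h1]
    simp
    omega
  have hsizep := Tr.length_elems (tr p) (sl p)
  simp only [List.cons_append, List.append_assoc, List.length_cons, List.length_append,
    List.length_map] at hsize
  have hupd {α : Type} (f : Fin n → α) (a : α) {P : Fin n → α → Prop} (hPp : P p a)
      (hP : ∀ x ∈ S, P x (f x)) : ∀ x ∈ S.erase u, P x (Function.update f p a x) := by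
    intro x hx
    by_cases hxp : x = p
    · subst hxp
      simpa using hPp
    · simpa [hxp] using hP x (Finset.mem_of_mem_erase hx)
  have hd : ∀ y ∈ S.erase u, (I.tree.dist u y : ℝ) =
      I.tree.weight s(u, p) + I.tree.dist p y := fun y hy => by
    rw [h.convex.dist_eq hu huniq (Finset.mem_of_mem_erase hy) (Finset.ne_of_mem_erase hy)]
    simp
  have hd' : ∀ y ∈ S.erase u, (I.tree.dist y u : ℝ) =
      I.tree.weight s(u, p) + I.tree.dist y p := fun y hy => by
    rw [I.tree.dist_comm, hd y hy, I.tree.dist_comm p]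
  have hS : insert u (S.erase u) = S := Finset.insert_erase hu
  have hLR (x m : ℝ) : Fill ((tr u).elems (sl u)) x m ↔
      Fill ((l₁ ++ [(θ, q₁)]) ++ (θ, q₂) :: l₂) x m := by
    rw [h1, List.append_assoc, fill_append, fill_append]
    simp only [List.cons_append, List.nil_append, fill_cut hq1 hq2]
  have hBu : GKR.total (l₁ ++ [(θ, q₁)]) = B u := by
    rw [← hB]
    simp [GKR.total]
  have hF : ∀ v ∈ S.erase u, v ≠ p → (Function.update tr p t.1 v).elems
      (Function.update sl p t.2 v) = (tr v).elems (sl v) := fun v _ hv => by simp [hv]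
  have hFp : ((Function.update tr p t.1 p).elems (Function.update sl p t.2 p)).Perm
      (((l₁ ++ [(θ, q₁)]).map (fun a => (a.1 - (I.tree.weight s(u, p) : ℝ), a.2)) ++
        ((θ, q₂) :: l₂).map fun a => (a.1 + (I.tree.weight s(u, p) : ℝ), a.2)) ++
        (tr p).elems (sl p)) := by
    simp only [Function.update_self]
    refine ht.trans (List.Perm.append_right _ ?_)
    simp only [List.map_append, List.map_cons, List.map_nil, List.append_assoc, List.cons_append,
      List.nil_append]
    refine List.perm_middle.symm.trans (List.Perm.append_left _ ?_)
    exact List.Perm.swap _ _ _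
  have hL : ∀ a ∈ l₁ ++ [(θ, q₁)], a.1 ≤ θ := by
    intro a ha
    rcases List.mem_append.1 ha with ha | ha
    · exact h9 a ha _ (.inl rfl)
    · rw [List.mem_singleton.1 ha]
  have hR : ∀ a ∈ (θ, q₂) :: l₂, θ ≤ a.1 := by
    intro a ha
    rcases List.mem_cons.1 ha with rfl | ha
    · exact le_rfl
    · exact h7 a ha
  refine ⟨h.convex.erase hu huniq, ?_, hupd tr t.1 htb h.balanced,
    hupd tr t.1 (P := fun _ a => a ≠ .nil) ?_ h.ne_nil,
    hupd B _ (P := fun _ a => 0 ≤ a) (add_nonneg (h.nonneg p hp) (h.nonneg u hu)) h.nonneg, ?_, ?_,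
    fun r hr => ?_⟩
  · intro x hx
    by_cases hxp : x = p
    · subst hxp
      simpa using hts
    · simpa [hxp] using h.sorted x (Finset.mem_of_mem_erase hx)
  · intro h0
    rw [h0] at hsize
    simp [Tr.size] at hsize
  · intro x hx
    by_cases hxp : x = p
    · subst hxp
      have hu := h.le_total u hu
      have hp := h.le_total x hp
      rw [Tr.total_eq _ (sl u), h1] at hu
      rw [Tr.total_eq _ (sl x)] at hp
      simp only [Function.update_self]
      rw [Tr.total_eq _ t.2, (ht.map _).sum_eq]
      simp at hu ⊢
      have hcomp (w : ℝ) (l : List (ℝ × ℝ)) :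
          List.map (Prod.snd ∘ fun a => (a.1 + w, a.2)) l = l.map Prod.snd :=
        List.map_congr_left fun _ _ => rfl
      have hcomp' (w : ℝ) (l : List (ℝ × ℝ)) :
          List.map (Prod.snd ∘ fun a => (a.1 - w, a.2)) l = l.map Prod.snd :=
        List.map_congr_left fun _ _ => rfl
      rw [hcomp, hcomp']
      linarith
    · simpa [hxp] using h.le_total x (Finset.mem_of_mem_erase hx)
  · have h10 := h.size_le
    rw [← Finset.add_sum_erase S _ hu, ← Finset.add_sum_erase _ _ hpS] at h10
    rw [← Finset.add_sum_erase _ _ hpS, Function.update_self,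
      Finset.sum_congr rfl fun x hx => by
        rw [Function.update_of_ne (Finset.ne_of_mem_erase hx)], Finset.card_erase_of_mem hu]
    have := Finset.card_pos.2 ⟨u, hu⟩
    omega
  · refine h.solution r (isLeast_of_dominated ?_ ?_ hr)
    · intro r hr
      rw [Set.mem_ofPred_eq, ← hS] at hr
      obtain ⟨r', h11, h12⟩ := hr.eliminate (B' := Function.update B p (B p + B u))
        (F' := fun x => (Function.update tr p t.1 x).elems (Function.update sl p t.2 x))
        (I.tree.weight s(u, p)).2 (by simp) hpS (by simp [I.tree.dist_self]) hd hd'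
        hLR hBu hL hR hF hFp (fun v _ hv => by simp [hv]) (by simp)
      exact ⟨r', h12, h11⟩
    · intro r hr
      obtain ⟨r', h11, h12⟩ := hr.of_eliminate (d := fun x y => (I.tree.dist x y : ℝ)) (u := u)
        (p := p) (S := S.erase u) (F := fun x => (tr x).elems (sl x)) (B := B)
        (I.tree.weight s(u, p)).2 (by simp) hpS
        (congrArg _ (I.tree.dist_self u)) (congrArg _ (I.tree.dist_self p)) hd hd'
        hLR hBu hF hFp (fun v _ hv => by simp [hv]) (by simp)
      rw [hS] at h12
      exact ⟨r', h12, h11⟩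

/-- When one node is left, the solution is found by filling its segments in order. -/
theorem isSolution (h : Reduced I {p} tr sl B c) :
    I.IsSolution (c + greedySum ((tr p).elems (sl p)) (B p)) := by
  apply h.solution
  have hp := Finset.mem_singleton_self p
  obtain ⟨h1, h2⟩ := isLeast_greedySum (h.sorted p hp).1 (h.sorted p hp).2 (h.nonneg p hp)
    (by simpa [GKR.total, ← Tr.total_eq] using h.le_total p hp)
  refine ⟨⟨B, fun _ => greedySum ((tr p).elems (sl p)) (B p), fun _ _ => 0, ?_, by simp,
    by simp, by simp⟩, ?_⟩
  · intro v hv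
    rw [Finset.mem_singleton.1 hv]
    exact h1
  · rintro r ⟨x, m, π, hf, hπ, hnet, rfl⟩
    have hxB : x p = B p := by
      have := hnet p hp
      simp only [Finset.sum_singleton, sub_self] at this
      linarith
    have := h2 (a := m p) (by simpa [hxB] using hf p hp)
    simpa [I.tree.dist_self] using this

/-- The initial trees. -/
theorem init (htr : ∀ x, ((tr x).elems (sl x)).Perm
      [(-(I.destroy x : ℝ), (I.source x : ℝ)), ((I.create x : ℝ), (I.target x : ℝ))])
    (hs : ∀ x, (tr x).Sorted (sl x)) (hb : ∀ x, (tr x).Balanced) :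
    Reduced I Finset.univ tr sl (fun x => I.target x) (∑ x, (I.destroy x : ℝ) * I.source x) := by
  have hsize (x) : (tr x).size = 2 := Tr.size_eq_of_perm (htr x)
  refine ⟨fun x _ y _ z _ => Finset.mem_univ z, fun x _ => hs x, fun x _ => hb x, fun x _ h => ?_,
    fun x _ => (I.target x).2, fun x _ => ?_, ?_, fun r hr => ?_⟩
  · have := hsize x
    rw [h] at this
    simp [Tr.size] at this
  · rw [Tr.total_eq _ (sl x), ((htr x).map _).sum_eq]
    simp
  · simp [hsize]
    omega
  · exact isGKRDistance_of_isLeast I.tree.dist_self I.tree.dist_triangle htr hr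

end Reduced

/-! ### Reading the edges -/

/-- The sum of `φ` over the neighbours of a node in a set of nodes. -/
def nbrSum {V M : Type*} [AddCommMonoid M] (G : SimpleGraph V) [DecidableRel G.Adj] (S : Finset V)
    (φ : V → M) (v : V) : M :=
  ∑ q ∈ S with G.Adj v q, φ q

theorem nbrSum_erase {V M : Type*} [AddCommMonoid M] [DecidableEq V] {G : SimpleGraph V}
    [DecidableRel G.Adj] {S : Finset V} {u : V} (hu : u ∈ S) (φ : V → M) (v : V) :
    nbrSum G S φ v = (if G.Adj v u then φ u else 0) + nbrSum G (S.erase u) φ v := by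
  simp only [nbrSum, Finset.sum_filter]
  rw [← Finset.add_sum_erase S _ hu]

/-- Read the edge with number `i`, in register `11`, and count it at both ends: array `2` holds
the degrees, array `3` the sums of the neighbours, and real array `5` the sums of the weights. -/
def edgeBody : Cmd := block
  [.nload 12 0 11, .nload 13 1 11, .rload 7 0 11,
   .nload 17 2 12, .nadd 17 17 16, .nstore 2 12 17,
   .nload 17 2 13, .nadd 17 17 16, .nstore 2 13 17,
   .nload 17 3 12, .nadd 17 17 13, .nstore 3 12 17,
   .nload 17 3 13, .nadd 17 17 12, .nstore 3 13 17,
   .rload 8 5 12, .radd 8 8 7, .rstore 5 12 8,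
   .rload 8 5 13, .radd 8 8 7, .rstore 5 13 8,
   .nadd 11 11 16]

/-- The sum over the ends `y` of the first `i` edges of a function of the edge. -/
def endSum {M : Type*} [AddCommMonoid M] (s : State) (i y : ℕ) (φ ψ : ℕ → M) : M :=
  ∑ j ∈ Finset.range i, ((if s.narr 0 j = y then φ j else 0) + if s.narr 1 j = y then ψ j else 0)

theorem endSum_succ {M : Type*} [AddCommMonoid M] (s : State) (i y : ℕ) (φ ψ : ℕ → M) :
    endSum s (i + 1) y φ ψ = endSum s i y φ ψ +
      ((if s.narr 0 i = y then φ i else 0) + if s.narr 1 i = y then ψ i else 0) :=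
  Finset.sum_range_succ _ _

/-- The state `t` arises from `s` by reading the first `i` edges. -/
structure EdgesRead (s : State) (i : ℕ) (t : State) : Prop where
  idx : t.nreg 11 = i
  le : i ≤ s.nreg 15
  nreg : ∀ x, x ≤ 2 ∨ x = 15 ∨ x = 16 → t.nreg x = s.nreg x
  ans : t.rreg rAns = s.rreg rAns
  narr : ∀ A, A ≠ 2 → A ≠ 3 → t.narr A = s.narr A
  rarr : ∀ A, A ≠ 5 → t.rarr A = s.rarr A
  degree : ∀ y, t.narr 2 y = endSum s i y (fun _ => 1) fun _ => 1
  nbr : ∀ y, t.narr 3 y = endSum s i y (s.narr 1) (s.narr 0)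
  weight : ∀ y, t.rarr 5 y = endSum s i y (s.rarr 0) (s.rarr 0)

theorem runs_edgeBody {s t : State} {i : ℕ} (h : EdgesRead s i t) (h1 : s.nreg 16 = 1)
    (hi : i < s.nreg 15) :
    Runs procs edgeBody t fun k t => k ≤ 23 ∧ EdgesRead s (i + 1) t := by
  obtain ⟨h2, h3, h4, h5, h6, h7, h8, h9, h10⟩ := h
  have h16 := h4 16 (by simp)
  have e0 := h6 0 (by simp) (by simp)
  have e1 := h6 1 (by simp) (by simp)
  have e2 := h7 0 (by simp)
  simp only [edgeBody, block, runs_thenDo_cons, runs_thenDo_nil, runs_instr]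
  refine ⟨by norm_num, ⟨?_, by omega, fun x hx => ?_, ?_, fun A hA hA' => ?_, fun A hA => ?_,
    fun y => ?_, fun y => ?_, fun y => ?_⟩⟩
  · simp [h2, h16, h1]
  · rw [← h4 x hx]
    simp
    grind
  · simpa using h5
  · rw [← h6 A hA hA']
    ext j
    simp [hA, hA']
  · rw [← h7 A hA]
    ext j
    simp [hA]
  · rw [endSum_succ, ← h8]
    simp [e0, e1, h2, h16, h1]
    grind
  · rw [endSum_succ, ← h9]
    simp [e0, e1, h2]
    grind
  · rw [endSum_succ, ← h10]
    simp [e0, e1, e2, h2]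
    grind

theorem runs_edges {s : State} (h11 : s.nreg 11 = 0) (h1 : s.nreg 16 = 1)
    (h2 : ∀ y, s.narr 2 y = 0) (h3 : ∀ y, s.narr 3 y = 0) (h5 : ∀ y, s.rarr 5 y = 0) :
    Runs procs (.loop (.nlt 11 15) edgeBody) s fun k t => k ≤ 24 * s.nreg 15 + 1 ∧
      EdgesRead s (s.nreg 15) t := by
  refine (runs_loop (EdgesRead s) (fun i => 24 * i) (fun i => s.nreg 15 - i) ?_ 0 s ?_).mono ?_
  · intro i t h hb
    have h15 := h.nreg 15 (by simp)
    simp only [Test.Holds, h.idx, h15] at hb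
    refine (runs_edgeBody h h1 hb).mono fun k t' ht => ⟨i + 1, ht.2, by omega, by omega⟩
  · exact ⟨h11, by simp, by simp, rfl, by simp, by simp, by simp [endSum, h2], by simp [endSum, h3],
      by simp [endSum, h5]⟩
  · rintro k t ⟨i, h, hb, hk⟩
    have h15 := h.nreg 15 (by simp)
    simp only [Test.Holds, h.idx, h15] at hb
    have := h.le
    obtain rfl : i = s.nreg 15 := by omega
    exact ⟨by omega, h⟩

theorem endSum_eq {n : ℕ} {G : SimpleGraph (Fin n)} [DecidableRel G.Adj] (e : EdgeList G)
    {M : Type*} [AddCommMonoid M] {s : State}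
    (h0 : ∀ j, s.narr 0 j = toArray (fun i => (e.src i : ℕ)) j)
    (h1 : ∀ j, s.narr 1 j = toArray (fun i => (e.dst i : ℕ)) j) (v : Fin n) {φ ψ : ℕ → M}
    {χ : Fin n → M} (hφ : ∀ j, e.src j = v → φ j = χ (e.dst j))
    (hψ : ∀ j, e.dst j = v → ψ j = χ (e.src j)) :
    endSum s (n - 1) v φ ψ = nbrSum G Finset.univ χ v := by
  rw [nbrSum, ← e.sum_eq, endSum, Finset.sum_range]
  refine Finset.sum_congr rfl fun j _ => ?_
  simp only [h0, h1, toArray, j.2, dite_true, Fin.val_inj]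
  congr 1
  · split_ifs with h
    · exact hφ j h
    · rfl
  · split_ifs with h
    · exact hψ j h
    · rfl

/-! ### The initial trees -/

/-- Build the tree of the node `v`, in register `11`. The segment `(-λ_d v, a v)` stands for mass
that is not destroyed, and `(λ_c v, b v)` for mass that is created. -/
def initBody : Cmd :=
  thenDo [.nconst nTree 0, .rconst 7 0, .rload rKey 1 11, .rload rLen 3 11, .rmul 8 rKey rLen,
    .radd rAns rAns 8, .rsub rKey 7 rKey] <|
  .seq (.call 0) <|
  thenDo [.rload rKey 2 11, .rload rLen 4 11] <|
  .seq (.call 0) <| block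
    [.nstore 4 11 nTree, .rstore 6 11 rSlope, .nconst 17 2, .nstore 5 11 17, .nadd 11 11 16]

/-- The initial tree of the node `v`, and its root slope. -/
noncomputable def Problem.initTree {n : ℕ} (I : Problem n) (v : Fin n) : Tr × ℝ :=
  Tr.insAll (.nil, 0)
    [(-(I.destroy v : ℝ), (I.source v : ℝ)), ((I.create v : ℝ), (I.target v : ℝ))]

theorem Problem.initTree_spec {n : ℕ} (I : Problem n) (v : Fin n) :
    (I.initTree v).1.Sorted (I.initTree v).2 ∧ (I.initTree v).1.Balanced ∧
      ((I.initTree v).1.elems (I.initTree v).2).Perm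
        [(-(I.destroy v : ℝ), (I.source v : ℝ)), ((I.create v : ℝ), (I.target v : ℝ))] := by
  have h := Tr.insAll_spec (t := (.nil, 0)) (l := [(-(I.destroy v : ℝ), (I.source v : ℝ)),
    ((I.create v : ℝ), (I.target v : ℝ))]) (by simp [Tr.Sorted, Tr.elems]) trivial (by simp)
  simpa [Problem.initTree, Tr.elems] using h

/-- The state `t` arises from `s` by building the trees of the first `i` nodes. -/
structure TreesBuilt {n : ℕ} (I : Problem n) (s : State) (i : ℕ) (t : State) : Prop where
  heap : Heap t
  idx : t.nreg 11 = i
  le : i ≤ n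
  zero : t.nreg 0 = n
  one : t.nreg 16 = 1
  ans : t.rreg rAns = ∑ v : Fin n with v.val < i, (I.destroy v : ℝ) * I.source v
  narr : ∀ A j, A < 4 → t.narr A j = s.narr A j
  rarr : ∀ A j, A < 6 → t.rarr A j = s.rarr A j
  tree : ∀ v : Fin n, v.val < i → Rep t (I.initTree v).1 (t.narr 4 v)
  slope : ∀ v : Fin n, v.val < i → t.rarr 6 v = (I.initTree v).2
  count : ∀ v : Fin n, v.val < i → t.narr 5 v = 2

@[simp] theorem rep_setNArr {s : State} {A i j v : ℕ} {T : Tr} (hA : A < 10) :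
    Rep (s.setNArr A j v) T i ↔ Rep s T i := by
  induction T generalizing i with
  | nil => rfl
  | node lv l dl len r dr ihl ihr =>
    have h10 : 10 ≠ A := by omega
    have h11 : 11 ≠ A := by omega
    have h12 : 12 ≠ A := by omega
    simp [Rep, ihl, ihr, h10, h11, h12]

@[simp] theorem rep_setRArr {s : State} {A i j : ℕ} {v : ℝ} {T : Tr} (hA : A < 10) :
    Rep (s.setRArr A j v) T i ↔ Rep s T i := by
  induction T generalizing i with
  | nil => rfl
  | node lv l dl len r dr ihl ihr =>
    have h10 : 10 ≠ A := by omega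
    have h11 : 11 ≠ A := by omega
    have h12 : 12 ≠ A := by omega
    have h13 : 13 ≠ A := by omega
    simp [Rep, ihl, ihr, h10, h11, h12, h13]

@[simp] theorem heap_setNArr {s : State} {A j v : ℕ} (hA : A < 10) :
    Heap (s.setNArr A j v) ↔ Heap s := by
  have h10 : 10 ≠ A := by omega
  have h12 : 12 ≠ A := by omega
  constructor <;> rintro ⟨h1, h2, h3⟩ <;> constructor <;> simp_all

@[simp] theorem heap_setRArr {s : State} {A j : ℕ} {v : ℝ} (hA : A < 10) :
    Heap (s.setRArr A j v) ↔ Heap s := by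
  have h13 : 13 ≠ A := by omega
  constructor <;> rintro ⟨h1, h2, h3⟩ <;> constructor <;> simp_all

theorem Core.narr_lt {s t : State} (e : Core s t) {A j : ℕ} (hA : A < 10) :
    t.narr A j = s.narr A j :=
  e.narr A j (.inl hA)

theorem Core.rarr_lt {s t : State} (e : Core s t) {A j : ℕ} (hA : A < 10) :
    t.rarr A j = s.rarr A j :=
  e.rarr A j (.inl hA)

theorem runs_initBody (hp : procs[0]? = some insBody) {n : ℕ} {I : Problem n} {s t : State} {i : ℕ}
    (h : TreesBuilt I s i t) (hi : i < n) (h1 : s.rarr 1 i = I.destroy ⟨i, hi⟩)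
    (h2 : s.rarr 2 i = I.create ⟨i, hi⟩) (h3 : s.rarr 3 i = I.source ⟨i, hi⟩)
    (h4 : s.rarr 4 i = I.target ⟨i, hi⟩) :
    Runs procs initBody t fun k t => k ≤ 460 ∧ TreesBuilt I s (i + 1) t := by
  have hidx := h.idx
  have e1 := (h.rarr 1 i (by simp)).trans h1
  have e2 := (h.rarr 2 i (by simp)).trans h2
  have e3 := (h.rarr 3 i (by simp)).trans h3
  have e4 := (h.rarr 4 i (by simp)).trans h4
  simp only [initBody, block, runs_thenDo_cons, runs_thenDo_nil, runs_seq, Instr.exec]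
  refine runs_call hp ?_
  refine (runs_insBody hp .nil trivial _ (by simpa using h.heap) (by simp [Rep])).mono ?_
  rintro k t' ⟨hk, et, hR, hsl⟩
  have hE : Core t t' := .trans (by simp) et.toCore
  have hans := et.ans
  simp [hidx, e1, e3] at hR hsl hans
  refine runs_call hp ?_
  refine (runs_insBody hp _ (Tr.balanced_ins .nil _ _ _ trivial).1 _
    (by simpa using h.heap.core hE) (by simpa using hR)).mono ?_
  rintro k' t'' ⟨hk', et', hR', hsl'⟩
  have hE' : Core t t'' := hE.trans (.trans (by simp) et'.toCore)
  have hans' := et'.ans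
  simp [hans] at hans'
  have hidx' : t'.nreg 11 = i := by rw [hE.nreg _ (by norm_num), hidx]
  have e5 := (hE.rarr_lt (A := 2) (by simp)).trans e2
  have e6 := (hE.rarr_lt (A := 4) (by simp)).trans e4
  have hR2 : Rep t'' (I.initTree ⟨i, hi⟩).1 (t''.nreg 3) := by
    simp [hidx', e5, e6, hsl] at hR'
    exact hR'
  have hsl2 : t''.rreg 1 = (I.initTree ⟨i, hi⟩).2 := by
    simp [hidx', e5, e6, hsl] at hsl'
    exact hsl'
  have hidx2 : t''.nreg 11 = i := by rw [hE'.nreg _ (by norm_num), hidx]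
  have h16 : t''.nreg 16 = 1 := by rw [hE'.nreg _ (by norm_num), h.one]
  simp only [runs_instr]
  refine ⟨?_, ?_⟩
  · simp [Tr.depth, Tr.ins] at hk hk'
    omega
  have hval (v : Fin n) (hv : v.val < i + 1) (hv' : v.val ≠ i) : v.val < i := by omega
  refine ⟨by simpa using h.heap.core hE', by simp [hidx2, h16], hi, ?_, ?_, ?_, ?_, ?_, ?_, ?_, ?_⟩
  · simp [hE'.zero, h.zero]
  · simp [h16]
  · simp [hans', h.ans]
    have hset : Finset.univ.filter (fun v : Fin n => v.val ≤ i) =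
        insert ⟨i, hi⟩ (Finset.univ.filter fun v : Fin n => v.val < i) := by
      ext v
      simp [Fin.ext_iff]
      omega
    rw [hset, Finset.sum_insert (by simp), add_comm]
  · intro A j hA
    rw [← h.narr A j hA, ← hE'.narr_lt (by omega)]
    have h4 : A ≠ 4 := by omega
    have h5 : A ≠ 5 := by omega
    simp [h4, h5]
  · intro A j hA
    rw [← h.rarr A j hA, ← hE'.rarr_lt (by omega)]
    have h6 : A ≠ 6 := by omega
    simp [h6]
  · intro v hv
    by_cases hv' : v.val = i
    · obtain rfl : v = ⟨i, hi⟩ := Fin.ext hv'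
      simpa [hidx2] using hR2
    · simpa [hidx2, hv', hE'.narr_lt] using (h.tree v (hval v hv hv')).core hE'
  · intro v hv
    by_cases hv' : v.val = i
    · obtain rfl : v = ⟨i, hi⟩ := Fin.ext hv'
      simpa [hidx2] using hsl2
    · simpa [hidx2, hv', hE'.rarr_lt] using h.slope v (hval v hv hv')
  · intro v hv
    by_cases hv' : v.val = i
    · obtain rfl : v = ⟨i, hi⟩ := Fin.ext hv'
      simp [hidx2]
    · simpa [hidx2, hv', hE'.narr_lt] using h.count v (hval v hv hv')

theorem runs_init (hp : procs[0]? = some insBody) {n : ℕ} {I : Problem n} {s : State}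
    (h : TreesBuilt I s 0 s) (h1 : ∀ v : Fin n, s.rarr 1 v = I.destroy v)
    (h2 : ∀ v : Fin n, s.rarr 2 v = I.create v) (h3 : ∀ v : Fin n, s.rarr 3 v = I.source v)
    (h4 : ∀ v : Fin n, s.rarr 4 v = I.target v) :
    Runs procs (.loop (.nlt 11 0) initBody) s fun k t => k ≤ 461 * n + 1 ∧
      TreesBuilt I s n t := by
  refine (runs_loop (TreesBuilt I s) (fun i => 461 * i) (fun i => n - i) ?_ 0 s h).mono ?_
  · intro i t h hb
    simp only [Test.Holds, h.idx, h.zero] at hb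
    exact (runs_initBody hp h hb (h1 ⟨i, hb⟩) (h2 ⟨i, hb⟩) (h3 ⟨i, hb⟩) (h4 ⟨i, hb⟩)).mono
      fun k t' ht => ⟨i + 1, ht.2, by omega, by omega⟩
  · rintro k t ⟨i, h, hb, hk⟩
    simp only [Test.Holds, h.idx, h.zero] at hb
    obtain rfl : i = n := by have := h.le; omega
    exact ⟨by omega, h⟩

/-! ### Merging and evaluating trees -/

theorem Rep.congr {s t : State} (h1 : t.nreg nTop = s.nreg nTop)
    (h2 : ∀ A i, A ≠ aStack → t.narr A i = s.narr A i)
    (h3 : ∀ A i, A ≠ aStack → t.rarr A i = s.rarr A i) {T : Tr} {i : ℕ} (h : Rep s T i) :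
    Rep t T i := by
  induction T generalizing i with
  | nil => exact h
  | node lv l dl len r dr ihl ihr =>
    obtain ⟨g0, g1, g2, g3, g4, g5, g6, g7, g8⟩ := h
    refine ⟨g0, h1 ▸ g1, ?_, ?_, ?_, ?_, ?_, ?_, ?_⟩
    · rw [h2 _ _ (by norm_num), g2]
    · rw [h3 _ _ (by norm_num), g3]
    · rw [h3 _ _ (by norm_num), g4]
    · rw [h3 _ _ (by norm_num), g5]
    · rw [h3 _ _ (by norm_num), g6]
    · rw [h2 _ _ (by norm_num)]
      exact ihl g7
    · rw [h2 _ _ (by norm_num)]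
      exact ihr g8

/-- Insert the segment at `nVisit`. -/
def mergeVisit : Cmd := thenDo [.rmove rKey rVisit, .rload rLen aSeg nVisit] (.call 0)

theorem Tr.size_insAll {t : Tr × ℝ} {l : List (ℝ × ℝ)} (h : t.1.Sorted t.2) (hb : t.1.Balanced)
    (hl : ∀ a ∈ l, 0 ≤ a.2) : (insAll t l).1.size = l.length + t.1.size := by
  rw [size_eq_of_perm (insAll_spec h hb hl).2.2, List.length_append, length_elems]

/-- The traversal of the tree `T'` inserts all its segments into the tree `T`. -/
theorem runs_merge (hp0 : procs[0]? = some insBody)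
    (hp2 : procs[2]? = some (travBody 2 mergeVisit)) {s : State} {T T' : Tr} {N : ℕ} (hs : Heap s)
    (hT : Rep s T (s.nreg nTree)) (hT' : Rep s T' (s.nreg nVisit)) (hsT : T.Sorted (s.rreg rSlope))
    (hbT : T.Balanced) (hsT' : T'.Sorted (s.rreg rVisit)) (hN : T'.size + T.size ≤ N) :
    Runs procs (.call 2) s fun k t =>
      k ≤ (110 * (2 * Nat.log 2 (N + 1) + 1) + 25) * T'.size + 4 ∧ Core s t ∧
      Rep t (Tr.insAll (T, s.rreg rSlope) (T'.elems (s.rreg rVisit))).1 (t.nreg nTree) ∧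
      t.rreg rSlope = (Tr.insAll (T, s.rreg rSlope) (T'.elems (s.rreg rVisit))).2 ∧
      t.rreg rAns = s.rreg rAns := by
  refine runs_call hp2 ?_
  set t₀ := (T, s.rreg rSlope) with ht₀
  refine (runs_travBody hp2 (T'.elems (s.rreg rVisit)) (fun L t =>
    Rep t (Tr.insAll t₀ L).1 (t.nreg nTree) ∧ t.rreg rSlope = (Tr.insAll t₀ L).2 ∧
      t.rreg rAns = s.rreg rAns) (110 * (2 * Nat.log 2 (N + 1) + 1) + 3) ?_ ?_ T' [] s hs hT' ?_
    ⟨hT, rfl, rfl⟩).mono ?_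
  · rintro L s' t ⟨h1, h2, h3⟩ g1 g2 g3 g4
    refine ⟨?_, ?_, ?_⟩
    · rw [g1 _ (by norm_num) (by norm_num) (by norm_num)]
      exact h1.congr (g1 _ (by norm_num) (by norm_num) (by norm_num)) g3 g4
    · rw [g2 _ (by norm_num) (by norm_num), h2]
    · rw [g2 _ (by norm_num) (by norm_num), h3]
  · rintro L s' hL ⟨h1, h2, h3⟩ hs'
    have hL' : L.length ≤ T'.size := by
      rw [← Tr.length_elems T' (s.rreg rVisit)]
      have := hL.length_le
      simp at this
      omega
    have hpos : ∀ a ∈ L, 0 ≤ a.2 := fun a ha => hsT'.2 a (hL.subset (by simp [ha]))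
    obtain ⟨-, hb, -⟩ := Tr.insAll_spec (t := t₀) hsT hbT hpos
    have hsize := Tr.size_insAll (t := t₀) hsT hbT hpos
    simp only [mergeVisit, runs_thenDo_cons, runs_thenDo_nil, Instr.exec]
    refine runs_call hp0 ?_
    refine (runs_insBody hp0 _ hb _ (by simpa using hs') (by simpa using h1)).mono ?_
    rintro k t ⟨hk, et, hR, hsl⟩
    simp [h2] at hR hsl
    rw [Tr.insAll_concat]
    refine ⟨?_, .trans (by simp) et.toCore, ?_, ?_, ⟨hR, hsl, ?_⟩⟩
    · have hlog : Nat.log 2 ((Tr.insAll t₀ L).1.size + 1) ≤ Nat.log 2 (N + 1) := by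
        refine Nat.log_mono_right ?_
        rw [hsize]
        simp only [ht₀]
        omega
      have hd := hb.depth_le_log
      have : 110 * ((Tr.insAll t₀ L).1.depth + 1) ≤ 110 * (2 * Nat.log 2 (N + 1) + 1) := by
        gcongr
        omega
      omega
    · simp [et.visit]
    · simp [et.rreg]
    · simp [et.ans, h3]
  · simp
  · rintro k t ⟨hk, e, h1, h2, h3⟩
    exact ⟨by linarith, e, h1, h2, h3⟩

/-- Fill the segment at `nVisit` and subtract its length from `rPos`. -/
def evalVisit : Cmd :=
  thenDo [.rload rLen aSeg nVisit] <| .seq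
    (.branch (.rlt rPos rLen) (.instr (.rmove rLen rPos)) (.instr .skip)) <| block
    [.rsub rPos rPos rLen, .rmul 8 rVisit rLen, .radd rAns rAns 8]

theorem runs_evalVisit {s : State} :
    Runs procs evalVisit s fun k t => k ≤ 7 ∧ Core s t ∧ t.nreg = s.nreg ∧
      t.rarr = s.rarr ∧ t.rreg rVisit = s.rreg rVisit ∧
      t.rreg rPos = s.rreg rPos - min (s.rreg rPos) (s.rarr aSeg (s.nreg nVisit)) ∧
      t.rreg rAns = s.rreg rAns +
        s.rreg rVisit * min (s.rreg rPos) (s.rarr aSeg (s.nreg nVisit)) := by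
  simp only [evalVisit, block, runs_thenDo_cons, runs_thenDo_nil, runs_seq, Instr.exec]
  by_cases h : s.rreg rPos < s.rarr aSeg (s.nreg nVisit)
  · apply runs_branch_true
    · simpa using h
    simp [min_eq_left h.le]
  · apply runs_branch_false
    · simpa using h
    simp [min_eq_right (not_lt.1 h)]

/-- The traversal of the tree `T` fills its segments in order. -/
theorem runs_eval (hp3 : procs[3]? = some (travBody 3 evalVisit)) {s : State} {T : Tr}
    (hs : Heap s) (hT : Rep s T (s.nreg nVisit)) :
    Runs procs (.call 3) s fun k t => k ≤ 29 * T.size + 4 ∧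
      t.rreg rAns = s.rreg rAns + greedySum (T.elems (s.rreg rVisit)) (s.rreg rPos) := by
  refine runs_call hp3 ?_
  refine (runs_travBody hp3 (T.elems (s.rreg rVisit)) (fun L t =>
    t.rreg rAns = s.rreg rAns + greedySum L (s.rreg rPos) ∧
      t.rreg rPos = greedyRest L (s.rreg rPos)) 7 ?_ ?_ T [] s hs hT ?_ ?_).mono ?_
  · rintro L s' t ⟨h1, h2⟩ - g2 - -
    exact ⟨by rw [g2 _ (by norm_num) (by norm_num), h1], by
      rw [g2 _ (by norm_num) (by norm_num), h2]⟩
  · rintro L s' - ⟨h1, h2⟩ -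
    refine runs_evalVisit.mono ?_
    rintro k t ⟨hk, e, g1, g2, g3, g4, g5⟩
    refine ⟨hk, e, by rw [g1], g3, ?_, ?_⟩
    · rw [g5, h1, h2, greedySum_concat, add_assoc]
    · rw [g4, h2, greedyRest_concat]
  · simp
  · simp [greedySum, greedyRest]
  · rintro k t ⟨hk, -, h, -⟩
    exact ⟨by omega, h⟩

/-! ### Stripping the leaves -/

section Stripping

open scoped Classical in
/-- The state `s` holds the reduced problem on the set of nodes `S`. Arrays `2` and `3` and real
array `5` hold the number of neighbours in `S`, their sum, and the sum of the weights of the edges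
to them; the degree is `0` outside `S`. -/
structure Stored {n : ℕ} (I : Problem n) (S : Finset (Fin n)) (tr : Fin n → Tr) (sl B : Fin n → ℝ)
    (c : ℝ) (s : State) : Prop where
  heap : Heap s
  zero : s.nreg 0 = n
  one : s.nreg 16 = 1
  ans : s.rreg rAns = c
  tree : ∀ v ∈ S, Rep s (tr v) (s.narr 4 v)
  slope : ∀ v ∈ S, s.rarr 6 v = sl v
  offset : ∀ v ∈ S, s.rarr 4 v = B v
  count : ∀ v ∈ S, s.narr 5 v = (tr v).size
  degree : ∀ v ∈ S, s.narr 2 v = nbrSum I.tree.graph S (fun _ => 1) v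
  nbr : ∀ v ∈ S, s.narr 3 v = nbrSum I.tree.graph S (fun q => (q : ℕ)) v
  weight : ∀ v ∈ S, s.rarr 5 v = nbrSum I.tree.graph S (fun q => (I.tree.weight s(v, q) : ℝ)) v
  dead : ∀ v ∉ S, s.narr 2 v = 0

/-- Remove the leaf with number `u`, in register `12`. -/
def detachInstrs : List Instr :=
  [.nload 13 3 12, .rload rW 5 12, .nconst 17 0, .nstore 2 12 17,
   .nload 17 2 13, .nsub 17 17 16, .nstore 2 13 17,
   .nload 17 3 13, .nsub 17 17 12, .nstore 3 13 17,
   .rload 7 5 13, .rsub 7 7 rW, .rstore 5 13 7,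
   .rload rKey 4 12, .rmul 7 rW rKey, .radd rAns rAns 7,
   .rload 7 4 13, .radd 7 7 rKey, .rstore 4 13 7,
   .nload nTree 4 12, .rload rSlope 6 12]

/-- Make the current tree the tree of the node `p`, in register `13`, and go to this node. -/
def attachInstrs : List Instr :=
  [.nstore 4 13 nTree, .rstore 6 13 rSlope, .nstore 5 13 19, .nmove 14 13, .nmove 12 13]

/-- Merge the current tree with the tree of the node `p`, in register `13`, by inserting the
segments of the smaller tree into the larger one. -/
def mergeCmd : Cmd :=
  thenDo [.nload 17 5 12, .nadd 17 17 16, .nload 18 5 13, .nadd 19 17 18] <|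
  .seq (.branch (.nlt 17 18)
    (block [.nmove nVisit nTree, .rmove rVisit rSlope, .nload nTree 4 13, .rload rSlope 6 13])
    (block [.nload nVisit 4 13, .rload rVisit 6 13])) <|
  .seq (.call 2) <| thenDo attachInstrs (.instr .skip)

/-- If the node `u` is a leaf, remove it and go on with its neighbour; otherwise take the next
node. -/
def stripBody : Cmd :=
  thenDo [.nload 17 2 12] <| .branch (.neq 17 16)
    (thenDo detachInstrs <| .seq (.call 1) <| .seq (.call 0) mergeCmd)
    (block [.nadd 11 11 16, .nmove 12 11])

variable {n : ℕ} {I : Problem n} {S : Finset (Fin n)} {tr : Fin n → Tr}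
  {sl B : Fin n → ℝ} {c : ℝ} {s t : State} {u p : Fin n}

open scoped Classical in
/-- A node with one neighbour. -/
theorem exists_unique_of_nbrSum_eq_one {V : Type*} {G : SimpleGraph V} {S : Finset V} {u : V}
    (h : nbrSum G S (fun _ => 1) u = 1) :
    ∃ p ∈ S, G.Adj u p ∧ (∀ q ∈ S, G.Adj u q → q = p) ∧
      ∀ {M : Type} [AddCommMonoid M] (φ : V → M), nbrSum G S φ u = φ p := by
  simp only [nbrSum, Finset.sum_const, smul_eq_mul, mul_one, Finset.card_eq_one] at h
  obtain ⟨p, hp⟩ := h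
  have h1 : p ∈ S ∧ G.Adj u p := by
    rw [← Finset.mem_filter, hp]
    exact Finset.mem_singleton_self p
  refine ⟨p, h1.1, h1.2, fun q hq hq' => ?_, fun φ => by simp [nbrSum, hp]⟩
  rw [← Finset.mem_singleton, ← hp]
  exact Finset.mem_filter.2 ⟨hq, hq'⟩

/-- Executing a list of instructions. -/
noncomputable def execAll (s : State) (l : List Instr) : State := l.foldl Instr.exec s

theorem runs_thenDo {l : List Instr} {d : Cmd} {Q : ℕ → State → Prop} :
    Runs procs (thenDo l d) s Q ↔ Runs procs d (execAll s l) fun k t => Q (l.length + k) t := by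
  induction l generalizing s Q with
  | nil => simp [execAll]
  | cons i l ih =>
    rw [runs_thenDo_cons, ih]
    simp only [execAll, List.foldl_cons, List.length_cons]
    refine iff_of_eq (congrArg _ ?_)
    ext k t
    rw [show 1 + (l.length + k) = l.length + 1 + k by omega]

open scoped Classical in
/-- The state after removing the leaf `u` with neighbour `p`: all is stored as it should be, except
for the tree of `p`. -/
structure Detached (I : Problem n) (S : Finset (Fin n)) (tr : Fin n → Tr) (sl B : Fin n → ℝ)
    (c : ℝ) (u p : Fin n) (s : State) : Prop where
  stored : Stored I (S.erase u) tr sl (Function.update B p (B p + B u))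
    (c + I.tree.weight s(u, p) * B u) s
  leaf : s.nreg 12 = u
  parent : s.nreg 13 = p
  count : s.narr 5 u = (tr u).size

theorem Stored.detach (h : Stored I S tr sl B c s) (hu : u ∈ S) (hp : p ∈ S)
    (hadj : I.tree.graph.Adj u p) (huniq : ∀ q ∈ S, I.tree.graph.Adj u q → q = p)
    (h12 : s.nreg 12 = u) (hn : s.narr 3 u = p) (hw : s.rarr 5 u = I.tree.weight s(u, p)) :
    Detached I S tr sl B c u p (execAll s detachInstrs) ∧
      (execAll s detachInstrs).nreg 11 = s.nreg 11 ∧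
      Rep (execAll s detachInstrs) (tr u) ((execAll s detachInstrs).nreg nTree) ∧
      (execAll s detachInstrs).rreg rSlope = sl u ∧
      (execAll s detachInstrs).rreg rKey = B u ∧
      (execAll s detachInstrs).rreg rW = I.tree.weight s(u, p) := by
  classical
  have hpu : p ≠ u := hadj.ne'
  have hpu' : (p : ℕ) ≠ u := fun h => hpu (Fin.ext h)
  have hB := h.offset u hu
  have hBp := h.offset p hp
  have hadj' : ∀ x ∈ S, (I.tree.graph.Adj x u ↔ x = p) := fun x hx =>
    ⟨fun h => huniq x hx h.symm, fun h => h ▸ hadj.symm⟩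
  have hsum {M : Type} [AddCommMonoid M] (φ : Fin n → M) (x) (hx : x ∈ S) :
      nbrSum I.tree.graph S φ x =
        (if x = p then φ u else 0) + nbrSum I.tree.graph (S.erase u) φ x := by
    rw [nbrSum_erase hu]
    simp only [hadj' x hx]
  have hS {x} (hx : x ∈ S.erase u) : x ∈ S ∧ (x : ℕ) ≠ u :=
    ⟨Finset.mem_of_mem_erase hx, fun h => Finset.ne_of_mem_erase hx (Fin.ext h)⟩
  refine ⟨⟨⟨?_, ?_, ?_, ?_, fun x hx => ?_, fun x hx => ?_, fun x hx => ?_, fun x hx => ?_,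
    fun x hx => ?_, fun x hx => ?_, fun x hx => ?_, fun x hx => ?_⟩, ?_, ?_, ?_⟩,
    ?_, ?_, ?_, ?_, ?_⟩
  all_goals simp only [execAll, detachInstrs, List.foldl_cons, List.foldl_nil, Instr.exec]
  · simpa using h.heap
  · simpa using h.zero
  · simpa using h.one
  · simp [h12, hw, hB, h.ans, hn, hpu']
  · simpa using h.tree x (hS hx).1
  · simpa using h.slope x (hS hx).1
  · have hx' := h.offset x (hS hx).1
    by_cases hxp : x = p
    · subst hxp
      simp [h12, hn, hpu', hB, hx']
    · have hxp' : (x : ℕ) ≠ p := fun h => hxp (Fin.ext h)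
      simp [h12, hn, hxp, hxp', hx']
  · simpa using h.count x (hS hx).1
  · have hx' := h.degree x (hS hx).1
    rw [hsum _ x (hS hx).1] at hx'
    by_cases hxp : x = p
    · subst hxp
      simp [h12, hn, hpu', hx', h.one]
    · have hxp' : (x : ℕ) ≠ p := fun h => hxp (Fin.ext h)
      simp [h12, hn, hxp', hx', hxp, (hS hx).2]
  · have hx' := h.nbr x (hS hx).1
    rw [hsum _ x (hS hx).1] at hx'
    by_cases hxp : x = p
    · subst hxp
      simp [h12, hn, hpu', hx']
    · have hxp' : (x : ℕ) ≠ p := fun h => hxp (Fin.ext h)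
      simp [h12, hn, hxp', hx', hxp]
  · have hx' := h.weight x (hS hx).1
    rw [hsum _ x (hS hx).1] at hx'
    by_cases hxp : x = p
    · subst hxp
      simp [h12, hn, hx', hw, Sym2.eq_swap (a := x) (b := u)]
    · have hxp' : (x : ℕ) ≠ p := fun h => hxp (Fin.ext h)
      simp [h12, hn, hxp', hx', hxp]
  · by_cases hxu : x = u
    · subst hxu
      simp [h12, hn, hpu'.symm]
    · have hx' : x ∉ S := fun h => hx (Finset.mem_erase.2 ⟨hxu, h⟩)
      have hxu' : (x : ℕ) ≠ u := fun h => hxu (Fin.ext h)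
      have hxp' : (x : ℕ) ≠ p := fun h => hx' (Fin.ext h ▸ hp)
      simp [h12, hn, hxu', hxp', h.dead x hx']
  · simp [h12]
  · simp [h12, hn]
  · simpa using h.count u hu
  · simp
  · simpa [h12, hn, hpu'] using h.tree u hu
  · simpa [h12, hn, hpu'] using h.slope u hu
  · simp [h12, hn, hpu', hB]
  · simp [h12, hn, hpu', hw]

theorem Stored.core (h : Stored I S tr sl B c s) (e : Core s t) (ha : t.rreg rAns = s.rreg rAns) :
    Stored I S tr sl B c t where
  heap := h.heap.core e
  zero := e.zero.trans h.zero
  one := (e.nreg _ (by norm_num)).trans h.one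
  ans := ha.trans h.ans
  tree v hv := by rw [e.narr_lt (by norm_num)]; exact (h.tree v hv).core e
  slope v hv := (e.rarr_lt (by norm_num)).trans (h.slope v hv)
  offset v hv := (e.rarr_lt (by norm_num)).trans (h.offset v hv)
  count v hv := (e.narr_lt (by norm_num)).trans (h.count v hv)
  degree v hv := (e.narr_lt (by norm_num)).trans (h.degree v hv)
  nbr v hv := (e.narr_lt (by norm_num)).trans (h.nbr v hv)
  weight v hv := (e.rarr_lt (by norm_num)).trans (h.weight v hv)
  dead v hv := (e.narr_lt (by norm_num)).trans (h.dead v hv)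

theorem Detached.core (h : Detached I S tr sl B c u p s) (e : Core s t)
    (ha : t.rreg rAns = s.rreg rAns) : Detached I S tr sl B c u p t where
  stored := h.stored.core e ha
  leaf := (e.nreg _ (by norm_num)).trans h.leaf
  parent := (e.nreg _ (by norm_num)).trans h.parent
  count := (e.narr_lt (by norm_num)).trans h.count

@[simp] theorem stored_setN {x v : ℕ} (h0 : x ≠ 0) (h1 : x ≠ 1) (h16 : x ≠ 16) :
    Stored I S tr sl B c (s.setN x v) ↔ Stored I S tr sl B c s := by
  constructor <;> rintro ⟨g1, g2, g3, g4, g5, g6, g7, g8, g9, g10, g11, g12⟩ <;> constructor <;>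
    simp_all [h0.symm, h16.symm]

@[simp] theorem stored_setR {x : ℕ} {v : ℝ} (h0 : x ≠ 0) :
    Stored I S tr sl B c (s.setR x v) ↔ Stored I S tr sl B c s := by
  constructor <;> rintro ⟨g1, g2, g3, g4, g5, g6, g7, g8, g9, g10, g11, g12⟩ <;> constructor <;>
    simp_all [h0.symm]

theorem Stored.attach (h : Stored I S tr sl B c s) (h13 : s.nreg 13 = p) {T : Tr × ℝ}
    (hT : Rep s T.1 (s.nreg nTree)) (hsl : s.rreg rSlope = T.2) (h19 : s.nreg 19 = T.1.size) :
    Stored I S (Function.update tr p T.1) (Function.update sl p T.2) B c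
        (execAll s attachInstrs) ∧
      (execAll s attachInstrs).nreg 11 = s.nreg 11 ∧ (execAll s attachInstrs).nreg 12 = p ∧
      (execAll s attachInstrs).nreg 14 = p := by
  simp only [execAll, attachInstrs, List.foldl_cons, List.foldl_nil, Instr.exec]
  refine ⟨⟨?_, ?_, ?_, ?_, fun x hx => ?_, fun x hx => ?_, fun x hx => ?_, fun x hx => ?_,
    fun x hx => ?_, fun x hx => ?_, fun x hx => ?_, fun x hx => ?_⟩, ?_, ?_, ?_⟩
  · simpa using h.heap
  · simpa using h.zero
  · simpa using h.one
  · simpa using h.ans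
  · by_cases hxp : x = p
    · subst hxp
      simpa [h13] using hT
    · have hxp' : (x : ℕ) ≠ p := fun h => hxp (Fin.ext h)
      simpa [h13, hxp, hxp'] using h.tree x hx
  · by_cases hxp : x = p
    · subst hxp
      simpa [h13] using hsl
    · have hxp' : (x : ℕ) ≠ p := fun h => hxp (Fin.ext h)
      simpa [h13, hxp, hxp'] using h.slope x hx
  · simpa using h.offset x hx
  · by_cases hxp : x = p
    · subst hxp
      simpa [h13] using h19
    · have hxp' : (x : ℕ) ≠ p := fun h => hxp (Fin.ext h)
      simpa [h13, hxp, hxp'] using h.count x hx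
  · simpa using h.degree x hx
  · simpa using h.nbr x hx
  · simpa using h.weight x hx
  · simpa using h.dead x hx
  · simp
  · simp [h13]
  · simp [h13]

/-- Merging takes time proportional to the size of the smaller tree, up to a logarithm. -/
theorem runs_mergeCmd (hp0 : procs[0]? = some insBody)
    (hp2 : procs[2]? = some (travBody 2 mergeVisit)) (h : Detached I S tr sl B c u p s)
    (hpS : p ∈ S.erase u) {T : Tr} (hT : Rep s T (s.nreg nTree)) (hTs : T.Sorted (s.rreg rSlope))
    (hTb : T.Balanced) (hTsize : T.size = (tr u).size + 1) (hps : (tr p).Sorted (sl p))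
    (hpb : (tr p).Balanced) {N : ℕ} (hN : T.size + (tr p).size ≤ N) :
    Runs procs mergeCmd s fun k t =>
      k ≤ (110 * (2 * Nat.log 2 (N + 1) + 1) + 25) * min T.size (tr p).size + 20 ∧
      t.nreg 11 = s.nreg 11 ∧ t.nreg 12 = p ∧ t.nreg 14 = p ∧
      ∃ T' : Tr × ℝ, T'.1.Sorted T'.2 ∧ T'.1.Balanced ∧
        (T'.1.elems T'.2).Perm (T.elems (s.rreg rSlope) ++ (tr p).elems (sl p)) ∧
        Stored I (S.erase u) (Function.update tr p T'.1) (Function.update sl p T'.2)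
          (Function.update B p (B p + B u)) (c + I.tree.weight s(u, p) * B u) t := by
  obtain ⟨hs, hu, hp, hcu⟩ := h
  have hcp := hs.count p hpS
  have htp := hs.tree p hpS
  have hsp := hs.slope p hpS
  have h1 := hs.one
  -- `X` is the tree traversed, and `Y` is the tree into which it is merged
  have key (s' : State) (X Y : Tr) (hs' : Stored I (S.erase u) tr sl
      (Function.update B p (B p + B u)) (c + I.tree.weight s(u, p) * B u) s')
      (h11 : s'.nreg 11 = s.nreg 11) (h13 : s'.nreg 13 = p)
      (h19 : s'.nreg 19 = T.size + (tr p).size) (hX : Rep s' X (s'.nreg nVisit))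
      (hY : Rep s' Y (s'.nreg nTree)) (hXs : X.Sorted (s'.rreg rVisit))
      (hYs : Y.Sorted (s'.rreg rSlope)) (hYb : Y.Balanced) (hmin : X.size = min T.size (tr p).size)
      (hXY : (X.elems (s'.rreg rVisit) ++ Y.elems (s'.rreg rSlope)).Perm
        (T.elems (s.rreg rSlope) ++ (tr p).elems (sl p))) :
      Runs procs (.seq (.call 2) (thenDo attachInstrs (.instr .skip))) s' fun k t =>
        k ≤ (110 * (2 * Nat.log 2 (N + 1) + 1) + 25) * min T.size (tr p).size + 10 ∧
        t.nreg 11 = s.nreg 11 ∧ t.nreg 12 = p ∧ t.nreg 14 = p ∧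
        ∃ T' : Tr × ℝ, T'.1.Sorted T'.2 ∧ T'.1.Balanced ∧
          (T'.1.elems T'.2).Perm (T.elems (s.rreg rSlope) ++ (tr p).elems (sl p)) ∧
          Stored I (S.erase u) (Function.update tr p T'.1) (Function.update sl p T'.2)
            (Function.update B p (B p + B u)) (c + I.tree.weight s(u, p) * B u) t := by
    have hsize : X.size + Y.size = T.size + (tr p).size := by
      simpa [Tr.length_elems] using hXY.length_eq
    rw [runs_seq]
    refine (runs_merge hp0 hp2 hs'.heap hY hX hYs hYb hXs (N := N) (by omega)).mono ?_
    rintro k t ⟨hk, e, hR, hsl, ha⟩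
    have hspec := Tr.insAll_spec (t := (Y, s'.rreg rSlope)) hYs hYb hXs.2
    have hsz := Tr.size_insAll (t := (Y, s'.rreg rSlope)) hYs hYb hXs.2
    have hst := (hs'.core e ha).attach (p := p) ((e.nreg _ (by norm_num)).trans h13) hR hsl (by
      rw [e.nreg _ (by norm_num), h19, hsz, Tr.length_elems, hsize])
    rw [runs_thenDo, runs_instr]
    refine ⟨?_, ?_, hst.2.2.1, hst.2.2.2, _, hspec.1, hspec.2.1, hspec.2.2.trans hXY, hst.1⟩
    · rw [← hmin]
      simp [attachInstrs]
      omega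
    · exact hst.2.1.trans ((e.nreg _ (by norm_num)).trans h11)
  simp only [mergeCmd, runs_thenDo_cons, runs_thenDo_nil, Instr.exec]
  rw [runs_seq]
  by_cases hlt : T.size < (tr p).size
  · apply runs_branch_true
    · simpa [hu, hp, hcu, hcp, h1, hTsize] using hlt
    simp only [block, runs_thenDo_cons, runs_thenDo_nil, runs_instr, Instr.exec]
    refine (key _ T (tr p) (by simpa using hs) (by simp) (by simp [hp])
      (by simp [hu, hp, hcu, hcp, h1, hTsize]) (by simpa using hT) (by simpa [hp] using htp)
      (by simpa using hTs) (by simpa [hp, hsp] using hps) hpb (min_eq_left hlt.le).symm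
      (by simp [hp, hsp])).mono ?_
    rintro k t ⟨hk, ht⟩
    exact ⟨by omega, ht⟩
  · apply runs_branch_false
    · simpa [hu, hp, hcu, hcp, h1, hTsize] using hlt
    simp only [block, runs_thenDo_cons, runs_thenDo_nil, runs_instr, Instr.exec]
    refine (key _ (tr p) T (by simpa using hs) (by simp) (by simp [hp])
      (by simp [hu, hp, hcu, hcp, h1, hTsize]) (by simpa [hp] using htp) (by simpa using hT)
      (by simpa [hp, hsp] using hps) (by simpa using hTs) hTb
      (min_eq_right (not_lt.1 hlt)).symm
      (by simpa [hp, hsp] using List.perm_append_comm)).mono ?_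
    rintro k t ⟨hk, ht⟩
    exact ⟨by omega, ht⟩

/-- A bound, up to a small factor, of the time of an operation on a tree. There are at most `3 * n`
segments at any time: two for each node, and one more for each cut. -/
def unitTime (n : ℕ) : ℕ := 110 * (2 * Nat.log 2 (3 * n + 1) + 1) + 100

theorem Tr.Balanced.depth_le_of_size {T : Tr} (h : T.Balanced) {N : ℕ} (hN : T.size ≤ N) :
    T.depth ≤ 2 * Nat.log 2 (N + 1) :=
  h.depth_le_log.trans (Nat.mul_le_mul_left 2 (Nat.log_mono_right (by omega)))

theorem runs_stripLeaf (hp0 : procs[0]? = some insBody) (hp1 : procs[1]? = some shiftBody)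
    (hp2 : procs[2]? = some (travBody 2 mergeVisit)) (hred : Reduced I S tr sl B c)
    (hs : Stored I S tr sl B c s) (hu : u ∈ S) (h12 : s.nreg 12 = u) (hdeg : s.narr 2 u = 1) :
    Runs procs (thenDo detachInstrs <| .seq (.call 1) <| .seq (.call 0) mergeCmd) s fun k t =>
      ∃ p ∈ S, p ≠ u ∧ (∀ q ∈ S, I.tree.graph.Adj q u → q = p) ∧
        k + 3 ≤ unitTime n * (min ((tr u).size + 1) (tr p).size + 3) ∧
        t.nreg 11 = s.nreg 11 ∧ t.nreg 12 = p ∧ t.nreg 14 = p ∧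
        ∃ (T' : Tr × ℝ) (B' : Fin n → ℝ) (c' : ℝ), T'.1.size = (tr u).size + 1 + (tr p).size ∧
          Reduced I (S.erase u) (Function.update tr p T'.1) (Function.update sl p T'.2) B' c' ∧
          Stored I (S.erase u) (Function.update tr p T'.1) (Function.update sl p T'.2) B' c' t := by
  classical
  obtain ⟨p, hp, hadj, huniq, hφ⟩ :=
    exists_unique_of_nbrSum_eq_one ((hs.degree u hu).symm.trans hdeg)
  have hpu : p ≠ u := hadj.ne'
  have hpS : p ∈ S.erase u := Finset.mem_erase.2 ⟨hpu, hp⟩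
  have hnbr : s.narr 3 u = p := (hs.nbr u hu).trans (hφ _)
  have hw : s.rarr 5 u = I.tree.weight s(u, p) := (hs.weight u hu).trans (hφ _)
  have hsize : (tr u).size + 1 + (tr p).size ≤ 3 * n := by
    have h := hred.size_le
    have h1 := Finset.card_pos.2 ⟨u, hu⟩
    rw [← Finset.add_sum_erase S _ hu, ← Finset.add_sum_erase _ _ hpS] at h
    omega
  obtain ⟨hd, h11, hR, hsl, hkey, hwr⟩ := hs.detach hu hp hadj huniq h12 hnbr hw
  rw [runs_thenDo]
  generalize execAll s detachInstrs = s₁ at *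
  have hub := hred.balanced u hu
  rw [runs_seq]
  refine runs_call hp1 ?_
  refine (runs_shiftBody hp1 (tr u) s₁ hd.stored.heap hR).mono ?_
  rintro k₁ s₂ ⟨hk₁, e₁, hR₁, hsl₁, hkl₁⟩
  rw [hsl, hkey, hwr] at hR₁ hsl₁ hkl₁
  obtain ⟨hsh, hsh0⟩ := (hred.sorted u hu).shift (w := I.tree.weight s(u, p))
    (I.tree.weight s(u, p)).2 (hred.ne_nil u hu) (hred.nonneg u hu) (hred.le_total u hu)
  have hshb := (Tr.balanced_shift (I.tree.weight s(u, p)) (tr u) (sl u) (B u) hub).1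
  have hshs := Tr.size_shift (I.tree.weight s(u, p)) (tr u) (sl u) (B u)
  have hd₂ := hd.core e₁.toCore e₁.ans
  rw [runs_seq]
  refine runs_call hp0 ?_
  refine (runs_insBody hp0 _ hshb s₂ hd₂.stored.heap hR₁).mono ?_
  rintro k₂ s₃ ⟨hk₂, e₂, hR₂, hsl₂⟩
  have hk : s₂.rreg 2 = _ := congrArg Prod.fst hkl₁
  have hl : s₂.rreg 3 = _ := congrArg Prod.snd hkl₁
  rw [hsl₁, hk, hl] at hR₂ hsl₂
  have hd₃ := hd₂.core e₂.toCore e₂.ans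
  have hins := hsh.ins (k := ((tr u).shift (I.tree.weight s(u, p)) (sl u) (B u)).2.1) hsh0
  have hinsp := Tr.perm_ins ((tr u).shift (I.tree.weight s(u, p)) (sl u) (B u)).2.1
    ((tr u).shift (I.tree.weight s(u, p)) (sl u) (B u)).2.2 hsh
  have hinsb := (Tr.balanced_ins _ (((tr u).shift (I.tree.weight s(u, p)) (sl u) (B u)).1.2)
    ((tr u).shift (I.tree.weight s(u, p)) (sl u) (B u)).2.1
    ((tr u).shift (I.tree.weight s(u, p)) (sl u) (B u)).2.2 hshb).1
  have hinss := Tr.size_ins ((tr u).shift (I.tree.weight s(u, p)) (sl u) (B u)).2.1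
    ((tr u).shift (I.tree.weight s(u, p)) (sl u) (B u)).2.2 hsh
  rw [← hsl₂] at hins hinsp
  rw [hshs] at hinss
  refine (runs_mergeCmd hp0 hp2 hd₃ hpS hR₂ hins hinsb hinss (hred.sorted p hp)
    (hred.balanced p hp) (N := 3 * n) (by omega)).mono ?_
  rintro k₃ t ⟨hk₃, g11, g12, g14, T', g1, g2, g3, g4⟩
  have g5 := g3.trans (hinsp.append_right _)
  refine ⟨p, hp, hpu, fun q hq h => huniq q hq h.symm, ?_, ?_, g12, g14, T', _, _, ?_,
    hred.eliminate hu hp hadj huniq g1 g2 g5, g4⟩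
  · have hdep₁ := hub.depth_le_of_size (N := 3 * n) (by omega)
    have hdep₂ := hshb.depth_le_of_size (N := 3 * n) (by omega)
    rw [hinss] at hk₃
    simp only [detachInstrs, List.length_cons, List.length_nil, unitTime] at hk₁ hk₂ hk₃ ⊢
    generalize Nat.log 2 (3 * n + 1) = Λ at *
    generalize min ((tr u).size + 1) (tr p).size = m at *
    have hm : (110 * (2 * Λ + 1) + 25) * m ≤ (110 * (2 * Λ + 1) + 100) * m :=
      Nat.mul_le_mul_right _ (by omega)
    rw [mul_add]
    omega
  · rw [g11, e₂.nreg _ (by norm_num), e₁.nreg _ (by norm_num), h11]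
  · rw [Tr.size_eq_of_perm g3, List.length_append, Tr.length_elems, Tr.length_elems, hinss]

/-! ### The running time of the stripping -/

/-- The potential of a tree with `m` segments. -/
def potential (m : ℕ) : ℕ := m * Nat.log 2 m

theorem potential_add {a b : ℕ} (ha : 0 < a) (hb : 0 < b) :
    potential a + potential b + min a b ≤ potential (a + b) := by
  wlog h : a ≤ b generalizing a b
  · have := this hb ha (by omega)
    rw [min_comm, add_comm a b]
    omega
  have h1 : Nat.log 2 a + 1 ≤ Nat.log 2 (a + b) := by
    rw [← Nat.log_mul_base (by norm_num) (by omega)]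
    exact Nat.log_mono_right (by omega)
  have h2 : Nat.log 2 b ≤ Nat.log 2 (a + b) := Nat.log_mono_right (by omega)
  rw [min_eq_left h]
  simp only [potential]
  calc a * Nat.log 2 a + b * Nat.log 2 b + a = a * (Nat.log 2 a + 1) + b * Nat.log 2 b := by ring
    _ ≤ a * Nat.log 2 (a + b) + b * Nat.log 2 (a + b) := by gcongr
    _ = _ := by ring

theorem potential_mono {a b : ℕ} (h : a ≤ b) : potential a ≤ potential b :=
  Nat.mul_le_mul h (Nat.log_mono_right h)

/-- The time spent until the nodes in `S` are left, and the node `v` is the next candidate. -/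
def stripTime {n : ℕ} (S : Finset (Fin n)) (tr : Fin n → Tr) (v : ℕ) : ℕ :=
  unitTime n * (∑ x ∈ S, potential (tr x).size + 3 * (n - S.card) + v)

theorem stripTime_erase (hu : u ∈ S) (hp : p ∈ S) (hpu : p ≠ u) (h0 : (tr p).size ≠ 0) {T : Tr}
    (hT : T.size = (tr u).size + 1 + (tr p).size) (v : ℕ) :
    stripTime S tr v + unitTime n * (min ((tr u).size + 1) (tr p).size + 3) ≤
      stripTime (S.erase u) (Function.update tr p T) v := by
  have hpS : p ∈ S.erase u := Finset.mem_erase.2 ⟨hpu, hp⟩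
  rw [stripTime, stripTime, ← mul_add]
  refine Nat.mul_le_mul_left _ ?_
  have hrest : ∑ x ∈ (S.erase u).erase p, potential (Function.update tr p T x).size =
      ∑ x ∈ (S.erase u).erase p, potential (tr x).size :=
    Finset.sum_congr rfl fun x hx => by rw [Function.update_of_ne (Finset.ne_of_mem_erase hx)]
  rw [← Finset.add_sum_erase S _ hu, ← Finset.add_sum_erase (S.erase u) _ hpS,
    ← Finset.add_sum_erase (S.erase u) (fun x => potential (Function.update tr p T x).size) hpS,
    hrest, Function.update_self, Finset.card_erase_of_mem hu, hT]
  have h1 := potential_add (a := (tr u).size + 1) (b := (tr p).size) (by omega) (by omega)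
  have h2 := potential_mono (Nat.le_add_right (tr u).size 1)
  have h3 := Finset.card_pos.2 ⟨u, hu⟩
  have h4 := Finset.card_le_univ S
  simp only [Fintype.card_fin] at h4
  omega

theorem stripTime_singleton {p : Fin n} (h : (tr p).size ≤ 3 * n) :
    stripTime {p} tr n + 3 * unitTime n ≤
      unitTime n * (3 * n * Nat.log 2 (3 * n + 1) + 4 * n) := by
  have h1 := (potential_mono h).trans
    (Nat.mul_le_mul_left (3 * n) (Nat.log_mono_right (b := 2) (by omega : 3 * n ≤ 3 * n + 1)))
  have h2 := p.pos
  rw [stripTime, Finset.sum_singleton, Finset.card_singleton, mul_comm 3 (unitTime n),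
    ← mul_add]
  refine Nat.mul_le_mul_left _ ?_
  generalize 3 * n * Nat.log 2 (3 * n + 1) = x at *
  omega

theorem Tr.size_ne_zero {T : Tr} (h : T ≠ .nil) : T.size ≠ 0 := by
  cases T with
  | nil => exact absurd rfl h
  | node => simp [Tr.size]

open scoped Classical in
/-- The state of the stripping: the nodes in `S` are left, with trees `tr`; the candidate is the
node in register `12`, and no other node up to `v` is a leaf. -/
def Stripping (I : Problem n) (a : Finset (Fin n) × (Fin n → Tr) × ℕ) (s : State) : Prop :=
  ∃ sl B c, Reduced I a.1 a.2.1 sl B c ∧ Stored I a.1 a.2.1 sl B c s ∧ s.nreg 11 = a.2.2 ∧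
    (a.2.2 < n ∧ s.nreg 12 < n ∨ a.2.2 = n ∧ s.nreg 12 = n) ∧
    (∃ r ∈ a.1, s.nreg 14 = r) ∧
    ∀ x ∈ a.1, x.val ≤ a.2.2 → x.val ≠ s.nreg 12 → nbrSum I.tree.graph a.1 (fun _ => 1) x ≠ 1

theorem runs_stripBody (hp0 : procs[0]? = some insBody) (hp1 : procs[1]? = some shiftBody)
    (hp2 : procs[2]? = some (travBody 2 mergeVisit)) {a : Finset (Fin n) × (Fin n → Tr) × ℕ}
    (h : Stripping I a s) (hlt : a.2.2 < n) :
    Runs procs stripBody s fun k t => ∃ a', Stripping I a' t ∧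
      n - a'.2.2 + a'.1.card < n - a.2.2 + a.1.card ∧
      k + 1 + stripTime a.1 a.2.1 a.2.2 ≤ stripTime a'.1 a'.2.1 a'.2.2 := by
  classical
  obtain ⟨S, tr, v⟩ := a
  obtain ⟨sl, B, c, hred, hs, h11, h12, ⟨r, hr, h14⟩, hleaf⟩ := h
  dsimp only at *
  have hun : s.nreg 12 < n := by omega
  lift s.nreg 12 to Fin n using hun with u hu
  rw [eq_comm] at hu
  simp only [stripBody, runs_thenDo_cons, runs_thenDo_nil, Instr.exec]
  by_cases hdeg : s.narr 2 u = 1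
  · have huS : u ∈ S := by
      by_contra huS
      rw [hs.dead u huS] at hdeg
      exact absurd hdeg (by norm_num)
    apply runs_branch_true
    · simp [hu, hdeg, hs.one]
    refine (runs_stripLeaf hp0 hp1 hp2 hred (s := s.setN 17 (s.narr 2 (s.nreg 12)))
      (by simpa using hs) huS (by simpa using hu) (by simpa using hdeg)).mono ?_
    rintro k t ⟨p, hp, hpu, huniq, hk, g11, g12, g14, T', B', c', hT', hred', hs'⟩
    have hpS : p ∈ S.erase u := Finset.mem_erase.2 ⟨hpu, hp⟩
    have htime := stripTime_erase huS hp hpu (Tr.size_ne_zero (hred.ne_nil p hp)) hT' v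
    have hcard := Finset.card_pos.2 ⟨u, huS⟩
    simp at g11
    refine ⟨(S.erase u, Function.update tr p T'.1, v), ⟨_, _, _, hred', hs', g11.trans h11,
      .inl ⟨hlt, g12 ▸ p.2⟩, ⟨p, hpS, g14⟩, fun x hx hxv hxp => ?_⟩, ?_, ?_⟩
    · dsimp only at *
      rw [g12] at hxp
      have hxS := Finset.mem_of_mem_erase hx
      have hxu : ¬ I.tree.graph.Adj x u := fun h => hxp (congrArg _ (huniq x hxS h))
      have hx1 := hleaf x hxS hxv fun h => Finset.ne_of_mem_erase hx (Fin.ext h)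
      rw [nbrSum_erase huS, if_neg hxu, zero_add] at hx1
      exact hx1
    · simp only [Finset.card_erase_of_mem huS]
      omega
    · dsimp only
      omega
  · apply runs_branch_false
    · simpa [hu, hs.one] using hdeg
    simp only [block, runs_thenDo_cons, runs_thenDo_nil, runs_instr, Instr.exec]
    refine ⟨(S, tr, v + 1), ⟨sl, B, c, hred, by simpa using hs, by simp [h11, hs.one], ?_,
      ⟨r, hr, by simpa using h14⟩, fun x hx hxv hxu => ?_⟩, ?_, ?_⟩
    · simp [h11, hs.one]
      omega
    · simp [h11, hs.one] at hxu hxv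
      by_cases hxu' : x = u
      · rw [hxu']
        rwa [hs.degree u (hxu' ▸ hx)] at hdeg
      · exact hleaf x hx (by omega) fun h => hxu' (Fin.ext h)
    · dsimp only
      omega
    · have h6 : 6 ≤ unitTime n := by
        rw [unitTime]
        omega
      simp only [stripTime]
      rw [← add_assoc (_ + _) v 1, mul_add _ _ 1]
      omega

theorem runs_strip (hp0 : procs[0]? = some insBody) (hp1 : procs[1]? = some shiftBody)
    (hp2 : procs[2]? = some (travBody 2 mergeVisit)) (h : Stripping I (Finset.univ, tr, 0) s) :
    Runs procs (.loop (.nlt 11 0) stripBody) s fun k t =>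
      k ≤ unitTime n * (3 * n * Nat.log 2 (3 * n + 1) + 4 * n) + 1 ∧
      ∃ (p : Fin n) (tr : Fin n → Tr) (sl B : Fin n → ℝ) (c : ℝ), Reduced I {p} tr sl B c ∧
        Stored I {p} tr sl B c t ∧ t.nreg 14 = p := by
  classical
  refine (runs_loop (Stripping I) (fun a => stripTime a.1 a.2.1 a.2.2)
    (fun a => n - a.2.2 + a.1.card) ?_ (Finset.univ, tr, 0) s h).mono ?_
  · rintro a s h hb
    obtain ⟨sl, B, c, hred, hs, h11, -⟩ := id h
    refine runs_stripBody hp0 hp1 hp2 h ?_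
    simpa [h11, hs.zero] using hb
  · rintro k t ⟨⟨S, tr, v⟩, ⟨sl, B, c, hred, hs, h11, h12, ⟨p, hp, h14⟩, hleaf⟩, hb, hk⟩
    dsimp only at *
    simp only [Test.Holds, h11, hs.zero] at hb
    have hv : v = n := by omega
    -- no node is a leaf, so only one is left
    have hcard : S.card ≤ 1 := by
      by_contra hcard
      obtain ⟨u, hu, q, hq, hadj, huniq⟩ := hred.convex.exists_leaf (not_le.1 hcard)
      have hun := u.2
      refine hleaf u hu (by omega) (by omega) ?_
      have : Finset.filter (I.tree.graph.Adj u) S = {q} := by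
        ext x
        simp only [Finset.mem_filter, Finset.mem_singleton]
        exact ⟨fun h => huniq x h.1 h.2, fun h => h ▸ ⟨hq, hadj⟩⟩
      simp [nbrSum, this]
    obtain rfl : S = {p} := Finset.eq_singleton_iff_unique_mem.2
      ⟨hp, fun x hx => Finset.card_le_one.1 hcard x hx p hp⟩
    have hsize := hred.size_le
    simp only [Finset.sum_singleton, Finset.card_singleton] at hsize
    have htime := stripTime_singleton (tr := tr) (p := p) (by omega)
    subst hv
    exact ⟨by omega, p, tr, sl, B, c, hred, hs, h14⟩

end Stripping

/-! ### The program -/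

/-- The program computing the GKR distance. Registers `15` and `16` hold `n - 1` and `1`; register
`11` runs over the edges and, twice, over the nodes; register `14` holds the number of a remaining
node. Array `4` and real array `6` hold the index of the root and the root slope of the tree of each
node, array `5` the number of its segments, and real array `4` its offset. -/
def treeProgram : Program where
  procs := [insBody, shiftBody, travBody 2 mergeVisit, travBody 3 evalVisit]
  main :=
    thenDo [.nconst 16 1, .nsub 15 0 16] <|
    .seq (.loop (.nlt 11 15) edgeBody) <|
    thenDo [.nconst 11 0] <|
    .seq (.loop (.nlt 11 0) initBody) <|
    thenDo [.nconst 11 0, .nconst 12 0, .nconst 14 0] <|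
    .seq (.loop (.nlt 11 0) stripBody) <|
    thenDo [.rload rPos 4 14, .nload nVisit 4 14, .rload rVisit 6 14] (.call 3)

/-- A bound of the running time of the program. -/
def timeBound (n : ℕ) : ℕ := 700 * (n + 1) * (Nat.log 2 n + 4) ^ 2

theorem le_timeBound {n : ℕ} (hn : 0 < n) :
    unitTime n * (3 * n * Nat.log 2 (3 * n + 1) + 4 * n) + 572 * n + 20 ≤ timeBound n := by
  have hlog : Nat.log 2 (3 * n + 1) ≤ Nat.log 2 n + 2 := by
    calc Nat.log 2 (3 * n + 1) ≤ Nat.log 2 (n * 2 * 2) := Nat.log_mono_right (by omega)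
      _ = Nat.log 2 n + 2 := by
        rw [Nat.log_mul_base (by norm_num) (by omega), Nat.log_mul_base (by norm_num) (by omega)]
  rw [timeBound, unitTime]
  generalize Nat.log 2 (3 * n + 1) = Λ at *
  generalize Nat.log 2 n = L at *
  have h1 : 110 * (2 * Λ + 1) + 100 ≤ 220 * (L + 4) := by omega
  have h2 : 3 * n * Λ + 4 * n ≤ 3 * n * (L + 4) := by
    calc 3 * n * Λ + 4 * n ≤ 3 * n * (L + 2) + 6 * n := by gcongr; norm_num
      _ = 3 * n * (L + 4) := by ring
  have h3 := Nat.mul_le_mul h1 h2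
  have h4 : 16 * (n + 1) ≤ (L + 4) ^ 2 * (n + 1) := Nat.mul_le_mul_right _ (by nlinarith)
  nlinarith

theorem isBigO_timeBound : Asymptotics.IsBigO Filter.atTop (fun n : ℕ => (timeBound n : ℝ))
    fun n : ℕ => (n : ℝ) * Real.log n ^ 2 := by
  refine Asymptotics.IsBigO.of_bound (1400 * (5 / Real.log 2) ^ 2) ?_
  filter_upwards [Filter.eventually_ge_atTop 2] with n hn
  have h2 : 0 < Real.log 2 := Real.log_pos (by norm_num)
  have hn' : (2 : ℝ) ≤ n := by exact_mod_cast hn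
  have hlog : Real.log 2 ≤ Real.log n := Real.log_le_log (by norm_num) hn'
  have h1 : (Nat.log 2 n : ℝ) ≤ Real.log n / Real.log 2 := by
    simpa [Real.logb] using Real.natLog_le_logb n 2
  have h3 : (1 : ℝ) ≤ Real.log n / Real.log 2 := (one_le_div h2).2 hlog
  have h4 : (Nat.log 2 n : ℝ) + 4 ≤ 5 / Real.log 2 * Real.log n := by
    calc (Nat.log 2 n : ℝ) + 4 ≤ Real.log n / Real.log 2 + 4 * (Real.log n / Real.log 2) := by
          linarith
      _ = _ := by ring
  rw [Real.norm_of_nonneg (by positivity), Real.norm_of_nonneg (by positivity), timeBound]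
  push_cast
  calc 700 * ((n : ℝ) + 1) * ((Nat.log 2 n : ℝ) + 4) ^ 2
      ≤ 700 * (2 * n) * (5 / Real.log 2 * Real.log n) ^ 2 := by
        gcongr
        linarith
    _ = _ := by ring

variable {n : ℕ} {I : Problem n} {s t : State}

open scoped Classical in
theorem EdgesRead.nbrSums {e : EdgeList I.tree.graph}
    (h : EdgesRead (((I.initialState e).setN 16 1).setN 15 (n - 1)) (n - 1) t) (v : Fin n) :
    t.narr 2 v = nbrSum I.tree.graph Finset.univ (fun _ => 1) v ∧
      t.narr 3 v = nbrSum I.tree.graph Finset.univ (fun q => (q : ℕ)) v ∧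
      t.rarr 5 v = nbrSum I.tree.graph Finset.univ (fun q => (I.tree.weight s(v, q) : ℝ)) v := by
  refine ⟨(h.degree v).trans ?_, (h.nbr v).trans ?_, (h.weight v).trans ?_⟩
  all_goals refine endSum_eq e (fun _ => rfl) (fun _ => rfl) v ?_ ?_
  · simp
  · simp
  · simp [Problem.initialState, toArray]
  · simp [Problem.initialState, toArray]
  · rintro j rfl
    simp [Problem.initialState, toArray]
  · rintro j rfl
    simp [Problem.initialState, toArray, Sym2.eq_swap]

theorem treeProgram_solves (I : Problem n) (e : EdgeList I.tree.graph) :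
    treeProgram.Solves I e (timeBound n) := by
  classical
  obtain ⟨v₀⟩ := I.tree.isTree.1.nonempty
  have hn := v₀.pos
  suffices h : Runs treeProgram.procs treeProgram.main (I.initialState e) fun k t =>
      k ≤ timeBound n ∧ I.IsSolution (t.rreg 0) from h
  have hp0 : treeProgram.procs[0]? = some insBody := rfl
  have hp1 : treeProgram.procs[1]? = some shiftBody := rfl
  have hp2 : treeProgram.procs[2]? = some (travBody 2 mergeVisit) := rfl
  have hp3 : treeProgram.procs[3]? = some (travBody 3 evalVisit) := rfl
  generalize treeProgram.procs = procs at *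
  simp only [treeProgram, runs_thenDo_cons, runs_thenDo_nil, Instr.exec]
  have h0 : (I.initialState e).nreg 0 = n := rfl
  rw [runs_seq]
  simp only [setN_nreg, h0]
  simp only [Nat.reduceEqDiff, if_true, if_false]
  refine (runs_edges rfl rfl (fun _ => rfl) (fun _ => rfl) fun _ => rfl).mono ?_
  rintro k₁ s₁ ⟨hk₁, h₁⟩
  have hk₁' : k₁ ≤ 24 * (n - 1) + 1 := by simpa using hk₁
  replace h₁ : EdgesRead (((I.initialState e).setN 16 1).setN 15 (n - 1)) (n - 1) s₁ := by
    simpa using h₁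
  have hsums := h₁.nbrSums
  have hr1 (A i : ℕ) (hA : A ≠ 5) : s₁.rarr A i = (I.initialState e).rarr A i :=
    congrFun (h₁.rarr A hA) i
  have hn1 (A i : ℕ) (hA : A ≠ 2) (hA' : A ≠ 3) : s₁.narr A i = (I.initialState e).narr A i :=
    congrFun (h₁.narr A hA hA') i
  simp only [runs_thenDo_cons, runs_thenDo_nil, Instr.exec]
  rw [runs_seq]
  refine (runs_init hp0 (I := I) (s := s₁.setN 11 0) ⟨?_, ?_, ?_, ?_, ?_, ?_, fun _ _ _ => rfl,
    fun _ _ _ => rfl, ?_, ?_, ?_⟩ ?_ ?_ ?_ ?_).mono ?_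
  · exact heap_setN.2 ⟨hn1 _ _ (by norm_num) (by norm_num), hn1 _ _ (by norm_num) (by norm_num),
      hr1 _ _ (by norm_num)⟩
  · simp
  · simp
  · simp [h₁.nreg 0 (by simp), h0]
  · simp [h₁.nreg 16 (by simp)]
  · simp [h₁.ans, Problem.initialState]
  · simp
  · simp
  · simp
  · intro v
    simp [hr1, Problem.initialState, toArray]
  · intro v
    simp [hr1, Problem.initialState, toArray]
  · intro v
    simp [hr1, Problem.initialState, toArray]
  · intro v
    simp [hr1, Problem.initialState, toArray]
  rintro k₂ s₂ ⟨hk₂, h₂⟩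
  simp only [runs_thenDo_cons, runs_thenDo_nil, Instr.exec]
  rw [runs_seq]
  have hspec := I.initTree_spec
  have hred := Reduced.init (fun v => (hspec v).2.2) (fun v => (hspec v).1) fun v => (hspec v).2.1
  have hst : Stored I Finset.univ (fun v => (I.initTree v).1) (fun v => (I.initTree v).2)
      (fun v => I.target v) (∑ v, (I.destroy v : ℝ) * I.source v) s₂ := by
    refine ⟨h₂.heap, h₂.zero, h₂.one, ?_, fun v _ => h₂.tree v v.2, fun v _ => h₂.slope v v.2,
      fun v _ => ?_, fun v _ => ?_, fun v _ => ?_, fun v _ => ?_, fun v _ => ?_, fun v hv => ?_⟩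
    · rw [h₂.ans]
      simp
    · rw [h₂.rarr _ _ (by norm_num)]
      simp [hr1, Problem.initialState, toArray]
    · rw [h₂.count v v.2, Tr.size_eq_of_perm (hspec v).2.2]
      rfl
    · rw [h₂.narr _ _ (by norm_num)]
      exact (hsums v).1
    · rw [h₂.narr _ _ (by norm_num)]
      exact (hsums v).2.1
    · rw [h₂.rarr _ _ (by norm_num)]
      exact (hsums v).2.2
    · exact absurd (Finset.mem_univ v) hv
  refine (runs_strip hp0 hp1 hp2 (I := I) (tr := fun v => (I.initTree v).1) ⟨_, _, _, hred,
    by simpa using hst, by simp, .inl ⟨hn, by simpa using hn⟩, ⟨⟨0, hn⟩, by simp, by simp⟩,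
    fun x _ hx hx' => absurd (by simpa using hx) (by simpa using hx')⟩).mono ?_
  rintro k₃ s₃ ⟨hk₃, p, tr, sl, B, c, hred₃, h₃, h14⟩
  have hp := Finset.mem_singleton_self p
  simp only [runs_thenDo_cons, runs_thenDo_nil, Instr.exec]
  refine (runs_eval hp3 (T := tr p) (by simpa using h₃.heap)
    (by simpa [h14] using h₃.tree p hp)).mono ?_
  rintro k₄ s₄ ⟨hk₄, ha⟩
  refine ⟨?_, ?_⟩
  · have hsize := hred₃.size_le
    simp only [Finset.sum_singleton, Finset.card_singleton] at hsize
    have := le_timeBound hn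
    omega
  · have hsol := hred₃.isSolution
    simp [h14, h₃.ans, h₃.offset p hp, h₃.slope p hp] at ha
    rwa [← ha] at hsol

end GKR

theorem theorem3 :
    ∃ (P : GKR.Program) (T : ℕ → ℕ),
      Asymptotics.IsBigO Filter.atTop (fun n : ℕ => (T n : ℝ))
        (fun n : ℕ => (n : ℝ) * (Real.log (n : ℝ)) ^ 2) ∧
      ∀ (n : ℕ) (I : GKR.Problem n) (e : GKR.EdgeList I.tree.graph), P.Solves I e (T n) :=
  ⟨GKR.treeProgram, GKR.timeBound, GKR.isBigO_timeBound, fun _ I e =>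
    GKR.treeProgram_solves I e⟩
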